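/- **Setup.** Work in $\mathbb{Q}[[q]]$. Let $\bar1$ be a formal symbol. For a finite sequence $\boldsymbol k=(k_1,\dots,k_r)$ with $k_i\in\{\bar1\}\cup\mathbb{Z}_{\ge1}$ and ($r=0$ or $k_r\ne\bar1$), put $$\zeta_q^\dagger(\boldsymbol k)=\sum_{\substack{0<n_1\le\cdots\le n_r\\ n_i<n_{i+1}\ (k_i\ne\bar1)}}\ \prod_{\substack{1\le j\le r\\ k_j\neq\bar1}}\frac{q^{n_j}}{(1-q^{n_j})^{k_j}},$$ and for $\boldsymbol k\in\mathbb{Z}_{\ge1}^r$ with ($r=0$ or $k_r\ne1$) put $$\zeta_q^{\mathrm{BZ}}(\boldsymbol k)=\sum_{0<n_1<\cdots<n_r}\ \prod_{j=1}^r\frac{q^{n_j(k_j-1)}}{(1-q^{n_j})^{k_j}}.$$ Let $\mathfrak h=\mathbb{Z}\langle x,y\rangle$, $\mathfrak h^1=\mathbb{Z}+y\mathfrak h$, $\mathfrak h^0=\mathbb{Z}+y\mathfrak hx$, $\mathfrak h^{\ge2}=\mathbb{Z}+yx\,\mathbb{Z}\langle x,yx\rangle\subset\mathfrak h^0$. Let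 $Z_q^\dagger:\mathfrak h^1\to\mathbb{Q}[[q]]$ and $Z_q^{\mathrm{BZ}}:\mathfrak h^0\to\mathbb{Q}[[q]]$ be the $\mathbb{Z}$-linear maps with $yx^{k_1-1}\cdots yx^{k_r-1}\mapsto\zeta_q^\dagger(k_1,\dots,k_r)$, respectively $\mapsto\zeta_q^{\mathrm{BZ}}(k_1,\dots,k_r)$ (and $1\mapsto1$). **Combinatorial notation.** Write $[n]=\{1,\dots,n\}$. Let $\mathcal T(r)$ be the set of all $S\cup S'$ with $S\cap S'=\emptyset$, where $S=\bigcup_{j\in R}\{2j,2j+1\}$ for some $R\subset[r-1]$ (and $[r-1]=\emptyset$ if $r=0$), and $S'=\bigcup_{j\in R'}\{2j-1,2j\}$ for some $R'\subset[r]$ such that no two elements of $S'$ differ by $2$. For finite $S\subset\mathbb{Z}_{>0}$ put $\kappa(S)=\#S/2$ (used for $S\in\mathcal T(r)$), $\mathrm{eo}(S)=\#\{j\ge1\mid\{2j,2j+1\}\subset S\}$ and $\sigma_S(i)=\#([i]\setminus S)$ for $i\notin S$. For $B\subset[2s]$ put $$\alpha(B)=\#\{0\le i\le s\mid B\cap\{2i,2i+1\}\ne\emptyset\},\qquad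 \beta(B)=\#\{1\le i\le s\mid B\cap\{2i-1,2i\}\neq\emptyset\},$$ and $\beta_A(B)=\beta(\sigma_A(B))$ if $A\cap B=\emptyset$. For $\boldsymbol c\in\mathbb{Z}_{\ge1}^{2r}$ let $[2r]^1_{\boldsymbol c}=\{i\mid c_i=1\}$ and $[2r]^{>1}_{\boldsymbol c}=\{i\mid c_i>1\}$; for $A\subset[2r]^1_{\boldsymbol c}$ and $B\subset[2r]^{>1}_{\boldsymbol c}$ let $\boldsymbol c_{A,B}$ be obtained from $\boldsymbol c$ by subtracting $1$ from the entries indexed by $B$ and deleting the entries indexed by $A$. **The words.** For $\epsilon\in\{0,1\}$ define $\mathfrak E^\epsilon_q(\boldsymbol c)\in\mathfrak h$ recursively by $\mathfrak E_q^\epsilon(\emptyset)=1$ and, for $r\ge1$, $$\begin{aligned}\mathfrak E_q^\epsilon(\boldsymbol c)=&-\sum_{\emptyset\ne B\subset[2r]^{>1}_{\boldsymbol c}}(-1)^{\#B}\,\mathfrak E_q^\epsilon(\boldsymbol c_{\emptyset,B})\,x^{\alpha(B)}+\sum_{\emptyset\ne B\subset[2r]^{>1}_{\boldsymbol c}}(-1)^{\#B}\,\mathfrak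 E_q^\epsilon(\boldsymbol c_{\emptyset,B})\sum_{h=\alpha(B)+1}^{\beta(B)}yx^{h-1}\\&+\sum_{\substack{\emptyset\ne A\subset[2r]^1_{\boldsymbol c},\ A\in\mathcal T(r)\\ B\subset[2r]^{>1}_{\boldsymbol c}}}\ \sum_{h=1}^{\kappa(A)}(-1)^{\mathrm{eo}(A)+\#B+\kappa(A)-h}\binom{\kappa(A)-1}{h-1}\,\mathfrak E_q^\epsilon(\boldsymbol c_{A,B})\,yx^{h+\epsilon\kappa(A)+\beta_A(B)-1},\end{aligned}$$ where $\sum_{h=\alpha+1}^{\beta}$ means $-\sum_{h=\beta+1}^{\alpha}$ if $\alpha>\beta$. Let $\theta$ be the automorphism of $\mathfrak h$ with $\theta(x)=-x$, $\theta(y)=-y$, and put $\mathfrak E_q(\boldsymbol c)=\mathfrak E_q^0(\boldsymbol c)$ and $\mathfrak D_q(\boldsymbol c)=(-1)^{c_1+\cdots+c_{2r}}\,\theta(\mathfrak E_q^1(\boldsymbol c))$. **Theorem.** Let $r\ge0$ and $l_1,\dots,l_r,k_1,\dots,k_r\in\mathbb{Z}_{\ge1}$. Then $\mathfrak E_q(l_1,k_1,\dots,l_r,k_r)\in\mathfrak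 h^1$, $\mathfrak D_q(l_1,k_1,\dots,l_r,k_r)\in\mathfrak h^{\ge2}$, and $$\zeta_q^\dagger(\{\bar1\}^{l_1-1},k_1,\dots,\{\bar1\}^{l_r-1},k_r)=Z_q^\dagger\bigl(\mathfrak E_q(l_1,k_1,\dots,l_r,k_r)\bigr),$$ $$\zeta_q^{\mathrm{BZ}}(\{1\}^{l_1-1},k_1+1,\dots,\{1\}^{l_r-1},k_r+1)=Z_q^{\mathrm{BZ}}\bigl(\mathfrak D_q(l_1,k_1,\dots,l_r,k_r)\bigr),$$ where $\{a\}^m$ denotes $a$ repeated $m$ times. -/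

import Mathlib

open scoped PowerSeries.WithPiTopology

namespace QMZV

/-! ### The two models of `q`-multiple zeta values

The indeterminate `q` is `PowerSeries.X : PowerSeries ℚ`.  Infinite sums are taken in `ℚ[[q]]`
with the topology of coefficientwise convergence. -/

/-- Entries of an index: the formal symbol `bar1`, or an integer. -/
inductive Entry where
  | bar1 : Entry
  | int (k : ℕ) : Entry

/-- The summation domain `0 < n₁ ≤ ⋯ ≤ n_r`, with `n_i < n_{i+1}` whenever `k_i ≠ bar1`. -/
def DagDomain (k : List Entry) (n : Fin k.length → ℕ) : Prop :=
  (∀ i, 0 < n i) ∧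
    ∀ i j : Fin k.length, (i : ℕ) + 1 = j → n i ≤ n j ∧ (k.get i ≠ Entry.bar1 → n i < n j)

/-- The factor of an entry: `1` for `bar1`, and `q^n / (1 - q^n)^k` for an integer `k`. -/
noncomputable def dagFactor : Entry → ℕ → PowerSeries ℚ
  | Entry.bar1, _ => 1
  | Entry.int k, n => PowerSeries.X ^ n * ((1 - PowerSeries.X ^ n)⁻¹) ^ k

/-- The summand of `ζ_q^†(k)` at `n = (n₁, …, n_r)`. -/
noncomputable def dagTerm (k : List Entry) (n : Fin k.length → ℕ) : PowerSeries ℚ :=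
  ∏ j, dagFactor (k.get j) (n j)

/-- `ζ_q^†(k)`, for an index `k` that is empty or whose last entry is not `bar1`. -/
noncomputable def zetaDag (k : List Entry) : PowerSeries ℚ :=
  ∑' n : {n : Fin k.length → ℕ // DagDomain k n}, dagTerm k n.1

/-- The summation domain `0 < n₁ < ⋯ < n_r`. -/
def BZDomain {r : ℕ} (n : Fin r → ℕ) : Prop :=
  (∀ i, 0 < n i) ∧ StrictMono n

/-- The summand `∏ q^(n_j (k_j - 1)) / (1 - q^(n_j))^(k_j)` of `ζ_q^BZ(k)`. -/
noncomputable def bzTerm (k : List ℕ) (n : Fin k.length → ℕ) : PowerSeries ℚ :=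
  ∏ j, PowerSeries.X ^ (n j * (k.get j - 1)) * ((1 - PowerSeries.X ^ n j)⁻¹) ^ k.get j

/-- The Bradley–Zhao value `ζ_q^BZ(k)`, for an index `k` of positive integers that is empty or
whose last entry is not `1`. -/
noncomputable def zetaBZ (k : List ℕ) : PowerSeries ℚ :=
  ∑' n : {n : Fin k.length → ℕ // BZDomain n}, bzTerm k n.1

/-! ### The algebra `𝔥 = ℤ⟨x, y⟩` and the maps `Z` -/

inductive Letter where
  | x : Letter
  | y : Letter

/-- `𝔥 = ℤ⟨x, y⟩`. -/
abbrev H : Type := FreeAlgebra ℤ Letter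

noncomputable def X : H := FreeAlgebra.ι ℤ Letter.x

noncomputable def Y : H := FreeAlgebra.ι ℤ Letter.y

/-- `𝔥¹ = ℤ + y𝔥`. -/
noncomputable def H1 : Submodule ℤ H :=
  Submodule.span ℤ {1} ⊔ LinearMap.range (LinearMap.mulLeft ℤ Y)

/-- `𝔥⁰ = ℤ + y𝔥x`. -/
noncomputable def H0 : Submodule ℤ H :=
  Submodule.span ℤ {1} ⊔ LinearMap.range (LinearMap.mulLeft ℤ Y ∘ₗ LinearMap.mulRight ℤ X)

/-- `𝔥^{≥2} = ℤ + yx ℤ⟨x, yx⟩`. -/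
noncomputable def Hge2 : Submodule ℤ H :=
  Submodule.span ℤ {1} ⊔
    (Subalgebra.toSubmodule (Algebra.adjoin ℤ {X, Y * X})).map (LinearMap.mulLeft ℤ (Y * X))

/-- For a word `x^m y x^(k₁-1) ⋯ y x^(k_r-1)`, the pair `(m, [k₁, …, k_r])`. -/
def decode : List Letter → ℕ × List ℕ
  | [] => (0, [])
  | Letter.x :: w => ((decode w).1 + 1, (decode w).2)
  | Letter.y :: w => (0, ((decode w).1 + 1) :: (decode w).2)

/-- The linear map on `𝔥` with `y x^(k₁-1) ⋯ y x^(k_r-1) ↦ f [k₁, …, k_r]`, and with value `0` on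
the words that begin with `x`. -/
noncomputable def extend (f : List ℕ → PowerSeries ℚ) : H →ₗ[ℤ] PowerSeries ℚ :=
  (FreeAlgebra.basisFreeMonoid ℤ Letter).constr ℤ fun w : FreeMonoid Letter =>
    if (decode w.toList).1 = 0 then f (decode w.toList).2 else 0

/-- `Z_q^† : 𝔥¹ → ℚ[[q]]`. -/
noncomputable def ZDag : H1 →ₗ[ℤ] PowerSeries ℚ :=
  (extend fun k => zetaDag (k.map Entry.int)).domRestrict H1

/-- `Z_q^BZ : 𝔥⁰ → ℚ[[q]]`. -/
noncomputable def ZBZ : H0 →ₗ[ℤ] PowerSeries ℚ :=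
  (extend zetaBZ).domRestrict H0

/-- The word `y x^(k₁-1) ⋯ y x^(k_r-1)`. -/
noncomputable def word (k : List ℕ) : H := (k.map fun m => Y * X ^ (m - 1)).prod

/-! ### Subsets of `{1, …, n}` and partial domino tilings -/

/-- `EO(r)`: unions of even-odd dominoes `{2j, 2j+1}`, `1 ≤ j ≤ r - 1`. -/
def EO (r : ℕ) : Finset (Finset ℕ) :=
  (Finset.Icc 1 (r - 1)).powerset.image fun R => R.biUnion fun j => {2 * j, 2 * j + 1}

/-- `OE(r)`: unions of odd-even dominoes `{2j-1, 2j}`, `1 ≤ j ≤ r`. -/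
def OE (r : ℕ) : Finset (Finset ℕ) :=
  (Finset.Icc 1 r).powerset.image fun R => R.biUnion fun j => {2 * j - 1, 2 * j}

/-- `OE*(r)`: the members of `OE(r)` in which no two elements differ by `2`. -/
def OEstar (r : ℕ) : Finset (Finset ℕ) :=
  (OE r).filter fun S => ∀ i ∈ S, ∀ j ∈ S, |(i : ℤ) - (j : ℤ)| ≠ 2

/-- `𝒯(r)`: the disjoint unions `S ∪ S'` with `S ∈ EO(r)` and `S' ∈ OE*(r)`. -/
def Tilings (r : ℕ) : Finset (Finset ℕ) :=
  ((EO r ×ˢ OEstar r).filter fun p => Disjoint p.1 p.2).image fun p => p.1 ∪ p.2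

/-- `κ(T) = #T / 2`. -/
def kappa (T : Finset ℕ) : ℕ := T.card / 2

/-- `eo(S)`: the number of `j ≥ 1` with `{2j, 2j+1} ⊆ S`. -/
def eo (S : Finset ℕ) : ℕ :=
  ((Finset.Icc 1 (S.sup id)).filter fun j => {2 * j, 2 * j + 1} ⊆ S).card

/-- `σ_S(i) = #([i] \ S)`. -/
def sigma (S : Finset ℕ) (i : ℕ) : ℕ := (Finset.Icc 1 i \ S).card

/-- `α(B)`, for `B ⊆ [2s]`. -/
def alpha (s : ℕ) (B : Finset ℕ) : ℕ :=
  ((Finset.Icc 0 s).filter fun i => (B ∩ {2 * i, 2 * i + 1}).Nonempty).card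

/-- `β(B)`, for `B ⊆ [2s]`. -/
def beta (s : ℕ) (B : Finset ℕ) : ℕ :=
  ((Finset.Icc 1 s).filter fun i => (B ∩ {2 * i - 1, 2 * i}).Nonempty).card

/-- `β_A(B) = β(σ_A(B))`. -/
def betaA (s : ℕ) (A B : Finset ℕ) : ℕ := beta s (B.image (sigma A))

/-- The positions `i ∈ [n]` (counted from `1`) with `c_i = 1`. -/
def posOne (c : List ℕ) : Finset ℕ :=
  (Finset.Icc 1 c.length).filter fun i => c.getD (i - 1) 0 = 1

/-- The positions `i ∈ [n]` (counted from `1`) with `c_i > 1`. -/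
def posGt (c : List ℕ) : Finset ℕ :=
  (Finset.Icc 1 c.length).filter fun i => 1 < c.getD (i - 1) 0

/-- `c_{A,B}`: subtract `1` from the entries at the positions in `B` and delete the entries at the
positions in `A`. -/
def modify (c : List ℕ) (A B : Finset ℕ) : List ℕ :=
  ((List.range c.length).filter fun i => i + 1 ∉ A).map fun i =>
    if i + 1 ∈ B then c.getD i 0 - 1 else c.getD i 0

/-! ### The words `𝔈_q` and `𝔇_q` -/

theorem sum_filter_map_lt (L : List ℕ) (p : ℕ → Bool) (f g : ℕ → ℕ) (hfg : ∀ i, f i ≤ g i)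
    (h : ∃ i ∈ L, (p i = false ∧ 0 < g i) ∨ (p i = true ∧ f i < g i)) :
    ((L.filter p).map f).sum < (L.map g).sum := by
  have hle : ∀ L : List ℕ, ((L.filter p).map f).sum ≤ (L.map g).sum := by
    intro L
    induction L with
    | nil => simp
    | cons a L ih =>
      have := hfg a
      by_cases ha : p a = true <;> simp [ha] <;> omega
  induction L with
  | nil => simp at h
  | cons a L ih =>
    obtain ⟨i, hi, h⟩ := h
    have h1 := hle L
    have h2 := hfg a
    rcases List.mem_cons.1 hi with rfl | hi
    · rcases h with ⟨hp, h⟩ | ⟨hp, h⟩ <;> simp [hp] <;> omega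
    · have := ih ⟨i, hi, h⟩
      by_cases ha : p a = true <;> simp [ha] <;> omega

theorem modify_sum_lt {c : List ℕ} {A B : Finset ℕ} (hA : A ⊆ posOne c) (hB : B ⊆ posGt c)
    (h : A.Nonempty ∨ B.Nonempty) : (modify c A B).sum < c.sum := by
  have hc : (List.range c.length).map (fun i => c.getD i 0) = c := by
    apply List.ext_getElem
    · simp
    · intro i h1 h2
      simp [List.getElem?_eq_getElem h2]
  refine lt_of_lt_of_eq (b := ((List.range c.length).map fun i => c.getD i 0).sum) ?_
    (congrArg List.sum hc)
  apply sum_filter_map_lt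
  · intro i
    split_ifs <;> omega
  · have hpos : ∀ i, 1 ≤ i → i ≤ c.length → i - 1 ∈ List.range c.length := by
      intro i h1 h2
      rw [List.mem_range]
      omega
    rcases h with ⟨i, hi⟩ | ⟨i, hi⟩
    · have h1 := Finset.mem_filter.1 (hA hi)
      have h2 := Finset.mem_Icc.1 h1.1
      refine ⟨i - 1, hpos i h2.1 h2.2, ?_⟩
      have h3 : i - 1 + 1 = i := by omega
      simp only [h3]
      left
      exact ⟨by simpa using hi, by omega⟩
    · have h1 := Finset.mem_filter.1 (hB hi)
      have h2 := Finset.mem_Icc.1 h1.1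
      have h3 : i - 1 + 1 = i := by omega
      refine ⟨i - 1, hpos i h2.1 h2.2, Or.inr ?_⟩
      simp only [h3, hi, if_true]
      refine ⟨?_, by omega⟩
      have h4 : i ∉ A := fun hiA => by
        have h5 := Finset.mem_filter.1 (hA hiA)
        omega
      simpa using h4

/-- The recursively defined element `𝔈_q^ε(c)`, for `c = (c₁, …, c_{2r})` with all `c_i ≥ 1` and
`ε ∈ {0, 1}`; see `EE_nil` and `EE_eq` for the recursion in its usual form.  The sum of `y x^(h-1)`
over `α(B) < h ≤ β(B)` means minus the sum over `β(B) < h ≤ α(B)` if `α(B) > β(B)`. -/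
noncomputable def EE (ε : ℕ) (c : List ℕ) : H :=
  if c = [] then 1 else
  - ∑ B ∈ ((posGt c).powerset.filter fun B => B.Nonempty).attach,
      (-1 : ℤ) ^ B.1.card • (EE ε (modify c ∅ B.1) * X ^ alpha (c.length / 2) B.1)
  + ∑ B ∈ ((posGt c).powerset.filter fun B => B.Nonempty).attach,
      (-1 : ℤ) ^ B.1.card • (EE ε (modify c ∅ B.1) *
        (∑ h ∈ Finset.Ioc (alpha (c.length / 2) B.1) (beta (c.length / 2) B.1), Y * X ^ (h - 1)
          - ∑ h ∈ Finset.Ioc (beta (c.length / 2) B.1) (alpha (c.length / 2) B.1),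
              Y * X ^ (h - 1)))
  + ∑ A ∈ ((Tilings (c.length / 2)).filter fun A => A.Nonempty ∧ A ⊆ posOne c).attach,
      ∑ B ∈ (posGt c).powerset.attach,
        ∑ h ∈ Finset.Icc 1 (kappa A.1),
          ((-1 : ℤ) ^ (eo A.1 + B.1.card + (kappa A.1 - h)) *
              ((kappa A.1 - 1).choose (h - 1) : ℤ)) •
            (EE ε (modify c A.1 B.1) * Y *
              X ^ (h + ε * kappa A.1 + betaA (c.length / 2) A.1 B.1 - 1))
termination_by c.sum
decreasing_by
  · have hB := Finset.mem_filter.1 B.2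
    exact modify_sum_lt (Finset.empty_subset _) (Finset.mem_powerset.1 hB.1) (Or.inr hB.2)
  · have hB := Finset.mem_filter.1 B.2
    exact modify_sum_lt (Finset.empty_subset _) (Finset.mem_powerset.1 hB.1) (Or.inr hB.2)
  · have hA := (Finset.mem_filter.1 A.2).2
    exact modify_sum_lt hA.2 (Finset.mem_powerset.1 B.2) (Or.inl hA.1)

theorem EE_nil (ε : ℕ) : EE ε [] = 1 := by
  rw [EE, if_pos rfl]

theorem EE_eq (ε : ℕ) {c : List ℕ} (hc : c ≠ []) :
    EE ε c =
      - ∑ B ∈ (posGt c).powerset.filter (fun B => B.Nonempty),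
          (-1 : ℤ) ^ B.card • (EE ε (modify c ∅ B) * X ^ alpha (c.length / 2) B)
      + ∑ B ∈ (posGt c).powerset.filter (fun B => B.Nonempty),
          (-1 : ℤ) ^ B.card • (EE ε (modify c ∅ B) *
            (∑ h ∈ Finset.Ioc (alpha (c.length / 2) B) (beta (c.length / 2) B), Y * X ^ (h - 1)
              - ∑ h ∈ Finset.Ioc (beta (c.length / 2) B) (alpha (c.length / 2) B),
                  Y * X ^ (h - 1)))
      + ∑ A ∈ (Tilings (c.length / 2)).filter (fun A => A.Nonempty ∧ A ⊆ posOne c),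
          ∑ B ∈ (posGt c).powerset,
            ∑ h ∈ Finset.Icc 1 (kappa A),
              ((-1 : ℤ) ^ (eo A + B.card + (kappa A - h)) *
                  ((kappa A - 1).choose (h - 1) : ℤ)) •
                (EE ε (modify c A B) * Y *
                  X ^ (h + ε * kappa A + betaA (c.length / 2) A B - 1)) := by
  rw [EE, if_neg hc]
  refine congrArg₂ (· + ·) (congrArg₂ (· + ·) (congrArg Neg.neg ?_) ?_) ?_
  · rw [← Finset.sum_attach ((posGt c).powerset.filter fun B => B.Nonempty)]
  · rw [← Finset.sum_attach ((posGt c).powerset.filter fun B => B.Nonempty)]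
  · rw [← Finset.sum_attach
      ((Tilings (c.length / 2)).filter fun A => A.Nonempty ∧ A ⊆ posOne c)]
    refine Finset.sum_congr rfl fun A _ => ?_
    rw [← Finset.sum_attach (posGt c).powerset]

/-- The automorphism `θ` of `𝔥` with `θ(x) = -x` and `θ(y) = -y`. -/
noncomputable def theta : H →ₐ[ℤ] H := FreeAlgebra.lift ℤ fun a => -FreeAlgebra.ι ℤ a

/-- `𝔈_q(c) = 𝔈_q^0(c)`. -/
noncomputable def wordE (c : List ℕ) : H := EE 0 c

/-- `𝔇_q(c) = (-1)^(c₁ + ⋯ + c_{2r}) θ(𝔈_q^1(c))`. -/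
noncomputable def wordD (c : List ℕ) : H := (-1 : ℤ) ^ c.sum • theta (EE 1 c)

/-! ### The indices of the theorem -/

/-- `(l₁, k₁, …, l_r, k_r)`. -/
def interleave {r : ℕ} (l k : Fin r → ℕ) : List ℕ :=
  (List.ofFn fun j => [l j, k j]).flatten

/-- `({bar1}^(l₁-1), k₁, …, {bar1}^(l_r-1), k_r)`. -/
def dagIndex {r : ℕ} (l k : Fin r → ℕ) : List Entry :=
  (List.ofFn fun j => List.replicate (l j - 1) Entry.bar1 ++ [Entry.int (k j)]).flatten

/-- `({1}^(l₁-1), k₁+1, …, {1}^(l_r-1), k_r+1)`. -/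
def bzIndex {r : ℕ} (l k : Fin r → ℕ) : List ℕ :=
  (List.ofFn fun j => List.replicate (l j - 1) 1 ++ [k j + 1]).flatten

/-! ### The definitions above are meaningful -/

theorem Hge2_le_H0 : Hge2 ≤ H0 := by
  refine sup_le le_sup_left ?_
  rintro _ ⟨a, ha, rfl⟩
  have key : ∃ (n : ℤ) (u : H), a = algebraMap ℤ H n + u * X := by
    refine Algebra.adjoin_induction (p := fun a _ => ∃ (n : ℤ) (u : H),
      a = algebraMap ℤ H n + u * X) ?_ ?_ ?_ ?_ ha
    · intro b hb
      rcases hb with rfl | rfl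
      · exact ⟨0, 1, by simp⟩
      · exact ⟨0, Y, by simp⟩
    · intro n
      exact ⟨n, 0, by simp⟩
    · rintro _ _ _ _ ⟨n, u, rfl⟩ ⟨m, v, rfl⟩
      exact ⟨n + m, u + v, by rw [map_add, add_mul]; abel⟩
    · rintro _ _ _ _ ⟨n, u, rfl⟩ ⟨m, v, rfl⟩
      refine ⟨n * m, algebraMap ℤ H n * v + u * algebraMap ℤ H m + u * X * v, ?_⟩
      have hc : algebraMap ℤ H m * X = X * algebraMap ℤ H m := Algebra.commutes m X
      simp only [map_mul, add_mul, mul_add, mul_assoc, hc]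
      abel
  obtain ⟨n, u, rfl⟩ := key
  refine Submodule.mem_sup_right ⟨algebraMap ℤ H n + X * u, ?_⟩
  have hc : algebraMap ℤ H n * X = X * algebraMap ℤ H n := Algebra.commutes n X
  change Y * ((algebraMap ℤ H n + X * u) * X) = Y * X * (algebraMap ℤ H n + u * X)
  rw [add_mul, hc, mul_add, mul_add]
  simp only [mul_assoc]

theorem decode_flatMap (k : List ℕ) (hk : ∀ m ∈ k, 1 ≤ m) :
    decode (k.flatMap fun m => Letter.y :: List.replicate (m - 1) Letter.x) = (0, k) := by
  have hx : ∀ (m : ℕ) (w : List Letter), decode (List.replicate m Letter.x ++ w) =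
      ((decode w).1 + m, (decode w).2) := by
    intro m w
    induction m with
    | zero => simp
    | succ m ih =>
      rw [List.replicate_succ, List.cons_append, decode, ih]
      simp [add_assoc]
  induction k with
  | nil => rfl
  | cons m k ih =>
    have h1 := hk m (by simp)
    have h2 := ih fun a ha => hk a (by simp [ha])
    rw [List.flatMap_cons, List.cons_append, decode, hx, h2]
    simp
    omega

theorem extend_word (f : List ℕ → PowerSeries ℚ) (k : List ℕ) (hk : ∀ m ∈ k, 1 ≤ m) :
    extend f (word k) = f k := by
  have hb : ∀ w : List Letter, FreeAlgebra.basisFreeMonoid ℤ Letter (FreeMonoid.ofList w) =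
      (w.map (FreeAlgebra.ι ℤ)).prod := by
    intro w
    rw [FreeAlgebra.basisFreeMonoid]
    simp [FreeAlgebra.equivMonoidAlgebraFreeMonoid, MonoidAlgebra.lift_single, FreeMonoid.lift_apply]
    exact one_smul ℤ _
  have hw : word k = FreeAlgebra.basisFreeMonoid ℤ Letter
      (FreeMonoid.ofList (k.flatMap fun m => Letter.y :: List.replicate (m - 1) Letter.x)) := by
    rw [hb, word]
    clear hk
    induction k with
    | nil => simp
    | cons m k ih =>
      rw [List.map_cons, List.prod_cons, ih]
      simp [X, Y, mul_assoc]
  rw [hw]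
  refine ((FreeAlgebra.basisFreeMonoid ℤ Letter).constr_basis ℤ _ _).trans ?_
  simp [decode_flatMap k hk]

/-- A family over a set of tuples is summable if `q^(n_i)` divides the term at `n` for all `i`. -/
theorem summable_of_dvd {r : ℕ} (D : (Fin r → ℕ) → Prop) (t : (Fin r → ℕ) → PowerSeries ℚ)
    (h : ∀ n, D n → ∀ i, (PowerSeries.X : PowerSeries ℚ) ^ n i ∣ t n) :
    Summable fun n : {n : Fin r → ℕ // D n} => t n.1 := by
  rw [PowerSeries.WithPiTopology.summable_iff_summable_coeff]
  intro m
  apply summable_of_hasFiniteSupport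
  have hfin : (Set.pi Set.univ fun _ : Fin r => Set.Iic m).Finite :=
    Set.Finite.pi fun _ => Set.finite_Iic m
  refine (hfin.preimage (f := Subtype.val) Subtype.val_injective.injOn).subset ?_
  intro n hn i _
  by_contra hlt
  exact hn (PowerSeries.X_pow_dvd_iff.1 (h n.1 n.2 i) m (not_le.1 hlt))

/-- The family that defines `ζ_q^†(k)` is summable in `ℚ[[q]]` for every admissible `k`. -/
theorem summable_dagTerm (k : List Entry) (hk : ∀ h : k ≠ [], k.getLast h ≠ Entry.bar1) :
    Summable fun n : {n : Fin k.length → ℕ // DagDomain k n} => dagTerm k n.1 := by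
  refine summable_of_dvd (DagDomain k) (dagTerm k) fun n hn i => ?_
  have hk0 : k ≠ [] := by
    rintro rfl
    exact i.elim0
  have hlen : 0 < k.length := List.length_pos_of_ne_nil hk0
  have hmono : ∀ (d a : ℕ) (ha : a + d < k.length), n ⟨a, by omega⟩ ≤ n ⟨a + d, ha⟩ := by
    intro d
    induction d with
    | zero => intro a ha; exact le_rfl
    | succ d ih =>
      intro a ha
      exact (ih a (by omega)).trans (hn.2 ⟨a + d, by omega⟩ ⟨a + (d + 1), ha⟩ rfl).1
  let j : Fin k.length := ⟨k.length - 1, by omega⟩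
  have hij : n i ≤ n j := by
    have h1 := hmono (k.length - 1 - i) i (by omega)
    have h2 : (⟨i + (k.length - 1 - i), by omega⟩ : Fin k.length) = j := by
      apply Fin.ext
      simp only [j]
      omega
    rwa [h2] at h1
  refine (pow_dvd_pow _ hij).trans (Dvd.dvd.trans ?_ (Finset.dvd_prod_of_mem _ (Finset.mem_univ j)))
  have hj : k.get j ≠ Entry.bar1 := by
    have := hk hk0
    rwa [List.getLast_eq_getElem] at this
  cases hkj : k.get j with
  | bar1 => exact absurd hkj hj
  | int m => exact Dvd.intro _ rfl

/-- The family that defines `ζ_q^BZ(k)` is summable in `ℚ[[q]]` for every admissible `k`. -/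
theorem summable_bzTerm (k : List ℕ) (hk : ∀ h : k ≠ [], 2 ≤ k.getLast h) :
    Summable fun n : {n : Fin k.length → ℕ // BZDomain n} => bzTerm k n.1 := by
  refine summable_of_dvd BZDomain (bzTerm k) fun n hn i => ?_
  have hk0 : k ≠ [] := by
    rintro rfl
    exact i.elim0
  have hlen : 0 < k.length := List.length_pos_of_ne_nil hk0
  let j : Fin k.length := ⟨k.length - 1, by omega⟩
  have hij : n i ≤ n j := hn.2.monotone (by
    rw [Fin.le_def]
    simp only [j]
    omega)
  have hj : 2 ≤ k.get j := by
    have := hk hk0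
    rwa [List.getLast_eq_getElem] at this
  refine (pow_dvd_pow _ (hij.trans ?_)).trans
    (Dvd.dvd.trans (Dvd.intro _ rfl) (Finset.dvd_prod_of_mem _ (Finset.mem_univ j)))
  exact Nat.le_mul_of_pos_right _ (by omega)

end QMZV

open QMZV

/-!
Both identities are limits, as `N → ∞`, of one identity between sums whose summation variables are
`< N`.  It holds over every commutative ring with a sequence `ξ` such that `ξ_0 = 0` and

  `ξ_{m+n} (ξ_m + ξ_n - 1) = ξ_m ξ_n`  for `m, n ≥ 1`.

In `ℚ[[q]]` this partial fraction relation is satisfied by `ξ_n = 1 / (1 - q^n)`, which gives the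
claim on `ζ_q^†` (`ε = 0`), and by `ξ_n = -q^n / (1 - q^n)`, which gives the claim on `ζ_q^BZ`
(`ε = 1`, up to the signs that `θ` accounts for).

Words.  Let `x` act on sequences by `a_n ↦ ξ_n a_n`, and `y` by `a_n ↦ (ξ_n - 1) ∑_{m<n} a_m`.  The
partial sums `wordSum` of the sequence that a word makes out of the unit sequence at `0` are the
truncations of the value of the word.  The `y x^(h-1)` in the recursion for `𝔈_q^ε` form telescoping
and binomial sums, so that the recursion becomes a relation between the partial sums up to `N + 1`
and those up to `N`, which determines them (`wordSum_EE_succ`):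
`∑_B (-1)^#B ξ_N^α(B) G_{c_B}(N+1) = ∑_{A,B} (-1)^(eo A + #B) η^κ(A) ξ_N^β_A(B) G_{c_{A,B}}(N)`
with `η = (ξ_N - 1) ξ_N^ε`.

Multiple sums.  The same relation is satisfied by explicit sums `coeffSum`.  These are the
coefficients of chain sums, with one formal variable `z_i` for each position `i ∈ [2r]`, over
`0 < n_1 < ⋯ < n_r < N`; a summation variable `n_i` has the weight
`(ξ_n - 1) ξ_n^ε / (1 - ξ_n z_{2i})`, and the integers `j` with `n_{i-1} < j ≤ n_i`, where
`n_0 = 0`, have weights in `z_{2i-1}`, among them the factor `1 / (1 - ξ_{N-j} z_{2i-1})`.  The sums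
over `B` of the relation are the expansions of products of factors `1 - ξ_N (z + z' - z z')` over
pairs of positions.  By the partial fraction relation such a factor turns the weight of passing from
the position `w` to `u` at a time `n` into the form `g_u + η f_w`, where `f_w` is the weight of a
step at `w` (`pairPassWeight_affine`).  The signed sum over the partial tilings is what makes these
contributions of `f_w` cancel (`oddTilingSum_step`); what remains is a recursion in `n` that the
products with `N + 1` in place of `N` satisfy as well (`generating_succ`, `coeffSum_succ`).  Hence
`wordSum_EE`.

Limits.  Since `q^i` divides `ξ_i - 1` (`ε = 0`) or `ξ_i` (`ε = 1`), and since the weight of a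
summation variable `n` is divisible by `q^n`, replacing `ξ_{N-j}` by its limit changes the truncated
sum by a multiple of `q^N` only.  After this replacement the weights of the intervals between the
`n_i` are the nested sums over the entries `bar1`, respectively `1`, so that the limits are
`ζ_q^†` and `ζ_q^BZ` (`tendsto_coeffSum_dag`, `tendsto_coeffSum_bz`), whereas the partial sums of a
word tend to its image under `Z_q^†` and `Z_q^BZ ∘ θ` (`tendsto_wordSum_dag`, `tendsto_wordSum_bz`).
-/

namespace QMZV

/-! ### Partial tilings, built from the right -/

/-- A partial tiling is given by the sets `R` and `R'` of the indices of its even-odd and of its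
odd-even dominoes; the condition that no two elements of `S'` differ by `2` says that `R'` contains
no two consecutive integers. -/
theorem mem_Tilings {r : ℕ} {A : Finset ℕ} : A ∈ Tilings r ↔ ∃ R R' : Finset ℕ,
    R ⊆ Finset.Icc 1 (r - 1) ∧ R' ⊆ Finset.Icc 1 r ∧ (∀ j ∈ R, j ∉ R' ∧ j + 1 ∉ R') ∧
    (∀ j ∈ R', j + 1 ∉ R') ∧ ∀ i, i ∈ A ↔ i / 2 ∈ R ∨ (i + 1) / 2 ∈ R' := by
  have h1 : ∀ (R : Finset ℕ) (i : ℕ),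
      (i ∈ R.biUnion fun j => {2 * j, 2 * j + 1}) ↔ i / 2 ∈ R := by
    intro R i
    simp only [Finset.mem_biUnion, Finset.mem_insert, Finset.mem_singleton]
    constructor
    · rintro ⟨j, hj, h⟩
      have : i / 2 = j := by omega
      rwa [this]
    · intro h
      exact ⟨_, h, by omega⟩
  have h2 : ∀ (R : Finset ℕ) (n : ℕ), R ⊆ Finset.Icc 1 n → ∀ i : ℕ,
      (i ∈ R.biUnion fun j => {2 * j - 1, 2 * j}) ↔ (i + 1) / 2 ∈ R := by
    intro R n hR i
    simp only [Finset.mem_biUnion, Finset.mem_insert, Finset.mem_singleton]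
    constructor
    · rintro ⟨j, hj, h⟩
      have := Finset.mem_Icc.1 (hR hj)
      have : (i + 1) / 2 = j := by omega
      rwa [this]
    · intro h
      have := Finset.mem_Icc.1 (hR h)
      exact ⟨_, h, by omega⟩
  simp only [Tilings, EO, OEstar, OE, Finset.mem_image, Finset.mem_filter, Finset.mem_product,
    Finset.mem_powerset, Prod.exists]
  constructor
  · rintro ⟨_, _, ⟨⟨⟨R, hR, rfl⟩, ⟨R', hR', rfl⟩, hadj⟩, hdis⟩, rfl⟩
    refine ⟨R, R', hR, hR', ?_, ?_, ?_⟩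
    · intro j hj
      have := Finset.disjoint_left.1 hdis
      simp only [h1, h2 R' r hR'] at this
      constructor
      · intro hj'
        refine this (a := 2 * j) ?_ ?_
        · rwa [show 2 * j / 2 = j by omega]
        · rwa [show (2 * j + 1) / 2 = j by omega]
      · intro hj'
        refine this (a := 2 * j + 1) ?_ ?_
        · rwa [show (2 * j + 1) / 2 = j by omega]
        · rwa [show (2 * j + 1 + 1) / 2 = j + 1 by omega]
    · intro j hj hj'
      simp only [h2 R' r hR'] at hadj
      refine hadj (2 * j) ?_ (2 * (j + 1)) ?_ ?_
      · rwa [show (2 * j + 1) / 2 = j by omega]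
      · rwa [show (2 * (j + 1) + 1) / 2 = j + 1 by omega]
      · push_cast
        rw [show (2 * (j : ℤ) - 2 * (j + 1)) = -2 by ring]
        rfl
    · intro i
      rw [Finset.mem_union, h1, h2 R' r hR']
  · rintro ⟨R, R', hR, hR', hd, hadj, hA⟩
    refine ⟨_, _, ⟨⟨⟨R, hR, rfl⟩, ⟨R', hR', rfl⟩, ?_⟩, ?_⟩, ?_⟩
    · simp only [h2 R' r hR']
      have key : ∀ i j : ℕ, (i + 1) / 2 ∈ R' → (j + 1) / 2 ∈ R' → j ≠ i + 2 := by
        rintro i j hi hj rfl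
        refine hadj _ hi ?_
        rwa [show (i + 1) / 2 + 1 = (i + 2 + 1) / 2 by omega]
      intro i hi j hj h
      rcases (abs_eq (by norm_num)).1 h with h | h
      · exact key j i hj hi (by omega)
      · exact key i j hi hj (by omega)
    · rw [Finset.disjoint_left]
      simp only [h1, h2 R' r hR']
      intro i hi hi'
      rcases Nat.even_or_odd' i with ⟨j, rfl | rfl⟩
      · rw [show 2 * j / 2 = j by omega] at hi
        rw [show (2 * j + 1) / 2 = j by omega] at hi'
        exact (hd j hi).1 hi'
      · rw [show (2 * j + 1) / 2 = j by omega] at hi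
        rw [show (2 * j + 1 + 1) / 2 = j + 1 by omega] at hi'
        exact (hd j hi).2 hi'
    · ext i
      rw [Finset.mem_union, h1, h2 R' r hR', hA]

/-- The members of `𝒯(r)` that do not contain the last position `2r`: for `r ≥ 1` these are the
partial tilings of `[2r - 1]` that may be followed by an uncovered position `2r`. -/
def oddTilings (r : ℕ) : Finset (Finset ℕ) :=
  (Tilings r).filter fun A => 2 * r ∉ A

theorem subset_of_mem_Tilings {r : ℕ} {A : Finset ℕ} (h : A ∈ Tilings r) :
    A ⊆ Finset.Icc 1 (2 * r) := by
  obtain ⟨R, R', hR, hR', -, -, hA⟩ := mem_Tilings.1 h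
  intro i hi
  rw [Finset.mem_Icc]
  rcases (hA i).1 hi with h | h
  · have := Finset.mem_Icc.1 (hR h)
    omega
  · have := Finset.mem_Icc.1 (hR' h)
    omega

theorem subset_of_mem_oddTilings {r : ℕ} {A : Finset ℕ} (h : A ∈ oddTilings r) :
    A ⊆ Finset.Icc 1 (2 * r - 1) := by
  have h' := Finset.mem_filter.1 h
  intro i hi
  have := Finset.mem_Icc.1 (subset_of_mem_Tilings h'.1 hi)
  have hne : i ≠ 2 * r := by
    rintro rfl
    exact h'.2 hi
  rw [Finset.mem_Icc]
  omega

theorem Tilings_zero : Tilings 0 = {∅} := by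
  ext A
  rw [Finset.mem_singleton]
  constructor
  · intro h
    simpa using subset_of_mem_Tilings h
  · rintro rfl
    exact mem_Tilings.2 ⟨∅, ∅, by simp, by simp, by simp, by simp, by simp⟩

theorem oddTilings_zero : oddTilings 0 = {∅} := by
  rw [oddTilings, Tilings_zero]
  rfl

theorem mem_Tilings_succ {r : ℕ} {A : Finset ℕ} : A ∈ Tilings (r + 1) ↔
    A ∈ oddTilings (r + 1) ∨ ∃ A' ∈ oddTilings r, A = A' ∪ {2 * r + 1, 2 * r + 2} := by
  constructor
  · intro h
    obtain ⟨R, R', hR, hR', hd, hadj, hA⟩ := mem_Tilings.1 h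
    have hR1 : r + 1 ∉ R := fun h => by
      have := Finset.mem_Icc.1 (hR h)
      omega
    by_cases hr : r + 1 ∈ R'
    · right
      have h1 : r ∉ R := fun h => (hd r h).2 hr
      have h2 : r ∉ R' := fun h => hadj r h hr
      refine ⟨A \ {2 * r + 1, 2 * r + 2}, ?_, ?_⟩
      · refine Finset.mem_filter.2 ⟨mem_Tilings.2 ⟨R, R'.erase (r + 1), ?_, ?_, ?_, ?_, ?_⟩, ?_⟩
        · intro j hj
          have := Finset.mem_Icc.1 (hR hj)
          have : j ≠ r := by rintro rfl; exact h1 hj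
          rw [Finset.mem_Icc]
          omega
        · intro j hj
          have h3 := Finset.mem_erase.1 hj
          have := Finset.mem_Icc.1 (hR' h3.2)
          rw [Finset.mem_Icc]
          omega
        · intro j hj
          have := hd j hj
          simp [this]
        · intro j hj
          have := hadj j (Finset.mem_erase.1 hj).2
          simp [this]
        · intro i
          rw [Finset.mem_sdiff, hA, Finset.mem_erase]
          simp only [Finset.mem_insert, Finset.mem_singleton]
          constructor
          · rintro ⟨h | h, h'⟩
            · exact Or.inl h
            · exact Or.inr ⟨by omega, h⟩
          · rintro (h | ⟨h, h'⟩)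
            · refine ⟨Or.inl h, ?_⟩
              rintro (rfl | rfl)
              · apply h1
                rwa [show (2 * r + 1) / 2 = r by omega] at h
              · apply hR1
                rwa [show (2 * r + 2) / 2 = r + 1 by omega] at h
            · exact ⟨Or.inr h', by omega⟩
        · rw [Finset.mem_sdiff, hA, show 2 * r / 2 = r by omega,
            show (2 * r + 1) / 2 = r by omega]
          tauto
      · rw [Finset.sdiff_union_of_subset]
        intro i hi
        rw [hA]
        right
        simp only [Finset.mem_insert, Finset.mem_singleton] at hi
        rwa [show (i + 1) / 2 = r + 1 by omega]
    · left
      refine Finset.mem_filter.2 ⟨h, ?_⟩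
      rw [hA, show 2 * (r + 1) / 2 = r + 1 by omega, show (2 * (r + 1) + 1) / 2 = r + 1 by omega]
      tauto
  · rintro (h | ⟨A', h, rfl⟩)
    · exact (Finset.mem_filter.1 h).1
    · obtain ⟨h, h2⟩ := Finset.mem_filter.1 h
      obtain ⟨R, R', hR, hR', hd, hadj, hA⟩ := mem_Tilings.1 h
      rw [hA, show 2 * r / 2 = r by omega, show (2 * r + 1) / 2 = r by omega] at h2
      push Not at h2
      refine mem_Tilings.2 ⟨R, insert (r + 1) R', ?_, ?_, ?_, ?_, ?_⟩
      · intro j hj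
        have := Finset.mem_Icc.1 (hR hj)
        rw [Finset.mem_Icc]
        omega
      · intro j hj
        rw [Finset.mem_Icc]
        rcases Finset.mem_insert.1 hj with rfl | hj
        · omega
        · have := Finset.mem_Icc.1 (hR' hj)
          omega
      · intro j hj
        have h3 := hd j hj
        have h4 := Finset.mem_Icc.1 (hR hj)
        simp only [Finset.mem_insert, not_or]
        exact ⟨⟨by omega, h3.1⟩, by omega, h3.2⟩
      · intro j hj
        simp only [Finset.mem_insert, not_or]
        rcases Finset.mem_insert.1 hj with rfl | hj
        · refine ⟨by omega, fun h => ?_⟩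
          have := Finset.mem_Icc.1 (hR' h)
          omega
        · refine ⟨?_, hadj j hj⟩
          intro h
          have : j = r := by omega
          exact h2.2 (this ▸ hj)
      · intro i
        simp only [Finset.mem_union, hA, Finset.mem_insert, Finset.mem_singleton]
        rw [show (i + 1) / 2 = r + 1 ↔ i = 2 * r + 1 ∨ i = 2 * r + 2 by omega, or_assoc,
          or_comm (a := (i + 1) / 2 ∈ R')]

theorem oddTilings_one : oddTilings 1 = {∅} := by
  ext A
  rw [Finset.mem_singleton]
  constructor
  · intro h
    have h1 := subset_of_mem_oddTilings h
    obtain ⟨h, h2⟩ := Finset.mem_filter.1 h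
    obtain ⟨R, R', hR, hR', hd, hadj, hA⟩ := mem_Tilings.1 h
    ext i
    simp only [Finset.notMem_empty, iff_false]
    intro hi
    have h3 := Finset.mem_Icc.1 (h1 hi)
    have : i = 1 := by omega
    subst this
    rcases (hA 1).1 hi with h4 | h4
    · simpa using hR h4
    · exact h2 ((hA _).2 (Or.inr h4))
  · rintro rfl
    refine Finset.mem_filter.2 ⟨?_, by simp⟩
    exact mem_Tilings.2 ⟨∅, ∅, by simp, by simp, by simp, by simp, by simp⟩

theorem mem_oddTilings_succ {r : ℕ} {A : Finset ℕ} : A ∈ oddTilings (r + 2) ↔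
    A ∈ Tilings (r + 1) ∨ ∃ A' ∈ oddTilings (r + 1), A = A' ∪ {2 * r + 2, 2 * r + 3} := by
  constructor
  · intro h
    obtain ⟨h, h2⟩ := Finset.mem_filter.1 h
    obtain ⟨R, R', hR, hR', hd, hadj, hA⟩ := mem_Tilings.1 h
    rw [hA, show 2 * (r + 2) / 2 = r + 2 by omega,
      show (2 * (r + 2) + 1) / 2 = r + 2 by omega] at h2
    push Not at h2
    have hR'1 : R' ⊆ Finset.Icc 1 (r + 1) := by
      intro j hj
      have := Finset.mem_Icc.1 (hR' hj)
      have : j ≠ r + 2 := by rintro rfl; exact h2.2 hj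
      rw [Finset.mem_Icc]
      omega
    by_cases hr : r + 1 ∈ R
    · right
      have h3 := hd _ hr
      refine ⟨A \ {2 * r + 2, 2 * r + 3}, ?_, ?_⟩
      · refine Finset.mem_filter.2 ⟨mem_Tilings.2 ⟨R.erase (r + 1), R', ?_, ?_, ?_, ?_, ?_⟩, ?_⟩
        · intro j hj
          have h4 := Finset.mem_erase.1 hj
          have := Finset.mem_Icc.1 (hR h4.2)
          rw [Finset.mem_Icc]
          omega
        · exact hR'1
        · intro j hj
          exact hd j (Finset.mem_erase.1 hj).2
        · exact hadj
        · intro i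
          rw [Finset.mem_sdiff, hA, Finset.mem_erase]
          simp only [Finset.mem_insert, Finset.mem_singleton]
          constructor
          · rintro ⟨h | h, h'⟩
            · exact Or.inl ⟨by omega, h⟩
            · exact Or.inr h
          · rintro (⟨h, h'⟩ | h)
            · exact ⟨Or.inl h', by omega⟩
            · refine ⟨Or.inr h, ?_⟩
              rintro (rfl | rfl)
              · apply h3.1
                rwa [show (2 * r + 2 + 1) / 2 = r + 1 by omega] at h
              · apply h3.2
                rwa [show (2 * r + 3 + 1) / 2 = r + 1 + 1 by omega] at h
        · simp [show 2 * (r + 1) = 2 * r + 2 by ring]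
      · rw [Finset.sdiff_union_of_subset]
        intro i hi
        rw [hA]
        left
        simp only [Finset.mem_insert, Finset.mem_singleton] at hi
        rwa [show i / 2 = r + 1 by omega]
    · left
      refine mem_Tilings.2 ⟨R, R', ?_, hR'1, hd, hadj, hA⟩
      intro j hj
      have := Finset.mem_Icc.1 (hR hj)
      have : j ≠ r + 1 := by rintro rfl; exact hr hj
      rw [Finset.mem_Icc]
      omega
  · rintro (h | ⟨A', h, rfl⟩)
    · refine Finset.mem_filter.2 ⟨?_, fun h' => ?_⟩
      · obtain ⟨R, R', hR, hR', hd, hadj, hA⟩ := mem_Tilings.1 h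
        refine mem_Tilings.2 ⟨R, R', ?_, ?_, hd, hadj, hA⟩
        · exact hR.trans (Finset.Icc_subset_Icc_right (by omega))
        · exact hR'.trans (Finset.Icc_subset_Icc_right (by omega))
      · have := Finset.mem_Icc.1 (subset_of_mem_Tilings h h')
        omega
    · have hsub := subset_of_mem_oddTilings h
      obtain ⟨h, h2⟩ := Finset.mem_filter.1 h
      obtain ⟨R, R', hR, hR', hd, hadj, hA⟩ := mem_Tilings.1 h
      rw [hA, show 2 * (r + 1) / 2 = r + 1 by omega,
        show (2 * (r + 1) + 1) / 2 = r + 1 by omega] at h2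
      push Not at h2
      refine Finset.mem_filter.2 ⟨mem_Tilings.2 ⟨insert (r + 1) R, R', ?_, ?_, ?_, ?_, ?_⟩, ?_⟩
      · intro j hj
        rw [Finset.mem_Icc]
        rcases Finset.mem_insert.1 hj with rfl | hj
        · omega
        · have := Finset.mem_Icc.1 (hR hj)
          omega
      · exact hR'.trans (Finset.Icc_subset_Icc_right (by omega))
      · intro j hj
        rcases Finset.mem_insert.1 hj with rfl | hj
        · refine ⟨h2.2, fun h => ?_⟩
          have := Finset.mem_Icc.1 (hR' h)
          omega
        · exact hd j hj
      · exact hadj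
      · intro i
        simp only [Finset.mem_union, hA, Finset.mem_insert, Finset.mem_singleton]
        rw [show i / 2 = r + 1 ↔ i = 2 * r + 2 ∨ i = 2 * r + 3 by omega, or_comm]
        simp only [or_assoc]
      · simp only [Finset.mem_union, Finset.mem_insert, Finset.mem_singleton, not_or]
        refine ⟨fun h => ?_, by omega, by omega⟩
        have := Finset.mem_Icc.1 (hsub h)
        omega

section Sums

variable {M : Type*} [AddCommMonoid M]

theorem sum_union_domino {S : Finset (Finset ℕ)} {P : Finset ℕ} (hP : ∀ A ∈ S, Disjoint A P)
    (F : Finset ℕ → M) : ∑ A ∈ S.image (fun A => A ∪ P), F A = ∑ A ∈ S, F (A ∪ P) := by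
  rw [Finset.sum_image]
  intro A hA A' hA' h
  have h1 := Finset.union_sdiff_cancel_right (hP A hA)
  have h2 := Finset.union_sdiff_cancel_right (hP A' hA')
  simp only at h
  rw [← h1, ← h2, h]

theorem disjoint_of_subset_Icc {A P : Finset ℕ} {n : ℕ} (hA : A ⊆ Finset.Icc 1 n)
    (hP : ∀ i ∈ P, n < i) : Disjoint A P := by
  rw [Finset.disjoint_left]
  intro i hi hi'
  have := Finset.mem_Icc.1 (hA hi)
  have := hP i hi'
  omega

/-- A member of `𝒯(r + 1)` leaves the position `2r + 2` uncovered, or it ends with the domino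
`{2r + 1, 2r + 2}` and leaves `2r` uncovered. -/
theorem sum_Tilings_succ (r : ℕ) (F : Finset ℕ → M) :
    ∑ A ∈ Tilings (r + 1), F A =
      ∑ A ∈ oddTilings (r + 1), F A + ∑ A ∈ oddTilings r, F (A ∪ {2 * r + 1, 2 * r + 2}) := by
  have h : Tilings (r + 1) = oddTilings (r + 1) ∪
      (oddTilings r).image fun A => A ∪ {2 * r + 1, 2 * r + 2} := by
    ext A
    rw [mem_Tilings_succ, Finset.mem_union, Finset.mem_image]
    simp only [eq_comm]
  rw [h, Finset.sum_union, sum_union_domino]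
  · intro A hA
    refine disjoint_of_subset_Icc (subset_of_mem_oddTilings hA) ?_
    intro i hi
    simp only [Finset.mem_insert, Finset.mem_singleton] at hi
    omega
  · rw [Finset.disjoint_left]
    intro A hA hA'
    obtain ⟨A', -, rfl⟩ := Finset.mem_image.1 hA'
    have := (Finset.mem_filter.1 hA).2
    simp [show 2 * (r + 1) = 2 * r + 2 by ring] at this

/-- A partial tiling of `[2r + 3]` leaves the position `2r + 3` uncovered, or it ends with the
domino `{2r + 2, 2r + 3}`. -/
theorem sum_oddTilings_succ (r : ℕ) (F : Finset ℕ → M) :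
    ∑ A ∈ oddTilings (r + 2), F A =
      ∑ A ∈ Tilings (r + 1), F A + ∑ A ∈ oddTilings (r + 1), F (A ∪ {2 * r + 2, 2 * r + 3}) := by
  have h : oddTilings (r + 2) = Tilings (r + 1) ∪
      (oddTilings (r + 1)).image fun A => A ∪ {2 * r + 2, 2 * r + 3} := by
    ext A
    rw [mem_oddTilings_succ, Finset.mem_union, Finset.mem_image]
    simp only [eq_comm]
  rw [h, Finset.sum_union, sum_union_domino]
  · intro A hA
    refine disjoint_of_subset_Icc (subset_of_mem_oddTilings hA) ?_
    intro i hi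
    simp only [Finset.mem_insert, Finset.mem_singleton] at hi
    omega
  · rw [Finset.disjoint_left]
    intro A hA hA'
    obtain ⟨A', -, rfl⟩ := Finset.mem_image.1 hA'
    have := Finset.mem_Icc.1 (subset_of_mem_Tilings hA (show 2 * r + 3 ∈ _ by simp))
    omega

end Sums

theorem kappa_union_domino {A : Finset ℕ} {n : ℕ} (hA : A ⊆ Finset.Icc 1 n) :
    kappa (A ∪ {n + 1, n + 2}) = kappa A + 1 := by
  have hd : Disjoint A {n + 1, n + 2} := by
    refine disjoint_of_subset_Icc hA ?_
    intro i hi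
    simp only [Finset.mem_insert, Finset.mem_singleton] at hi
    omega
  rw [kappa, kappa, Finset.card_union_of_disjoint hd, Finset.card_pair (by omega)]
  omega

theorem eo_eq_card {S : Finset ℕ} {M : ℕ} (h : ∀ i ∈ S, i ≤ M) :
    eo S = ((Finset.Icc 1 M).filter fun j => 2 * j ∈ S ∧ 2 * j + 1 ∈ S).card := by
  rw [eo]
  congr 1
  ext j
  simp only [Finset.mem_filter, Finset.mem_Icc, Finset.insert_subset_iff,
    Finset.singleton_subset_iff]
  constructor
  · rintro ⟨h1, h2, h3⟩
    have := h _ h2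
    exact ⟨by omega, h2, h3⟩
  · rintro ⟨h1, h2, h3⟩
    have : 2 * j ≤ S.sup id := Finset.le_sup (f := id) h2
    exact ⟨by omega, h2, h3⟩

theorem eo_union_even {A : Finset ℕ} {r : ℕ} (hr : 1 ≤ r) (hA : A ⊆ Finset.Icc 1 (2 * r - 1)) :
    eo (A ∪ {2 * r, 2 * r + 1}) = eo A + 1 := by
  have hb : ∀ i ∈ A, i ≤ 2 * r + 1 := fun i hi => by
    have := Finset.mem_Icc.1 (hA hi)
    omega
  rw [eo_eq_card hb, eo_eq_card (M := 2 * r + 1), ← Finset.card_insert_of_notMem (a := r)]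
  · congr 1
    ext j
    simp only [Finset.mem_filter, Finset.mem_Icc, Finset.mem_union, Finset.mem_insert,
      Finset.mem_singleton]
    constructor
    · rintro ⟨h1, h2 | h2, h3⟩
      · have := Finset.mem_Icc.1 (hA h2)
        right
        refine ⟨h1, h2, ?_⟩
        rcases h3 with h3 | h3
        · exact h3
        · omega
      · left
        omega
    · rintro (rfl | ⟨h1, h2, h3⟩)
      · exact ⟨by omega, by omega, by omega⟩
      · exact ⟨h1, Or.inl h2, Or.inl h3⟩
  · intro h
    have := Finset.mem_Icc.1 (hA (Finset.mem_filter.1 h).2.1)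
    omega
  · intro i hi
    simp only [Finset.mem_union, Finset.mem_insert, Finset.mem_singleton] at hi
    rcases hi with hi | hi
    · exact hb i hi
    · omega

theorem eo_union_odd {A : Finset ℕ} {r : ℕ} (hA : A ⊆ Finset.Icc 1 (2 * r - 1)) :
    eo (A ∪ {2 * r + 1, 2 * r + 2}) = eo A := by
  have hb : ∀ i ∈ A, i ≤ 2 * r + 2 := fun i hi => by
    have := Finset.mem_Icc.1 (hA hi)
    omega
  rw [eo_eq_card hb, eo_eq_card (M := 2 * r + 2)]
  · congr 1
    ext j
    simp only [Finset.mem_filter, Finset.mem_Icc, Finset.mem_union, Finset.mem_insert,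
      Finset.mem_singleton]
    constructor
    · rintro ⟨h1, h2, h3⟩
      rcases h2 with h2 | h2 <;> rcases h3 with h3 | h3
      · exact ⟨h1, h2, h3⟩
      · have := Finset.mem_Icc.1 (hA h2)
        omega
      · have := Finset.mem_Icc.1 (hA h3)
        omega
      · omega
    · rintro ⟨h1, h2, h3⟩
      exact ⟨h1, Or.inl h2, Or.inl h3⟩
  · intro i hi
    simp only [Finset.mem_union, Finset.mem_insert, Finset.mem_singleton] at hi
    rcases hi with hi | hi
    · exact hb i hi
    · omega

/-! ### Chain sums over alternating sequences of positions -/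

section Chain

variable {R : Type*} [CommRing R]

/-- `chain f w F n = ∑_{m ≤ n} F m * ∏_{m < j ≤ n} f w j`: after a start at time `m` with
weight `F m`, the steps up to time `n` are all weighted by `f w`. -/
def chain (f : ℕ → ℕ → R) (w : ℕ) (F : ℕ → R) : ℕ → R
  | 0 => F 0
  | n + 1 => f w (n + 1) * chain f w F n + F (n + 1)

/-- For a decreasing list of positions `[u_r, w_r, …, u₁, w₁]`, the sum over
`0 = n₀ < n₁ < ⋯ < n_r = n` in which the passage of `n_i` has weight `J w_i u_i n_i` and the steps
strictly between `n_{i-1}` and `n_i` have weight `f w_i`. -/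
def arrive (f : ℕ → ℕ → R) (J : ℕ → ℕ → ℕ → R) : List ℕ → ℕ → R
  | u :: w :: L, n + 1 => J w u (n + 1) * chain f w (arrive f J L) n
  | [], 0 => 1
  | _, _ => 0

/-- The chain sum of a list `w :: L` of odd length, whose last position `w` is still passed. -/
def chainList (f : ℕ → ℕ → R) (J : ℕ → ℕ → ℕ → R) (L : List ℕ) : ℕ → R :=
  chain f L.head! (arrive f J L.tail)

variable (f : ℕ → ℕ → R) (J : ℕ → ℕ → ℕ → R)

@[simp]
theorem arrive_nil_zero : arrive f J [] 0 = 1 := by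
  simp [arrive]

@[simp]
theorem arrive_nil_succ (n : ℕ) : arrive f J [] (n + 1) = 0 := by
  simp [arrive]

@[simp]
theorem arrive_cons_zero (u : ℕ) (L : List ℕ) : arrive f J (u :: L) 0 = 0 := by
  simp [arrive]

theorem arrive_cons_cons (u w : ℕ) (L : List ℕ) (n : ℕ) :
    arrive f J (u :: w :: L) (n + 1) = J w u (n + 1) * chain f w (arrive f J L) n := by
  simp [arrive]

/-- The positions in `[n]` outside `A`, in decreasing order. -/
def uncovered (n : ℕ) (A : Finset ℕ) : List ℕ :=
  ((List.range' 1 n).filter fun i => i ∉ A).reverse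

theorem uncovered_zero (A : Finset ℕ) : uncovered 0 A = [] := by
  simp [uncovered]

theorem uncovered_succ (n : ℕ) (A : Finset ℕ) :
    uncovered (n + 1) A = if n + 1 ∈ A then uncovered n A else (n + 1) :: uncovered n A := by
  rw [uncovered, List.range'_concat, List.filter_append, List.reverse_append, uncovered]
  simp only [one_mul, add_comm 1 n]
  by_cases h : n + 1 ∈ A <;> simp [h]

theorem uncovered_congr {n : ℕ} {A A' : Finset ℕ} (h : ∀ i, 1 ≤ i → i ≤ n → (i ∈ A ↔ i ∈ A')) :
    uncovered n A = uncovered n A' := by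
  rw [uncovered, uncovered]
  congr 1
  apply List.filter_congr
  intro i hi
  rw [List.mem_range'_1] at hi
  simp [h i hi.1 (by omega)]

theorem uncovered_of_subset {n : ℕ} {A : Finset ℕ} (h : A ⊆ Finset.Icc 1 n) :
    uncovered (n + 1) A = (n + 1) :: uncovered n A := by
  rw [uncovered_succ, if_neg]
  intro h'
  have := Finset.mem_Icc.1 (h h')
  omega

theorem uncovered_union_domino {n : ℕ} (A : Finset ℕ) :
    uncovered (n + 2) (A ∪ {n + 1, n + 2}) = uncovered n A := by
  rw [uncovered_succ, if_pos (by simp), uncovered_succ, if_pos (by simp)]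
  apply uncovered_congr
  intro i _ hi
  simp only [Finset.mem_union, Finset.mem_insert, Finset.mem_singleton]
  constructor
  · rintro (h | h)
    · exact h
    · omega
  · exact Or.inl

variable (m : R)

/-- The signed weight `(-1)^eo(A) m^κ(A)` of a partial tiling. -/
def tilingWeight (A : Finset ℕ) : R := (-1) ^ eo A * m ^ kappa A

theorem tilingWeight_empty : tilingWeight m ∅ = 1 := by
  simp [tilingWeight, eo, kappa]

theorem tilingWeight_union_even {A : Finset ℕ} {r : ℕ} (hA : A ⊆ Finset.Icc 1 (2 * r + 1)) :
    tilingWeight m (A ∪ {2 * r + 2, 2 * r + 3}) = -m * tilingWeight m A := by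
  rw [tilingWeight, kappa_union_domino hA,
    show ({2 * r + 2, 2 * r + 3} : Finset ℕ) = {2 * (r + 1), 2 * (r + 1) + 1} by
      simp [mul_add, add_assoc],
    eo_union_even (by omega) (by simpa [mul_add] using hA), tilingWeight]
  ring

theorem tilingWeight_union_odd {A : Finset ℕ} {r : ℕ} (hA : A ⊆ Finset.Icc 1 (2 * r - 1)) :
    tilingWeight m (A ∪ {2 * r + 1, 2 * r + 2}) = m * tilingWeight m A := by
  rw [tilingWeight, kappa_union_domino
    (hA.trans (Finset.Icc_subset_Icc_right (by omega))), eo_union_odd hA, tilingWeight]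
  ring

/-- The weighted sum over `𝒯(r)` of the chain sums of the uncovered positions in `[2r + 1]`. -/
def tilingSum (r n : ℕ) : R :=
  ∑ A ∈ Tilings r, tilingWeight m A * chain f (2 * r + 1) (arrive f J (uncovered (2 * r) A)) n

/-- The weighted sum over the partial tilings of `[2r + 1]` of the chain sums of the uncovered
positions. -/
def oddTilingSum (r n : ℕ) : R :=
  ∑ A ∈ oddTilings (r + 1), tilingWeight m A * chainList f J (uncovered (2 * r + 1) A) n

theorem oddTilingSum_zero (n : ℕ) : oddTilingSum f J m 0 n = chain f 1 (arrive f J []) n := by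
  simp [oddTilingSum, oddTilings_one, tilingWeight_empty, uncovered_succ, uncovered_zero,
    chainList]

theorem tilingSum_zero (n : ℕ) : tilingSum f J m 0 n = oddTilingSum f J m 0 n := by
  simp [oddTilingSum_zero, tilingSum, Tilings_zero, tilingWeight_empty, uncovered_zero]

theorem chainList_uncovered {A : Finset ℕ} {r : ℕ} (hA : A ⊆ Finset.Icc 1 (2 * r)) :
    chainList f J (uncovered (2 * r + 1) A) =
      chain f (2 * r + 1) (arrive f J (uncovered (2 * r) A)) := by
  rw [uncovered_of_subset hA, chainList]
  rfl

theorem oddTilingSum_succ (r n : ℕ) :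
    oddTilingSum f J m (r + 1) n = tilingSum f J m (r + 1) n - m * oddTilingSum f J m r n := by
  rw [oddTilingSum, sum_oddTilings_succ, tilingSum, oddTilingSum, Finset.mul_sum, sub_eq_add_neg,
    ← Finset.sum_neg_distrib]
  congr 1
  · refine Finset.sum_congr rfl fun A hA => ?_
    rw [chainList_uncovered f J (subset_of_mem_Tilings hA)]
  · refine Finset.sum_congr rfl fun A hA => ?_
    rw [tilingWeight_union_even m (by simpa [mul_add] using subset_of_mem_oddTilings hA)]
    rw [show 2 * (r + 1) + 1 = (2 * r + 1) + 2 by ring,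
      show ({2 * r + 2, 2 * r + 3} : Finset ℕ) = {2 * r + 1 + 1, 2 * r + 1 + 2} from rfl,
      uncovered_union_domino]
    ring

/-- The weighted sum, over the partial tilings of `[2r + 1]`, of the chain sums up to time `n`
times the weight `φ` of the last uncovered position. -/
def oddTilingSumWith (φ : ℕ → R) (r n : ℕ) : R :=
  ∑ A ∈ oddTilings (r + 1), tilingWeight m A *
    (φ (uncovered (2 * r + 1) A).head! * chainList f J (uncovered (2 * r + 1) A) n)

theorem oddTilingSumWith_zero (φ : ℕ → R) (n : ℕ) :
    oddTilingSumWith f J m φ 0 n = φ 1 * tilingSum f J m 0 n := by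
  simp [oddTilingSumWith, oddTilings_one, tilingWeight_empty, uncovered_succ, uncovered_zero,
    chainList, tilingSum, Tilings_zero]

theorem oddTilingSumWith_succ (φ : ℕ → R) (r n : ℕ) :
    oddTilingSumWith f J m φ (r + 1) n =
      φ (2 * r + 3) * tilingSum f J m (r + 1) n - m * oddTilingSumWith f J m φ r n := by
  rw [oddTilingSumWith, sum_oddTilings_succ, tilingSum, oddTilingSumWith, Finset.mul_sum,
    Finset.mul_sum, sub_eq_add_neg, ← Finset.sum_neg_distrib]
  congr 1
  · refine Finset.sum_congr rfl fun A hA => ?_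
    rw [chainList_uncovered f J (subset_of_mem_Tilings hA),
      uncovered_of_subset (subset_of_mem_Tilings hA)]
    simp only [List.head!_cons]
    rw [show 2 * (r + 1) + 1 = 2 * r + 3 by ring]
    ring
  · refine Finset.sum_congr rfl fun A hA => ?_
    rw [tilingWeight_union_even m (by simpa [mul_add] using subset_of_mem_oddTilings hA)]
    rw [show 2 * (r + 1) + 1 = (2 * r + 1) + 2 by ring,
      show ({2 * r + 2, 2 * r + 3} : Finset ℕ) = {2 * r + 1 + 1, 2 * r + 1 + 2} from rfl,
      uncovered_union_domino]
    ring

/-- A partial tiling of `[2r + 1]` leaves some position uncovered. -/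
theorem uncovered_ne_nil (r : ℕ) : ∀ A ∈ oddTilings (r + 1), uncovered (2 * r + 1) A ≠ [] := by
  induction r with
  | zero =>
    intro A hA
    rw [oddTilings_one, Finset.mem_singleton] at hA
    simp [hA, uncovered_succ]
  | succ r ih =>
    intro A hA
    rcases mem_oddTilings_succ.1 hA with h | ⟨A', h, rfl⟩
    · rw [uncovered_of_subset (subset_of_mem_Tilings h)]
      simp
    · rw [show 2 * (r + 1) + 1 = (2 * r + 1) + 2 by ring,
        show ({2 * r + 2, 2 * r + 3} : Finset ℕ) = {2 * r + 1 + 1, 2 * r + 1 + 2} from rfl,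
        uncovered_union_domino]
      exact ih A' h

theorem arrive_uncovered (r n : ℕ) {A : Finset ℕ} (hA : A ∈ oddTilings (r + 1)) :
    arrive f J (uncovered (2 * r + 2) A) (n + 1) =
      J (uncovered (2 * r + 1) A).head! (2 * r + 2) (n + 1) *
        chainList f J (uncovered (2 * r + 1) A) n := by
  rw [uncovered_of_subset (n := 2 * r + 1) (by simpa [mul_add] using subset_of_mem_oddTilings hA)]
  have h := uncovered_ne_nil r A hA
  generalize uncovered (2 * r + 1) A = L at h ⊢
  rcases L with _ | ⟨w, L⟩
  · exact absurd rfl h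
  · rw [arrive_cons_cons]
    rfl

variable {f J m}

/-- The passage from time `n` to time `n + 1` in `tilingSum`: the chain sum of the tail is either
continued, or `2r + 2` is uncovered and passed at time `n + 1`, or the tiling ends with the domino
`{2r + 1, 2r + 2}` and `2r` is passed at time `n + 1`. -/
theorem tilingSum_step (r n : ℕ) :
    tilingSum f J m (r + 1) (n + 1) = f (2 * r + 3) (n + 1) * tilingSum f J m (r + 1) n +
      oddTilingSumWith f J m (fun w => J w (2 * r + 2) (n + 1)) r n +
      m * ∑ A ∈ oddTilings r, tilingWeight m A * arrive f J (uncovered (2 * r) A) (n + 1) := by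
  have h : ∀ A, tilingWeight m A *
      chain f (2 * (r + 1) + 1) (arrive f J (uncovered (2 * (r + 1)) A)) (n + 1) =
      f (2 * r + 3) (n + 1) * (tilingWeight m A *
        chain f (2 * (r + 1) + 1) (arrive f J (uncovered (2 * (r + 1)) A)) n) +
      tilingWeight m A * arrive f J (uncovered (2 * (r + 1)) A) (n + 1) := by
    intro A
    rw [chain, show 2 * (r + 1) + 1 = 2 * r + 3 by ring]
    ring
  rw [tilingSum, Finset.sum_congr rfl fun A _ => h A, Finset.sum_add_distrib, ← Finset.mul_sum,
    sum_Tilings_succ r fun A =>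
      tilingWeight m A * arrive f J (uncovered (2 * (r + 1)) A) (n + 1), ← add_assoc]
  congr 1
  · congr 1
    refine Finset.sum_congr rfl fun A hA => ?_
    rw [show 2 * (r + 1) = 2 * r + 2 by ring, arrive_uncovered f J r n hA]
  · rw [Finset.mul_sum]
    refine Finset.sum_congr rfl fun A hA => ?_
    rw [tilingWeight_union_odd m (subset_of_mem_oddTilings hA),
      show 2 * (r + 1) = 2 * r + 2 by ring, uncovered_union_domino]
    ring

variable {g : ℕ → R} {n : ℕ}

theorem oddTilingSumWith_affine (hJ : ∀ w u, J w u (n + 1) = g u + m * f w (n + 1)) (u r : ℕ) :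
    oddTilingSumWith f J m (fun w => J w u (n + 1)) r n =
      g u * oddTilingSum f J m r n + m * oddTilingSumWith f J m (fun w => f w (n + 1)) r n := by
  rw [oddTilingSumWith, oddTilingSum, oddTilingSumWith, Finset.mul_sum, Finset.mul_sum,
    ← Finset.sum_add_distrib]
  refine Finset.sum_congr rfl fun A _ => ?_
  rw [hJ]
  ring

/-- If the weight of passing `u` after `w` is `g u + m * f w`, then the sums over partial tilings
satisfy a recursion in which no tiling occurs: the dominoes exactly cancel the dependence on all
positions but the last ones. -/
theorem oddTilingSum_step (hJ : ∀ w u, J w u (n + 1) = g u + m * f w (n + 1)) (r : ℕ) :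
    oddTilingSum f J m (r + 1) (n + 1) =
      f (2 * r + 3) (n + 1) * oddTilingSum f J m (r + 1) n +
        J (2 * r + 3) (2 * r + 2) (n + 1) * oddTilingSum f J m r n := by
  have hzero : oddTilingSum f J m 0 (n + 1) = f 1 (n + 1) * oddTilingSum f J m 0 n := by
    rw [oddTilingSum_zero, oddTilingSum_zero, chain, arrive_nil_succ, add_zero]
  induction r with
  | zero =>
    rw [oddTilingSum_succ, hzero, tilingSum_step, oddTilingSumWith_affine hJ,
      oddTilings_zero, hJ, oddTilingSumWith_zero, tilingSum_zero]
    have h2 := oddTilingSum_succ f J m 0 n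
    simp only [Finset.sum_singleton, mul_zero, uncovered_zero, arrive_nil_succ]
    linear_combination (-f (2 * 0 + 3) (n + 1)) * h2
  | succ r ih =>
    rw [oddTilingSum_succ, ih, tilingSum_step, oddTilingSumWith_affine hJ]
    have h1 : ∑ A ∈ oddTilings (r + 1),
        tilingWeight m A * arrive f J (uncovered (2 * (r + 1)) A) (n + 1) =
        oddTilingSumWith f J m (fun w => J w (2 * r + 2) (n + 1)) r n := by
      refine Finset.sum_congr rfl fun A hA => ?_
      rw [show 2 * (r + 1) = 2 * r + 2 by ring, arrive_uncovered f J r n hA]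
    rw [h1, oddTilingSumWith_affine hJ, oddTilingSumWith_succ, hJ, hJ]
    have h2 := oddTilingSum_succ f J m (r + 1) n
    have h3 := oddTilingSum_succ f J m r n
    simp only [show 2 * (r + 1) + 2 = 2 * r + 4 by ring, show 2 * (r + 1) + 3 = 2 * r + 5 by ring]
    linear_combination (-f (2 * r + 5) (n + 1)) * h2 - m * f (2 * r + 3) (n + 1) * h3

/-- The initial values of the recursion `oddTilingSum_step`.  At `r = 1` the tilings `∅` and
`{1, 2}` contribute `0` and `m`, and `{2, 3}` contributes `-m`. -/
theorem oddTilingSum_at_zero (f : ℕ → ℕ → R) (J : ℕ → ℕ → ℕ → R) (m : R) (r : ℕ) :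
    oddTilingSum f J m r 0 = if r = 0 then 1 else 0 := by
  have hT : ∀ r, tilingSum f J m (r + 1) 0 = if r = 0 then m else 0 := by
    intro r
    rw [tilingSum, sum_Tilings_succ]
    have h1 : ∑ A ∈ oddTilings (r + 1), tilingWeight m A *
        chain f (2 * (r + 1) + 1) (arrive f J (uncovered (2 * (r + 1)) A)) 0 = 0 := by
      refine Finset.sum_eq_zero fun A hA => ?_
      rw [show 2 * (r + 1) = 2 * r + 1 + 1 by ring, uncovered_of_subset
        (by simpa [mul_add] using subset_of_mem_oddTilings hA)]
      simp [chain]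
    rw [h1, zero_add]
    rcases r with _ | r
    · simp [oddTilings_zero, chain]
      rw [← Finset.empty_union {1, 2}, show ({1, 2} : Finset ℕ) = {2 * 0 + 1, 2 * 0 + 2} from rfl,
        tilingWeight_union_odd m (by simp), tilingWeight_empty]
      rw [show (2 : ℕ) = 0 + 2 from rfl, show (2 * 0 + 1 : ℕ) = 0 + 1 from rfl,
        show (2 * 0 + (0 + 2) : ℕ) = 0 + 2 from rfl, uncovered_union_domino, uncovered_zero]
      simp
    · rw [if_neg (by omega)]
      refine Finset.sum_eq_zero fun A hA => ?_
      rw [show 2 * (r + 1 + 1) = 2 * (r + 1) + 2 by ring, uncovered_union_domino,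
        show 2 * (r + 1) = 2 * r + 1 + 1 by ring, uncovered_of_subset
        (by simpa [mul_add] using subset_of_mem_oddTilings hA)]
      simp [chain]
  have h : ∀ r, oddTilingSum f J m (r + 1) 0 = 0 := by
    intro r
    induction r with
    | zero =>
      rw [oddTilingSum_succ, hT, oddTilingSum_zero]
      simp [chain]
    | succ r ih =>
      rw [oddTilingSum_succ, hT, ih]
      simp
  rcases r with _ | r
  · rw [oddTilingSum_zero]
    simp [chain]
  · rw [h, if_neg (by omega)]

end Chain

/-! ### The weights as power series in one variable -/

section Series

variable {K : Type*} [CommRing K] (ξ : ℕ → K) (e : ℕ)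

/-- The geometric series `1 / (1 - a z)`. -/
noncomputable def geomSeries (a : K) : PowerSeries K := PowerSeries.mk fun k => a ^ k

@[simp]
theorem coeff_geomSeries (a : K) (k : ℕ) : PowerSeries.coeff k (geomSeries a) = a ^ k :=
  PowerSeries.coeff_mk _ _

theorem geomSeries_mul (a : K) : geomSeries a * (1 - PowerSeries.C a * PowerSeries.X) = 1 := by
  ext k
  rw [mul_sub, mul_one, map_sub, mul_left_comm, PowerSeries.coeff_C_mul]
  rcases k with _ | k
  · simp
  · rw [PowerSeries.coeff_succ_mul_X, PowerSeries.coeff_one, if_neg (by omega)]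
    simp [pow_succ']

/-- The weight `η_n ξ_n^ε / (1 - ξ_n z)`, with `η_n = ξ_n - 1`, of a summation variable `n`. -/
noncomputable def jumpSeries (n : ℕ) : PowerSeries K :=
  PowerSeries.C ((ξ n - 1) * ξ n ^ e) * geomSeries (ξ n)

/-- The factor `1 / (1 - ξ_{N-j} z)` of the weight of the step at `j`. -/
noncomputable def stepLeft (N j : ℕ) : PowerSeries K := geomSeries (ξ (N - j))

/-- The factor `1 + ε η_j z` of the weight of the step at `j`. -/
noncomputable def stepRight (j : ℕ) : PowerSeries K :=
  1 + PowerSeries.C (e * (ξ j - 1)) * PowerSeries.X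

/-- The weight of the step at `j`. -/
noncomputable def stepSeries (N j : ℕ) : PowerSeries K := stepLeft ξ N j * stepRight ξ e j

/-- The weight of the passage from a summation variable `m` to the next one `n`. -/
noncomputable def regionSeries (N m n : ℕ) : PowerSeries K :=
  stepLeft ξ N n * ∏ j ∈ Finset.Ioo m n, stepSeries ξ e N j

theorem stepLeft_succ (N n : ℕ) : stepLeft ξ (N + 1) (n + 1) = stepLeft ξ N n := by
  rw [stepLeft, stepLeft, Nat.add_sub_add_right]

end Series

/-! ### The recursion for the generating functions -/

section Generating

variable {K R : Type*} [CommRing K] [CommRing R] (ξ : ℕ → K) (e : ℕ) (κ : K →+* R)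
  (E : ℕ → PowerSeries K →+* R)

/-- The polynomial `1 - ξ_N (1 - (1 - z_w) (1 - z_u))` in the variables at two positions. -/
noncomputable def pairFactor (N w u : ℕ) : R :=
  1 - κ (ξ N) * (E w PowerSeries.X + E u PowerSeries.X - E w PowerSeries.X * E u PowerSeries.X)

/-- The weight of the step at `n` in the variable at the position `w`. -/
noncomputable def stepWeight (N w n : ℕ) : R := E w (stepSeries ξ e N n)

/-- The weight of the passage of `n` by the block at the positions `w` and `u`. -/
noncomputable def passWeight (N w u n : ℕ) : R := E u (jumpSeries ξ e n) * E w (stepLeft ξ N n)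

/-- `passWeight`, times the factor `pairFactor` of the block. -/
noncomputable def pairPassWeight (N w u n : ℕ) : R :=
  pairFactor ξ κ E N w u * passWeight ξ e E N w u n

/-- The product of `pairFactor` over the blocks of a list of positions. -/
noncomputable def pairProd (N : ℕ) : List ℕ → R
  | u :: w :: L => pairFactor ξ κ E N w u * pairProd N L
  | _ => 1

/-- The product of `pairFactor` over `{0, 1}, {2, 3}, …, {2r, 2r + 1}`. -/
noncomputable def shiftedPairProd (N r : ℕ) : R :=
  ∏ i ∈ Finset.range (r + 1), pairFactor ξ κ E N (2 * i) (2 * i + 1)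

/-- The sum over `n < N` of the chain sums of the list of positions `L` that end at `n`. -/
noncomputable def generating (N : ℕ) (L : List ℕ) : R :=
  ∑ n ∈ Finset.range N, arrive (stepWeight ξ e E N) (passWeight ξ e E N) L n

theorem chain_mul {f : ℕ → ℕ → R} {w : ℕ} (c : R) (F : ℕ → R) (n : ℕ) :
    chain f w (fun k => c * F k) n = c * chain f w F n := by
  induction n with
  | zero => rfl
  | succ n ih =>
    rw [chain, chain, ih]
    ring

theorem chain_of_one {f : ℕ → ℕ → R} {w : ℕ} (hf : ∀ n, f w n = 1) (F : ℕ → R) (n : ℕ) :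
    chain f w F n = ∑ k ∈ Finset.range (n + 1), F k := by
  induction n with
  | zero => simp [chain]
  | succ n ih => rw [chain, ih, hf, one_mul, Finset.sum_range_succ _ (n + 1)]

theorem arrive_pairPassWeight (N : ℕ) : ∀ (L : List ℕ) (n : ℕ),
    arrive (stepWeight ξ e E N) (pairPassWeight ξ e κ E N) L n =
      pairProd ξ κ E N L * arrive (stepWeight ξ e E N) (passWeight ξ e E N) L n
  | [], n => by cases n <;> simp [pairProd]
  | [_], n => by cases n <;> simp [arrive]
  | u :: w :: L, 0 => by simp
  | u :: w :: L, n + 1 => by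
    rw [arrive_cons_cons, arrive_cons_cons, funext (arrive_pairPassWeight N L), chain_mul,
      pairPassWeight, pairProd]
    ring

variable {κ E} (hE : ∀ i a, E i (PowerSeries.C a) = κ a)

include hE

theorem geomSeries_map_mul (i : ℕ) (a : K) :
    E i (geomSeries a) * (1 - κ a * E i PowerSeries.X) = 1 := by
  rw [← hE i a, ← map_mul, ← map_one (E i), ← map_sub, ← map_mul, geomSeries_mul]

variable {ξ e}

/-- The weight of passing `u` after `w` is the sum of a term that depends on `u` only and of
a multiple of the weight of a step in `w`. This partial fraction decomposition comes from
`ξ_N (ξ_n + ξ_{N-n} - 1) = ξ_n ξ_{N-n}`. -/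
theorem pairPassWeight_affine (he : e = 0 ∨ e = 1) {N n : ℕ}
    (hξ : ξ N * (ξ n + ξ (N - n) - 1) = ξ n * ξ (N - n)) (w u : ℕ) :
    pairPassWeight ξ e κ E N w u n =
      (κ ((ξ n - 1) * ξ n ^ e) * (1 - κ (ξ N) * E u PowerSeries.X) -
        κ ((ξ N - 1) * ξ N ^ e) * (1 - κ (ξ n) * E u PowerSeries.X)) * E u (geomSeries (ξ n)) +
      κ ((ξ N - 1) * ξ N ^ e) * stepWeight ξ e E N w n := by
  have ha := geomSeries_map_mul hE w (ξ (N - n))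
  have hb := geomSeries_map_mul hE u (ξ n)
  have hξ' := congrArg κ hξ
  simp only [pairPassWeight, passWeight, stepWeight, pairFactor, jumpSeries, stepSeries, stepLeft,
    stepRight, map_mul, map_add, map_sub, map_one, map_pow, hE, map_natCast] at hξ' ⊢
  generalize E w (geomSeries (ξ (N - n))) = a at *
  generalize E u (geomSeries (ξ n)) = b at *
  generalize E w PowerSeries.X = z at *
  generalize E u PowerSeries.X = z' at *
  generalize κ (ξ (N - n)) = t at *
  generalize κ (ξ n) = s at *
  generalize κ (ξ N) = p at *
  rcases he with rfl | rfl
  · simp only [Nat.cast_zero, pow_zero]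
    linear_combination (-z * (1 - z') * a * b) * hξ' +
      ((s - 1) * (1 - p * z') - (p - 1) * (1 - s * z')) * b * ha + (p - 1) * a * hb
  · simp only [Nat.cast_one, pow_one]
    linear_combination (-z * (s + p - 1 - z' * s * p) * a * b) * hξ' +
      ((s - 1) * s * (1 - p * z') - (p - 1) * p * (1 - s * z')) * b * ha +
      (p - 1) * p * (1 + (s - 1) * z) * a * hb

/-- Raising `N` by one and shifting all summation variables by one exchanges the blocks
`{2i - 1, 2i}` with the blocks `{2i, 2i + 1}`. -/
theorem shiftedPairProd_mul_chain (he : e = 0 ∨ e = 1) (h0 : E 0 PowerSeries.X = 0) {N : ℕ}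
    (hξ : ∀ n, 1 ≤ n → n < N → ξ N * (ξ n + ξ (N - n) - 1) = ξ n * ξ (N - n)) :
    ∀ n, n < N → ∀ r, shiftedPairProd ξ κ E N r * E (2 * r + 1) (stepLeft ξ N n) *
      chain (stepWeight ξ e E (N + 1)) (2 * r + 1)
        (arrive (stepWeight ξ e E (N + 1)) (passWeight ξ e E (N + 1)) (uncovered (2 * r) ∅)) n =
      oddTilingSum (stepWeight ξ e E N) (pairPassWeight ξ e κ E N)
        (κ ((ξ N - 1) * ξ N ^ e)) r n := by
  intro n
  induction n with
  | zero =>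
    intro _ r
    rw [oddTilingSum_at_zero]
    rcases r with _ | r
    · have := geomSeries_map_mul hE 1 (ξ N)
      simp [chain, uncovered_zero, shiftedPairProd, pairFactor, h0, stepLeft]
      linear_combination this
    · rw [if_neg (by omega), show 2 * (r + 1) = 2 * r + 1 + 1 by ring,
        uncovered_of_subset (Finset.empty_subset _)]
      simp [chain]
  | succ n ih =>
    intro hn r
    have ih := ih (by omega)
    have hstep : ∀ w, stepWeight ξ e E (N + 1) w (n + 1) =
        E w (stepLeft ξ N n) * E w (stepRight ξ e (n + 1)) := by
      intro w
      rw [stepWeight, stepSeries, stepLeft_succ, map_mul]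
    have hstep' : ∀ w, stepWeight ξ e E N w (n + 1) =
        E w (stepLeft ξ N (n + 1)) * E w (stepRight ξ e (n + 1)) := by
      intro w
      rw [stepWeight, stepSeries, map_mul]
    rcases r with _ | r
    · have h1 := ih 0
      simp only [oddTilingSum_zero, mul_zero, zero_add, uncovered_zero] at h1 ⊢
      rw [chain, chain, ← h1, arrive_nil_succ, arrive_nil_succ, hstep, hstep']
      ring
    · rw [oddTilingSum_step
        (fun w u => pairPassWeight_affine hE he (hξ (n + 1) (by omega) hn) w u) r, ← ih, ← ih,
        chain, show 2 * (r + 1) = 2 * r + 1 + 1 by ring,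
        uncovered_of_subset (Finset.empty_subset _), uncovered_of_subset (Finset.empty_subset _),
        arrive_cons_cons, shiftedPairProd, Finset.prod_range_succ, ← shiftedPairProd, hstep,
        show 2 * r + 1 + 1 + 1 = 2 * r + 3 by ring, hstep', pairPassWeight, passWeight, passWeight,
        stepLeft_succ, show 2 * (r + 1) = 2 * r + 2 by ring, pairFactor, pairFactor,
        show 2 * r + 1 + 1 = 2 * r + 2 by ring, show 2 * r + 2 + 1 = 2 * r + 3 by ring]
      ring

/-- The recursion in `N` for the generating functions of the chain sums. -/
theorem generating_succ (he : e = 0 ∨ e = 1) (h0 : E 0 PowerSeries.X = 0) {N r : ℕ} (hN : 1 ≤ N)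
    (hr : 1 ≤ r) (hlast : ∀ φ, E (2 * r + 1) φ = κ (PowerSeries.constantCoeff φ))
    (hξ : ∀ n, 1 ≤ n → n < N → ξ N * (ξ n + ξ (N - n) - 1) = ξ n * ξ (N - n)) :
    shiftedPairProd ξ κ E N r * generating ξ e E (N + 1) (uncovered (2 * r) ∅) =
      ∑ A ∈ Tilings r, tilingWeight (κ ((ξ N - 1) * ξ N ^ e)) A *
        (pairProd ξ κ E N (uncovered (2 * r) A) * generating ξ e E N (uncovered (2 * r) A)) := by
  obtain ⟨N, rfl⟩ := Nat.exists_eq_add_of_le' hN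
  obtain ⟨r, rfl⟩ := Nat.exists_eq_add_of_le' hr
  have hgeom : ∀ a : K, PowerSeries.constantCoeff (geomSeries a) = 1 := by
    intro a
    rw [← PowerSeries.coeff_zero_eq_constantCoeff_apply, coeff_geomSeries, pow_zero]
  have hleft : ∀ M n, E (2 * (r + 1) + 1) (stepLeft ξ M n) = 1 := by
    intro M n
    rw [hlast, stepLeft, hgeom, map_one]
  have hone : ∀ M n, stepWeight ξ e E M (2 * (r + 1) + 1) n = 1 := by
    intro M n
    rw [stepWeight, stepSeries, map_mul, hleft, hlast, stepRight]
    simp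
  have hz : E (2 * (r + 1) + 1) PowerSeries.X = 0 := by
    rw [hlast]
    simp
  have hrhs : ∑ A ∈ Tilings (r + 1), tilingWeight (κ ((ξ (N + 1) - 1) * ξ (N + 1) ^ e)) A *
        (pairProd ξ κ E (N + 1) (uncovered (2 * (r + 1)) A) *
          generating ξ e E (N + 1) (uncovered (2 * (r + 1)) A)) =
      tilingSum (stepWeight ξ e E (N + 1)) (pairPassWeight ξ e κ E (N + 1))
        (κ ((ξ (N + 1) - 1) * ξ (N + 1) ^ e)) (r + 1) N := by
    refine Finset.sum_congr rfl fun A _ => ?_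
    rw [chain_of_one (hone _), generating, Finset.mul_sum]
    simp only [arrive_pairPassWeight]
  have h1 := shiftedPairProd_mul_chain hE he h0 hξ N (by omega) (r + 1)
  have h2 := shiftedPairProd_mul_chain hE he h0 hξ N (by omega) r
  rw [chain_of_one (hone _), hleft, mul_one] at h1
  rw [hrhs, generating, Finset.sum_range_succ, mul_add, h1]
  have h3 := oddTilingSum_succ (stepWeight ξ e E (N + 1)) (pairPassWeight ξ e κ E (N + 1))
        (κ ((ξ (N + 1) - 1) * ξ (N + 1) ^ e)) r N
  have h4 : pairFactor ξ κ E (N + 1) (2 * (r + 1)) (2 * (r + 1) + 1) *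
      E (2 * r + 2) (jumpSeries ξ e (N + 1)) = κ ((ξ (N + 1) - 1) * ξ (N + 1) ^ e) := by
    have := geomSeries_map_mul hE (2 * r + 2) (ξ (N + 1))
    rw [pairFactor, hz, jumpSeries, map_mul, hE, show 2 * (r + 1) = 2 * r + 2 by ring]
    linear_combination κ ((ξ (N + 1) - 1) * ξ (N + 1) ^ e) * this
  have h5 : uncovered (2 * (r + 1)) ∅ = (2 * r + 2) :: (2 * r + 1) :: uncovered (2 * r) ∅ := by
    rw [show 2 * (r + 1) = 2 * r + 1 + 1 by ring, uncovered_of_subset (Finset.empty_subset _),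
      uncovered_of_subset (Finset.empty_subset _)]
  rw [h5, arrive_cons_cons, shiftedPairProd, Finset.prod_range_succ, ← shiftedPairProd, passWeight,
    stepLeft_succ, h3]
  linear_combination (pairFactor ξ κ E (N + 1) (2 * (r + 1)) (2 * (r + 1) + 1) *
    E (2 * r + 2) (jumpSeries ξ e (N + 1))) * h2 +
    oddTilingSum (stepWeight ξ e E (N + 1)) (pairPassWeight ξ e κ E (N + 1))
      (κ ((ξ (N + 1) - 1) * ξ (N + 1) ^ e)) r N * h4

end Generating

/-! ### Expansion of the products over blocks -/

section Expansion

variable {K R : Type*} [CommRing K] [CommRing R]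

theorem inter_pair_nonempty {B : Finset ℕ} {a b : ℕ} :
    (B ∩ {a, b}).Nonempty ↔ a ∈ B ∨ b ∈ B := by
  simp only [Finset.Nonempty, Finset.mem_inter, Finset.mem_insert, Finset.mem_singleton]
  constructor
  · rintro ⟨x, hx, rfl | rfl⟩
    · exact Or.inl hx
    · exact Or.inr hx
  · rintro (h | h)
    · exact ⟨a, h, Or.inl rfl⟩
    · exact ⟨b, h, Or.inr rfl⟩

/-- The number of blocks of a list `[u_r, w_r, …, u₁, w₁]` that meet `B`. -/
def blockCount : List ℕ → Finset ℕ → ℕ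
  | u :: w :: L, B => (if w ∈ B ∨ u ∈ B then 1 else 0) + blockCount L B
  | _, _ => 0

theorem blockCount_congr : ∀ (L : List ℕ) {B B' : Finset ℕ}, (∀ i ∈ L, i ∈ B ↔ i ∈ B') →
    blockCount L B = blockCount L B'
  | [], _, _, _ => rfl
  | [_], _, _, _ => rfl
  | u :: w :: L, B, B', h => by
    rw [blockCount, blockCount, blockCount_congr L fun i hi => h i (by simp [hi])]
    simp only [h u (by simp), h w (by simp)]

theorem blockCount_map (σ : ℕ → ℕ) : ∀ (L : List ℕ) {B : Finset ℕ},
    (∀ i ∈ L, ∀ j ∈ B, σ i = σ j → i = j) → blockCount (L.map σ) (B.image σ) = blockCount L B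
  | [], _, _ => rfl
  | [_], _, _ => rfl
  | u :: w :: L, B, h => by
    have h1 : ∀ i ∈ u :: w :: L, (σ i ∈ B.image σ ↔ i ∈ B) := by
      intro i hi
      rw [Finset.mem_image]
      constructor
      · rintro ⟨j, hj, hij⟩
        rwa [h i hi j hj hij.symm]
      · intro hi'
        exact ⟨i, hi', rfl⟩
    rw [List.map_cons, List.map_cons, blockCount, blockCount,
      blockCount_map σ L fun i hi => h i (by simp [hi])]
    simp only [h1 u (by simp), h1 w (by simp)]

theorem beta_succ (k : ℕ) (B : Finset ℕ) :
    beta (k + 1) B = (if 2 * k + 1 ∈ B ∨ 2 * k + 2 ∈ B then 1 else 0) + beta k B := by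
  rw [beta, beta, ← Finset.insert_Icc_right_eq_Icc_add_one (by omega), Finset.filter_insert]
  have h : ((B ∩ {2 * (k + 1) - 1, 2 * (k + 1)}).Nonempty) ↔ 2 * k + 1 ∈ B ∨ 2 * k + 2 ∈ B := by
    rw [inter_pair_nonempty]
    rfl
  by_cases h' : 2 * k + 1 ∈ B ∨ 2 * k + 2 ∈ B
  · rw [if_pos (h.2 h'), if_pos h', Finset.card_insert_of_notMem (by simp)]
    omega
  · rw [if_neg (mt h.1 h'), if_neg h', zero_add]

theorem blockCount_range (k : ℕ) (B : Finset ℕ) :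
    blockCount (List.range' 1 (2 * k)).reverse B = beta k B := by
  induction k with
  | zero => simp [blockCount, beta]
  | succ k ih =>
    rw [show 2 * (k + 1) = 2 * k + 1 + 1 by ring, List.range'_concat, List.range'_concat,
      List.reverse_append, List.reverse_append]
    simp only [List.reverse_cons, List.reverse_nil, List.nil_append, List.cons_append, blockCount]
    rw [ih, beta_succ]
    simp only [one_mul, show 1 + (2 * k + 1) = 2 * k + 2 by ring,
      show 1 + 2 * k = 2 * k + 1 by ring]

theorem beta_eq_of_le {k r : ℕ} (hk : k ≤ r) {B : Finset ℕ} (hB : ∀ i ∈ B, i ≤ 2 * k) :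
    beta r B = beta k B := by
  induction r, hk using Nat.le_induction with
  | base => rfl
  | succ r hr ih =>
    rw [beta_succ, ih, if_neg, zero_add]
    rintro (h | h)
    · have := hB _ h
      omega
    · have := hB _ h
      omega

theorem sigma_succ (A : Finset ℕ) (n : ℕ) :
    sigma A (n + 1) = sigma A n + if n + 1 ∈ A then 0 else 1 := by
  rw [sigma, sigma, ← Finset.insert_Icc_right_eq_Icc_add_one (by omega)]
  by_cases h : n + 1 ∈ A
  · rw [Finset.insert_sdiff_of_mem _ h, if_pos h, add_zero]
  · rw [Finset.insert_sdiff_of_notMem _ h, Finset.card_insert_of_notMem (by simp), if_neg h]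

theorem uncovered_map_sigma (A : Finset ℕ) (n : ℕ) :
    (uncovered n A).map (sigma A) = (List.range' 1 (sigma A n)).reverse := by
  induction n with
  | zero => simp [uncovered_zero, sigma]
  | succ n ih =>
    rw [uncovered_succ, sigma_succ]
    by_cases h : n + 1 ∈ A
    · simp only [h, if_true, ih, add_zero]
    · rw [if_neg h, if_neg h, List.map_cons, ih, List.range'_concat, List.reverse_append,
        sigma_succ, if_neg h]
      simp [add_comm]

theorem mem_uncovered {n i : ℕ} {A : Finset ℕ} :
    i ∈ uncovered n A ↔ i ∈ Finset.Icc 1 n \ A := by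
  rw [uncovered, List.mem_reverse, List.mem_filter, List.mem_range'_1, Finset.mem_sdiff,
    Finset.mem_Icc]
  simp only [decide_eq_true_eq]
  constructor
  · rintro ⟨h, h'⟩
    exact ⟨by omega, h'⟩
  · rintro ⟨h, h'⟩
    exact ⟨by omega, h'⟩

theorem nodup_uncovered (n : ℕ) (A : Finset ℕ) : (uncovered n A).Nodup :=
  List.nodup_reverse.2 (List.Nodup.filter _ List.nodup_range')

theorem length_uncovered (n : ℕ) (A : Finset ℕ) : (uncovered n A).length = sigma A n := by
  have := congrArg List.length (uncovered_map_sigma A n)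
  simpa using this

theorem even_card_of_mem_Tilings (r : ℕ) :
    (∀ A ∈ Tilings r, Even A.card) ∧ ∀ A ∈ oddTilings (r + 1), Even A.card := by
  have hdom : ∀ (A : Finset ℕ) (n : ℕ), A ⊆ Finset.Icc 1 n → Even A.card →
      Even (A ∪ {n + 1, n + 2}).card := by
    intro A n hA h
    rw [Finset.card_union_of_disjoint, Finset.card_pair (by omega)]
    · exact h.add even_two
    · refine disjoint_of_subset_Icc hA ?_
      intro i hi
      simp only [Finset.mem_insert, Finset.mem_singleton] at hi
      omega
  induction r with
  | zero => simp [Tilings_zero, oddTilings_one]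
  | succ r ih =>
    have h1 : ∀ A ∈ oddTilings r, Even A.card := fun A hA => ih.1 A (Finset.mem_filter.1 hA).1
    have h2 : ∀ A ∈ Tilings (r + 1), Even A.card := by
      intro A hA
      rcases mem_Tilings_succ.1 hA with h | ⟨A', h, rfl⟩
      · exact ih.2 A h
      · exact hdom A' (2 * r) ((subset_of_mem_oddTilings h).trans
          (Finset.Icc_subset_Icc_right (by omega))) (h1 A' h)
    refine ⟨h2, fun A hA => ?_⟩
    rcases mem_oddTilings_succ.1 hA with h | ⟨A', h, rfl⟩
    · exact h2 A h
    · exact hdom A' (2 * r + 1) (by simpa [mul_add] using subset_of_mem_oddTilings h) (ih.2 A' h)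

theorem even_length_uncovered {r : ℕ} {A : Finset ℕ} (hA : A ∈ Tilings r) :
    Even (uncovered (2 * r) A).length := by
  have h1 := (even_card_of_mem_Tilings r).1 A hA
  have h2 := Finset.card_sdiff_add_card_eq_card (subset_of_mem_Tilings hA)
  rw [length_uncovered, sigma]
  rw [Nat.card_Icc] at h2
  rcases h1 with ⟨k, hk⟩
  exact ⟨r - k, by omega⟩

theorem sigma_injOn {n i j : ℕ} {A : Finset ℕ} (hi : i ∈ uncovered n A) (hj : j ∈ uncovered n A)
    (h : sigma A i = sigma A j) : i = j := by
  refine List.inj_on_of_nodup_map (f := sigma A) ?_ hi hj h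
  rw [uncovered_map_sigma]
  exact List.nodup_reverse.2 List.nodup_range'

/-- Both sides count the pairs of consecutive uncovered positions that meet `B`; deleting `A`
renumbers the uncovered positions by `σ_A`. -/
theorem blockCount_uncovered {r : ℕ} {A B : Finset ℕ} (hA : A ∈ Tilings r)
    (hB : B ⊆ Finset.Icc 1 (2 * r) \ A) : blockCount (uncovered (2 * r) A) B = betaA r A B := by
  have hB' : ∀ j ∈ B, j ∈ uncovered (2 * r) A := fun j hj => mem_uncovered.2 (hB hj)
  obtain ⟨k, hk⟩ := even_length_uncovered hA
  have hkr : sigma A (2 * r) = 2 * k := by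
    rw [← length_uncovered, hk]
    ring
  have hle : k ≤ r := by
    have : sigma A (2 * r) ≤ (Finset.Icc 1 (2 * r)).card := Finset.card_le_card Finset.sdiff_subset
    rw [Nat.card_Icc] at this
    omega
  rw [← blockCount_map (sigma A), uncovered_map_sigma, hkr, blockCount_range, betaA,
    beta_eq_of_le hle]
  · intro i hi
    obtain ⟨j, hj, rfl⟩ := Finset.mem_image.1 hi
    have : sigma A j ∈ (uncovered (2 * r) A).map (sigma A) := List.mem_map_of_mem (hB' j hj)
    rw [uncovered_map_sigma, List.mem_reverse, List.mem_range'_1, hkr] at this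
    omega
  · intro i hi j hj h
    exact sigma_injOn hi (hB' j hj) h

variable (ξ : ℕ → K) (κ : K →+* R) (E : ℕ → PowerSeries K →+* R)

/-- Multiplication by a factor of a new pair adds the elements of the pair to the subsets. -/
theorem pairFactor_mul_sum (N : ℕ) {w u : ℕ} {U : Finset ℕ} (hw : w ∉ U) (hu : u ∉ U)
    (hwu : w ≠ u) (cnt cnt' : Finset ℕ → ℕ)
    (hc : ∀ B, cnt' B = (if w ∈ B ∨ u ∈ B then 1 else 0) + cnt (B \ {w, u})) :
    pairFactor ξ κ E N w u * ∑ B ∈ U.powerset,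
        (-1) ^ B.card * κ (ξ N) ^ cnt B * ∏ j ∈ B, E j PowerSeries.X =
      ∑ B ∈ (insert w (insert u U)).powerset,
        (-1) ^ B.card * κ (ξ N) ^ cnt' B * ∏ j ∈ B, E j PowerSeries.X := by
  rw [Finset.sum_powerset_insert (by simp [hw, hwu]), Finset.sum_powerset_insert hu,
    Finset.sum_powerset_insert hu, ← Finset.sum_add_distrib, ← Finset.sum_add_distrib,
    ← Finset.sum_add_distrib, Finset.mul_sum]
  refine Finset.sum_congr rfl fun B hB => ?_
  have hB := Finset.mem_powerset.1 hB
  have hwB : w ∉ B := fun h => hw (hB h)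
  have huB : u ∉ B := fun h => hu (hB h)
  have hwB' : w ∉ insert u B := by simp [hwB, hwu]
  have hs : B \ {w, u} = B := by
    rw [Finset.sdiff_eq_self_iff_disjoint, Finset.disjoint_left]
    rintro i hi hi'
    rcases Finset.mem_insert.1 hi' with rfl | hi'
    · exact hwB hi
    · rw [Finset.mem_singleton] at hi'
      subst hi'
      exact huB hi
  have hs1 : insert u B \ {w, u} = B := by
    rw [Finset.insert_sdiff_of_mem _ (by simp), hs]
  have hs2 : insert w B \ {w, u} = B := by
    rw [Finset.insert_sdiff_of_mem _ (by simp), hs]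
  have hs3 : insert w (insert u B) \ {w, u} = B := by
    rw [Finset.insert_sdiff_of_mem _ (by simp), hs1]
  rw [hc, hc, hc, hc, hs, hs1, hs2, hs3, if_neg (by simp [hwB, huB]), if_pos (by simp),
    if_pos (by simp), if_pos (by simp), Finset.card_insert_of_notMem hwB',
    Finset.card_insert_of_notMem hwB, Finset.card_insert_of_notMem huB,
    Finset.prod_insert hwB', Finset.prod_insert hwB, Finset.prod_insert huB, pairFactor]
  ring

theorem pairProd_eq_sum (N : ℕ) : ∀ L : List ℕ, L.Nodup → Even L.length →
    pairProd ξ κ E N L = ∑ B ∈ L.toFinset.powerset,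
      (-1) ^ B.card * κ (ξ N) ^ blockCount L B * ∏ j ∈ B, E j PowerSeries.X
  | [], _, _ => by simp [pairProd, blockCount]
  | [_], _, h => by simp at h
  | u :: w :: L, hL, h => by
    have hL1 := List.nodup_cons.1 hL
    have hL2 := List.nodup_cons.1 hL1.2
    have hu : u ∉ L := fun h => hL1.1 (by simp [h])
    have hne : w ≠ u := fun h => hL1.1 (by simp [h])
    rw [pairProd, pairProd_eq_sum N L hL2.2 (by
      simpa [Nat.even_add_one] using h), List.toFinset_cons, List.toFinset_cons,
      Finset.insert_comm, pairFactor_mul_sum ξ κ E N (by simpa using hL2.1) (by simpa using hu) hne]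
    intro B
    rw [blockCount, blockCount_congr L (B := B \ {w, u})]
    intro i hi
    have h1 : i ≠ w := by rintro rfl; exact hL2.1 hi
    have h2 : i ≠ u := by rintro rfl; exact hu hi
    simp [h1, h2]

theorem alpha_succ (k : ℕ) (B : Finset ℕ) :
    alpha (k + 1) B = (if 2 * k + 2 ∈ B ∨ 2 * k + 3 ∈ B then 1 else 0) + alpha k B := by
  rw [alpha, alpha, ← Finset.insert_Icc_right_eq_Icc_add_one (by omega), Finset.filter_insert]
  have h : ((B ∩ {2 * (k + 1), 2 * (k + 1) + 1}).Nonempty) ↔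
      2 * k + 2 ∈ B ∨ 2 * k + 3 ∈ B := by
    rw [inter_pair_nonempty]
    rfl
  by_cases h' : 2 * k + 2 ∈ B ∨ 2 * k + 3 ∈ B
  · rw [if_pos (h.2 h'), if_pos h', Finset.card_insert_of_notMem (by simp)]
    omega
  · rw [if_neg (mt h.1 h'), if_neg h', zero_add]

theorem alpha_congr {k : ℕ} {B B' : Finset ℕ} (h : ∀ i, i ≤ 2 * k + 1 → (i ∈ B ↔ i ∈ B')) :
    alpha k B = alpha k B' := by
  rw [alpha, alpha]
  congr 1
  refine Finset.filter_congr fun i hi => ?_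
  have := Finset.mem_Icc.1 hi
  rw [inter_pair_nonempty, inter_pair_nonempty, h _ (by omega), h _ (by omega)]

theorem alpha_zero (B : Finset ℕ) : alpha 0 B = if 0 ∈ B ∨ 1 ∈ B then 1 else 0 := by
  have h := inter_pair_nonempty (B := B) (a := 0) (b := 1)
  rw [alpha]
  by_cases h' : 0 ∈ B ∨ 1 ∈ B
  · simp [Finset.filter_singleton, h.2 h', h']
  · simp only [Finset.Icc_self, Finset.filter_singleton, mul_zero, zero_add, h, h', if_false,
      Finset.card_empty]

theorem shiftedPairProd_eq_sum_range (N r : ℕ) :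
    shiftedPairProd ξ κ E N r = ∑ B ∈ (Finset.range (2 * r + 2)).powerset,
      (-1) ^ B.card * κ (ξ N) ^ alpha r B * ∏ j ∈ B, E j PowerSeries.X := by
  induction r with
  | zero =>
    have h := pairFactor_mul_sum ξ κ E N (w := 0) (u := 1) (U := ∅) (by simp) (by simp) (by simp)
      (fun _ => 0) (alpha 0) (fun B => by rw [alpha_zero, add_zero])
    simp only [Finset.powerset_empty, Finset.sum_singleton, Finset.card_empty, pow_zero,
      Finset.prod_empty, mul_one] at h
    rw [shiftedPairProd, Finset.prod_range_one]
    exact h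
  | succ r ih =>
    rw [shiftedPairProd, Finset.prod_range_succ, ← shiftedPairProd, mul_comm, ih,
      pairFactor_mul_sum ξ κ E N (cnt' := alpha (r + 1))]
    · refine Finset.sum_congr ?_ fun _ _ => rfl
      rw [show 2 * (r + 1) + 2 = 2 * r + 2 + 1 + 1 by ring,
        Finset.range_add_one (n := 2 * r + 2 + 1), Finset.range_add_one (n := 2 * r + 2),
        Finset.insert_comm, show 2 * (r + 1) = 2 * r + 2 by ring]
    · simp
      omega
    · simp
    · omega
    · intro B
      rw [alpha_succ]
      congr 1
      refine alpha_congr fun i hi => ?_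
      have h1 : i ≠ 2 * (r + 1) := by omega
      have h2 : i ≠ 2 * (r + 1) + 1 := by omega
      simp [h1, h2]

theorem shiftedPairProd_eq_sum (N r : ℕ) (h0 : E 0 PowerSeries.X = 0)
    (hlast : E (2 * r + 1) PowerSeries.X = 0) :
    shiftedPairProd ξ κ E N r = ∑ B ∈ (Finset.Icc 1 (2 * r)).powerset,
      (-1) ^ B.card * κ (ξ N) ^ alpha r B * ∏ j ∈ B, E j PowerSeries.X := by
  rw [shiftedPairProd_eq_sum_range]
  symm
  apply Finset.sum_subset
  · apply Finset.powerset_mono.2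
    intro i hi
    have := Finset.mem_Icc.1 hi
    rw [Finset.mem_range]
    omega
  · intro B hB hB'
    rw [Finset.mem_powerset] at hB hB'
    obtain ⟨i, hi, hi'⟩ := Finset.not_subset.1 hB'
    have h1 := Finset.mem_range.1 (hB hi)
    rw [Finset.mem_Icc] at hi'
    have h2 : i = 0 ∨ i = 2 * r + 1 := by omega
    have h3 : E i PowerSeries.X = 0 := by
      rcases h2 with rfl | rfl
      · exact h0
      · exact hlast
    rw [Finset.prod_eq_zero hi h3, mul_zero]

end Expansion

/-! ### Coefficients of the generating functions -/

section Coefficients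

variable {K : Type*} [CommRing K]

/-- The substitution of the variable at position `i` into a power series in one variable. -/
noncomputable def substVar (K : Type*) [CommRing K] (i : ℕ) :
    PowerSeries K →+* MvPowerSeries ℕ K :=
  (MvPowerSeries.rename (R := K)
    (Function.Embedding.punit i)).toRingHom

theorem coeff_substVar (i : ℕ) (φ : PowerSeries K) (m : ℕ →₀ ℕ) :
    MvPowerSeries.coeff m (substVar K i φ) =
      if m = Finsupp.single i (m i) then PowerSeries.coeff (m i) φ else 0 := by
  by_cases h : m = Finsupp.single i (m i)
  · rw [if_pos h]
    conv_lhs => rw [h]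
    have := MvPowerSeries.coeff_embDomain_rename
      (Function.Embedding.punit i) φ (Finsupp.single () (m i))
    rw [Finsupp.embDomain_single] at this
    exact this
  · rw [if_neg h]
    refine MvPowerSeries.coeff_rename_eq_zero _ φ ?_
    rintro ⟨x, rfl⟩
    apply h
    ext j
    have hx : x = Finsupp.single () (x ()) := by
      ext
      simp
    rw [hx, Finsupp.mapDomain_single, show (Function.Embedding.punit i) () = i from rfl,
      Finsupp.single_eq_same]

theorem substVar_X (i : ℕ) : substVar K i PowerSeries.X = MvPowerSeries.X i :=
  MvPowerSeries.rename_X _ _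

theorem substVar_C (i : ℕ) (a : K) : substVar K i (PowerSeries.C a) = MvPowerSeries.C a :=
  MvPowerSeries.rename_C _ _

/-- If `ψ` does not involve the variable at `i`, the coefficients of the product of `ψ` with a
power series in that variable are products of coefficients. -/
theorem coeff_substVar_mul (i : ℕ) (φ : PowerSeries K) {ψ : MvPowerSeries ℕ K}
    (hψ : ∀ m : ℕ →₀ ℕ, m i ≠ 0 → MvPowerSeries.coeff m ψ = 0) (m : ℕ →₀ ℕ) :
    MvPowerSeries.coeff m (substVar K i φ * ψ) =
      PowerSeries.coeff (m i) φ * MvPowerSeries.coeff (m.erase i) ψ := by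
  rw [MvPowerSeries.coeff_mul, Finset.sum_eq_single (Finsupp.single i (m i), m.erase i)]
  · rw [coeff_substVar]
    simp
  · rintro ⟨a, b⟩ hab hne
    rw [Finset.HasAntidiagonal.mem_antidiagonal] at hab
    rw [coeff_substVar]
    dsimp only at hab ⊢
    by_cases ha : a = Finsupp.single i (a i)
    · by_cases hb : b i = 0
      · exfalso
        apply hne
        have h1 : m i = a i := by
          rw [← hab, Finsupp.add_apply, hb, add_zero]
        have h2 : a = Finsupp.single i (m i) := by rw [h1]; exact ha
        have h3 : b = m.erase i := by
          ext j
          by_cases hj : j = i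
          · subst hj
            simp [hb]
          · rw [Finsupp.erase_ne hj, ← hab, ha]
            simp [Ne.symm hj]
        rw [← h2, h3]
      · rw [hψ b hb, mul_zero]
    · rw [if_neg ha, zero_mul]
  · intro h
    exact absurd (Finset.HasAntidiagonal.mem_antidiagonal.2 (Finsupp.single_add_erase i m)) h

variable (ξ : ℕ → K) (e : ℕ)

/-- For a list `[k_r, l_r, …, k₁, l₁]`, the sum over `0 = n₀ < n₁ < ⋯ < n_r = n` of the products
of the weights `v k_i n_i` and `h l_i n_{i-1} n_i`. -/
def blockArrive (v : ℕ → ℕ → K) (h : ℕ → ℕ → ℕ → K) : List ℕ → ℕ → K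
  | k :: l :: L, n + 1 => v k (n + 1) *
      ∑ j ∈ Finset.range (n + 1), h l j (n + 1) * blockArrive v h L j
  | [], 0 => 1
  | _, _ => 0

/-- The chain sum `blockArrive` whose weights are the coefficients of `jumpSeries` at `z^(k_i - 1)`
and of `regionSeries` at `z^(l_i - 1)`. -/
noncomputable def coeffArrive (N : ℕ) : List ℕ → ℕ → K :=
  blockArrive (fun k n => PowerSeries.coeff (k - 1) (jumpSeries ξ e n))
    fun l j n => PowerSeries.coeff (l - 1) (regionSeries ξ e N j n)

/-- For `c = (l₁, k₁, …, l_r, k_r)`, the truncation to summation variables `< N` of the multiple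
sum that is to be expressed by the words of the recursion. -/
noncomputable def coeffSum (N : ℕ) (c : List ℕ) : K :=
  ∑ n ∈ Finset.range N, coeffArrive ξ e N c.reverse n

variable {R : Type*} [CommRing R]

theorem chain_eq_sum (f : ℕ → ℕ → R) (w : ℕ) (F : ℕ → R) (n : ℕ) :
    chain f w F n = ∑ j ∈ Finset.range (n + 1), (∏ i ∈ Finset.Ioo j (n + 1), f w i) * F j := by
  induction n with
  | zero =>
    have : Finset.Ioo 0 1 = ∅ := rfl
    simp [chain, this]
  | succ n ih =>
    rw [chain, ih, Finset.sum_range_succ _ (n + 1), Finset.mul_sum]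
    congr 1
    · refine Finset.sum_congr rfl fun j hj => ?_
      have hj := Finset.mem_range.1 hj
      have : Finset.Ioo j (n + 1 + 1) = insert (n + 1) (Finset.Ioo j (n + 1)) := by
        ext i
        simp only [Finset.mem_Ioo, Finset.mem_insert]
        omega
      rw [this, Finset.prod_insert (by simp)]
      ring
    · have : Finset.Ioo (n + 1) (n + 1 + 1) = ∅ := by
        ext i
        simp only [Finset.mem_Ioo, Finset.notMem_empty, iff_false]
        omega
      rw [this, Finset.prod_empty, one_mul]

theorem arrive_eq_sum (E : ℕ → PowerSeries K →+* R) (N u w n : ℕ) (L : List ℕ) :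
    arrive (stepWeight ξ e E N) (passWeight ξ e E N) (u :: w :: L) (n + 1) =
      E u (jumpSeries ξ e (n + 1)) * ∑ j ∈ Finset.range (n + 1),
        E w (regionSeries ξ e N j (n + 1)) *
          arrive (stepWeight ξ e E N) (passWeight ξ e E N) L j := by
  rw [arrive_cons_cons, chain_eq_sum, passWeight, mul_assoc, Finset.mul_sum]
  congr 1
  refine Finset.sum_congr rfl fun j _ => ?_
  rw [regionSeries, map_mul, map_prod, mul_assoc]
  rfl

variable {ξ e}

open scoped Classical in
/-- The coefficients of a chain sum are the sums of products of coefficients. -/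
theorem coeff_arrive (E : ℕ → PowerSeries K →+* MvPowerSeries ℕ K) (N : ℕ) : ∀ (L : List ℕ),
    L.Nodup → (∀ i ∈ L, E i = substVar K i) → ∀ (n : ℕ) (m : ℕ →₀ ℕ),
    MvPowerSeries.coeff m (arrive (stepWeight ξ e E N) (passWeight ξ e E N) L n) =
      if ∀ i, m i ≠ 0 → i ∈ L then coeffArrive ξ e N (L.map fun i => m i + 1) n else 0
  | [], _, _, n, m => by
    have h : (∀ i, m i ≠ 0 → i ∈ ([] : List ℕ)) ↔ m = 0 := by
      simp [Finsupp.ext_iff]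
    cases n with
    | zero =>
      rw [arrive_nil_zero, MvPowerSeries.coeff_one]
      simp only [h, List.map_nil, coeffArrive, blockArrive]
    | succ n => simp [coeffArrive, blockArrive]
  | [u], _, _, n, m => by
    cases n <;> simp [coeffArrive, blockArrive, arrive]
  | u :: w :: L, hL, hE, 0, m => by
    simp [coeffArrive, blockArrive]
  | u :: w :: L, hL, hE, n + 1, m => by
    have hL1 := List.nodup_cons.1 hL
    have hL2 := List.nodup_cons.1 hL1.2
    have hu : u ∉ L := fun h => hL1.1 (by simp [h])
    have hne : u ≠ w := fun h => hL1.1 (by simp [h])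
    have ih := coeff_arrive E N L hL2.2 fun i hi => hE i (by simp [hi])
    have hw : ∀ (j : ℕ) (m : ℕ →₀ ℕ), MvPowerSeries.coeff m (substVar K w
        (regionSeries ξ e N j (n + 1)) *
          arrive (stepWeight ξ e E N) (passWeight ξ e E N) L j) =
        PowerSeries.coeff (m w) (regionSeries ξ e N j (n + 1)) *
          MvPowerSeries.coeff (m.erase w)
            (arrive (stepWeight ξ e E N) (passWeight ξ e E N) L j) := by
      intro j m
      apply coeff_substVar_mul
      intro m hm
      rw [ih, if_neg]
      intro h
      exact hL2.1 (h w hm)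
    rw [arrive_eq_sum, hE u (by simp), hE w (by simp), coeff_substVar_mul, map_sum]
    · have h1 : (∀ i, ((m.erase u).erase w) i ≠ 0 → i ∈ L) ↔ ∀ i, m i ≠ 0 → i ∈ u :: w :: L := by
        constructor
        · intro h i hi
          by_cases hiu : i = u
          · simp [hiu]
          by_cases hiw : i = w
          · simp [hiw]
          have := h i (by rwa [Finsupp.erase_ne hiw, Finsupp.erase_ne hiu])
          simp [this]
        · intro h i hi
          by_cases hiw : i = w
          · subst hiw
            simp at hi
          rw [Finsupp.erase_ne hiw] at hi
          by_cases hiu : i = u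
          · subst hiu
            simp at hi
          rw [Finsupp.erase_ne hiu] at hi
          simpa [hiw, hiu] using h i hi
      have h2 : (L.map fun i => ((m.erase u).erase w) i + 1) = L.map fun i => m i + 1 := by
        apply List.map_congr_left
        intro i hi
        have hiw : i ≠ w := by rintro rfl; exact hL2.1 hi
        have hiu : i ≠ u := by rintro rfl; exact hu hi
        rw [Finsupp.erase_ne hiw, Finsupp.erase_ne hiu]
      simp only [hw, ih, h1, h2, Finsupp.erase_ne (Ne.symm hne)]
      split_ifs
      · rw [List.map_cons, List.map_cons]
        rfl
      · simp
    · intro m hm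
      rw [map_sum]
      refine Finset.sum_eq_zero fun j _ => ?_
      rw [hw, ih, if_neg, mul_zero]
      intro h
      refine hu (h u ?_)
      rwa [Finsupp.erase_ne hne]

open scoped Classical in
theorem coeff_generating (E : ℕ → PowerSeries K →+* MvPowerSeries ℕ K) (N : ℕ) {L : List ℕ}
    (hL : L.Nodup) (hE : ∀ i ∈ L, E i = substVar K i) (m : ℕ →₀ ℕ) :
    MvPowerSeries.coeff m (generating ξ e E N L) =
      if ∀ i, m i ≠ 0 → i ∈ L then coeffSum ξ e N (L.map fun i => m i + 1).reverse else 0 := by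
  rw [generating, map_sum]
  simp only [coeff_arrive E N L hL hE, coeffSum, List.reverse_reverse]
  split_ifs
  · rfl
  · simp

/-- The indicator function of a finite set of positions. -/
noncomputable def indicatorOne (B : Finset ℕ) : ℕ →₀ ℕ :=
  Finsupp.onFinset B (fun i => if i ∈ B then 1 else 0) fun i hi => by
    by_contra h
    exact hi (if_neg h)

theorem indicatorOne_apply (B : Finset ℕ) (i : ℕ) :
    indicatorOne B i = if i ∈ B then 1 else 0 := rfl

theorem prod_X_eq_monomial (B : Finset ℕ) :
    ∏ j ∈ B, (MvPowerSeries.X j : MvPowerSeries ℕ K) =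
      MvPowerSeries.monomial (indicatorOne B) 1 := by
  induction B using Finset.induction_on with
  | empty =>
    rw [Finset.prod_empty]
    have : indicatorOne ∅ = 0 := by
      ext i
      simp [indicatorOne_apply]
    rw [this]
    rfl
  | insert a B ha ih =>
    rw [Finset.prod_insert ha, ih, MvPowerSeries.X, MvPowerSeries.monomial_mul_monomial, one_mul]
    congr 2
    ext i
    rw [Finsupp.add_apply, indicatorOne_apply, indicatorOne_apply, Finsupp.single_apply]
    by_cases h : a = i
    · subst h
      simp [ha]
    · simp [h, Ne.symm h]

theorem coeff_prod_X_mul (B : Finset ℕ) (φ : MvPowerSeries ℕ K) (m : ℕ →₀ ℕ) :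
    MvPowerSeries.coeff m ((∏ j ∈ B, MvPowerSeries.X j) * φ) =
      if B ⊆ m.support then MvPowerSeries.coeff (m - indicatorOne B) φ else 0 := by
  rw [prod_X_eq_monomial, MvPowerSeries.coeff_monomial_mul]
  have h : indicatorOne B ≤ m ↔ B ⊆ m.support := by
    constructor
    · intro h i hi
      have := h i
      rw [indicatorOne_apply, if_pos hi] at this
      rw [Finsupp.mem_support_iff]
      omega
    · intro h i
      rw [indicatorOne_apply]
      split_ifs with hi
      · have := Finsupp.mem_support_iff.1 (h hi)
        omega
      · omega
  simp only [h, one_mul]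

/-- The exponent `c - 1`, at the positions `1, …, n`. -/
noncomputable def exponent (c : List ℕ) : ℕ →₀ ℕ :=
  Finsupp.onFinset (posGt c) (fun i => if i ∈ posGt c then c.getD (i - 1) 0 - 1 else 0)
    fun i hi => by
      by_contra h
      exact hi (if_neg h)

theorem mem_posGt {c : List ℕ} {i : ℕ} :
    i ∈ posGt c ↔ (1 ≤ i ∧ i ≤ c.length) ∧ 1 < c.getD (i - 1) 0 := by
  rw [posGt, Finset.mem_filter, Finset.mem_Icc]

theorem mem_posOne {c : List ℕ} {i : ℕ} :
    i ∈ posOne c ↔ (1 ≤ i ∧ i ≤ c.length) ∧ c.getD (i - 1) 0 = 1 := by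
  rw [posOne, Finset.mem_filter, Finset.mem_Icc]

theorem exponent_support (c : List ℕ) : (exponent c).support = posGt c := by
  ext i
  rw [Finsupp.mem_support_iff, exponent, Finsupp.onFinset_apply]
  by_cases h : i ∈ posGt c
  · have := (mem_posGt.1 h).2
    simp only [h, if_true, iff_true]
    omega
  · simp [h]

theorem one_le_getD {c : List ℕ} (hc : ∀ a ∈ c, 1 ≤ a) {i : ℕ} (hi : i < c.length) :
    1 ≤ c.getD i 0 := by
  rw [List.getD_eq_getElem _ _ hi]
  exact hc _ (List.getElem_mem hi)

/-- The exponents of a monomial with the variables in `B` divided out, at the uncovered positions,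
are the entries of `c_{A,B}` less `1`. -/
theorem map_uncovered {c : List ℕ} (hc : ∀ a ∈ c, 1 ≤ a) (A : Finset ℕ) {B : Finset ℕ}
    (hB : B ⊆ posGt c) : ((uncovered c.length A).map fun i =>
      (exponent c - indicatorOne B) i + 1).reverse = modify c A B := by
  rw [uncovered, ← List.map_reverse, List.reverse_reverse, modify, List.range'_eq_map_range,
    List.filter_map, List.map_map]
  have h1 : (List.range c.length).filter ((fun i => decide (i ∉ A)) ∘ fun x => 1 + x) =
      (List.range c.length).filter fun i => decide (i + 1 ∉ A) := by
    apply List.filter_congr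
    intro i _
    simp [add_comm]
  rw [h1]
  apply List.map_congr_left
  intro i hi
  have hi := List.mem_range.1 (List.mem_filter.1 hi).1
  have h2 := one_le_getD hc hi
  simp only [Function.comp_apply, Finsupp.tsub_apply, indicatorOne_apply, exponent,
    Finsupp.onFinset_apply, add_comm 1 i]
  by_cases hB' : i + 1 ∈ B
  · have h3 := hB hB'
    have h4 := (mem_posGt.1 h3).2
    simp only [Nat.add_sub_cancel] at h4 ⊢
    simp only [hB', h3, if_true]
    omega
  · by_cases h3 : i + 1 ∈ posGt c
    · simp only [hB', h3, if_true, if_false, Nat.add_sub_cancel]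
      omega
    · have h4 : ¬ 1 < c.getD i 0 := fun h => h3 (mem_posGt.2 ⟨by omega, by simpa using h⟩)
      simp only [hB', h3, if_false]
      omega

variable (K) in
/-- The substitutions of the variables at the positions `1, …, 2r`, and of `0` at the other
positions. -/
noncomputable def substVars (r i : ℕ) : PowerSeries K →+* MvPowerSeries ℕ K :=
  if i ∈ Finset.Icc 1 (2 * r) then substVar K i
  else (MvPowerSeries.C).comp PowerSeries.constantCoeff

theorem substVars_of_mem {r i : ℕ} (hi : i ∈ Finset.Icc 1 (2 * r)) :
    substVars K r i = substVar K i := if_pos hi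

theorem substVars_of_notMem {r i : ℕ} (hi : i ∉ Finset.Icc 1 (2 * r)) (φ : PowerSeries K) :
    substVars K r i φ = MvPowerSeries.C (PowerSeries.constantCoeff φ) := by
  rw [substVars, if_neg hi]
  rfl

theorem substVars_C (r i : ℕ) (a : K) :
    substVars K r i (PowerSeries.C a) = MvPowerSeries.C a := by
  by_cases hi : i ∈ Finset.Icc 1 (2 * r)
  · rw [substVars_of_mem hi, substVar_C]
  · rw [substVars_of_notMem hi]
    simp

/-- Multiplication by the monomials of the sum amounts to subtracting `1` from the exponents at the
positions in `B`, which is possible for `B` inside the support only. -/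
theorem coeff_sum_mul {r : ℕ} (a : K) (cnt : Finset ℕ → ℕ) {U : Finset ℕ}
    (hU : U ⊆ Finset.Icc 1 (2 * r)) (φ : MvPowerSeries ℕ K) (m : ℕ →₀ ℕ) :
    MvPowerSeries.coeff m ((∑ B ∈ U.powerset, (-1) ^ B.card *
      (MvPowerSeries.C a : MvPowerSeries ℕ K) ^ cnt B *
        ∏ j ∈ B, substVars K r j PowerSeries.X) * φ) =
      ∑ B ∈ (U ∩ m.support).powerset, (-1) ^ B.card * a ^ cnt B *
        MvPowerSeries.coeff (m - indicatorOne B) φ := by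
  rw [Finset.sum_mul, map_sum]
  have h : ∀ B ∈ U.powerset, MvPowerSeries.coeff m ((-1) ^ B.card *
      (MvPowerSeries.C a : MvPowerSeries ℕ K) ^ cnt B *
        (∏ j ∈ B, substVars K r j PowerSeries.X) * φ) = if B ⊆ m.support then
        (-1) ^ B.card * a ^ cnt B * MvPowerSeries.coeff (m - indicatorOne B) φ else 0 := by
    intro B hB
    have hB := Finset.mem_powerset.1 hB
    have h1 : ∏ j ∈ B, substVars K r j PowerSeries.X =
        ∏ j ∈ B, (MvPowerSeries.X j : MvPowerSeries ℕ K) := by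
      refine Finset.prod_congr rfl fun j hj => ?_
      rw [substVars_of_mem (hU (hB hj)), substVar_X]
    have h2 : (-1) ^ B.card * (MvPowerSeries.C a : MvPowerSeries ℕ K) ^ cnt B =
        MvPowerSeries.C ((-1) ^ B.card * a ^ cnt B) := by
      simp
    rw [h1, h2, mul_assoc, MvPowerSeries.coeff_C_mul, coeff_prod_X_mul]
    split_ifs <;> simp
  rw [Finset.sum_congr rfl h, ← Finset.sum_filter]
  refine Finset.sum_congr ?_ fun _ _ => rfl
  ext B
  simp only [Finset.mem_filter, Finset.mem_powerset, Finset.subset_inter_iff]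

/-- The recursion in `N` for the truncated multiple sums. -/
theorem coeffSum_succ (he : e = 0 ∨ e = 1) {N r : ℕ} (hN : 1 ≤ N) (hr : 1 ≤ r)
    (hξ : ∀ n, 1 ≤ n → n < N → ξ N * (ξ n + ξ (N - n) - 1) = ξ n * ξ (N - n))
    {c : List ℕ} (hlen : c.length = 2 * r) (hc : ∀ a ∈ c, 1 ≤ a) :
    ∑ B ∈ (posGt c).powerset,
        (-1) ^ B.card * ξ N ^ alpha r B * coeffSum ξ e (N + 1) (modify c ∅ B) =
      ∑ A ∈ (Tilings r).filter (fun A => A ⊆ posOne c), ∑ B ∈ (posGt c).powerset,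
        tilingWeight ((ξ N - 1) * ξ N ^ e) A *
          ((-1) ^ B.card * ξ N ^ betaA r A B * coeffSum ξ e N (modify c A B)) := by
  have h0 : substVars K r 0 PowerSeries.X = 0 := by
    rw [substVars_of_notMem (by simp)]
    simp
  have hlast : ∀ φ, substVars K r (2 * r + 1) φ =
      MvPowerSeries.C (PowerSeries.constantCoeff φ) :=
    fun φ => substVars_of_notMem (by simp) φ
  have hpos : posGt c ⊆ Finset.Icc 1 (2 * r) := by
    rw [← hlen]
    exact Finset.filter_subset _ _
  have hmain := congrArg (MvPowerSeries.coeff (exponent c))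
    (generating_succ (ξ := ξ) (κ := MvPowerSeries.C) (substVars_C (K := K) r) he h0 hN hr hlast hξ)
  have hsub : ∀ A i, i ∈ uncovered (2 * r) A → substVars K r i = substVar K i := by
    intro A i hi
    exact substVars_of_mem (Finset.mem_sdiff.1 (mem_uncovered.1 hi)).1
  rw [shiftedPairProd_eq_sum ξ _ _ N r h0 (by rw [hlast]; simp),
    coeff_sum_mul _ _ subset_rfl, exponent_support, Finset.inter_eq_right.2 hpos] at hmain
  rw [map_sum] at hmain
  have hl : ∀ B ∈ (posGt c).powerset, MvPowerSeries.coeff (exponent c - indicatorOne B)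
      (generating ξ e (substVars K r) (N + 1) (uncovered (2 * r) ∅)) =
      coeffSum ξ e (N + 1) (modify c ∅ B) := by
    intro B hB
    have hB := Finset.mem_powerset.1 hB
    rw [coeff_generating _ _ (nodup_uncovered _ _) (hsub _), if_pos, ← hlen, map_uncovered hc _ hB]
    intro i hi
    rw [mem_uncovered, Finset.sdiff_empty]
    apply hpos
    rw [← exponent_support, Finsupp.mem_support_iff]
    rw [Finsupp.tsub_apply] at hi
    omega
  rw [Finset.sum_congr rfl fun B hB => by rw [← hl B hB], hmain, Finset.sum_filter]
  refine Finset.sum_congr rfl fun A hA => ?_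
  have hw : tilingWeight (MvPowerSeries.C ((ξ N - 1) * ξ N ^ e) : MvPowerSeries ℕ K) A =
      MvPowerSeries.C (tilingWeight ((ξ N - 1) * ξ N ^ e) A) := by
    simp [tilingWeight]
  have hU : (uncovered (2 * r) A).toFinset = Finset.Icc 1 (2 * r) \ A := by
    ext i
    rw [List.mem_toFinset, mem_uncovered]
  rw [hw, MvPowerSeries.coeff_C_mul, pairProd_eq_sum _ _ _ _ _ (nodup_uncovered _ _)
    (even_length_uncovered hA), hU, coeff_sum_mul _ _ Finset.sdiff_subset, exponent_support]
  split_ifs with hAone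
  · have hI : (Finset.Icc 1 (2 * r) \ A) ∩ posGt c = posGt c := by
      rw [Finset.inter_eq_right]
      intro i hi
      refine Finset.mem_sdiff.2 ⟨hpos hi, fun hi' => ?_⟩
      have h1 := (mem_posOne.1 (hAone hi')).2
      have h2 := (mem_posGt.1 hi).2
      omega
    rw [hI, Finset.mul_sum]
    refine Finset.sum_congr rfl fun B hB => ?_
    have hB := Finset.mem_powerset.1 hB
    have hBA : B ⊆ Finset.Icc 1 (2 * r) \ A := by
      exact hB.trans (Finset.inter_eq_right.1 hI)
    rw [coeff_generating _ _ (nodup_uncovered _ _) (hsub _), if_pos,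
      blockCount_uncovered hA hBA, ← hlen, map_uncovered hc _ hB]
    intro i hi
    rw [mem_uncovered]
    have : i ∈ posGt c := by
      rw [← exponent_support, Finsupp.mem_support_iff]
      rw [Finsupp.tsub_apply] at hi
      omega
    rw [← hI] at this
    exact Finset.mem_of_mem_inter_left this
  · rw [Finset.sum_eq_zero, mul_zero]
    intro B hB
    have hB := (Finset.mem_powerset.1 hB).trans Finset.inter_subset_left
    obtain ⟨i, hi, hi'⟩ := Finset.not_subset.1 hAone
    rw [coeff_generating _ _ (nodup_uncovered _ _) (hsub _), if_neg, mul_zero]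
    intro h
    have hiI := Finset.mem_Icc.1 (subset_of_mem_Tilings hA hi)
    have hiG : i ∈ posGt c := by
      have h1 := one_le_getD hc (i := i - 1) (by omega)
      have h2 : c.getD (i - 1) 0 ≠ 1 := fun h => hi' (mem_posOne.2 ⟨by omega, h⟩)
      exact mem_posGt.2 ⟨by omega, by omega⟩
    have hiB : i ∉ B := fun h => (Finset.mem_sdiff.1 (hB h)).2 hi
    have := h i (by
      rw [Finsupp.tsub_apply, indicatorOne_apply, if_neg hiB, Nat.sub_zero,
        ← Finsupp.mem_support_iff, exponent_support]
      exact hiG)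
    exact (Finset.mem_sdiff.1 (mem_uncovered.1 this)).2 hi

end Coefficients

/-! ### Words as operators on sequences -/

section Words

variable {K : Type*} [CommRing K] (ξ : ℕ → K)

/-- The operator `a ↦ (n ↦ ξ_n a_n)` by which `x` acts. -/
def opX : (ℕ → K) →ₗ[ℤ] (ℕ → K) where
  toFun a n := ξ n * a n
  map_add' a b := by
    ext n
    simp [mul_add]
  map_smul' k a := by
    ext n
    simp [mul_left_comm]

/-- The operator `a ↦ (n ↦ (ξ_n - 1) ∑_{m < n} a_m)` by which `y` acts. -/
def opY : (ℕ → K) →ₗ[ℤ] (ℕ → K) where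
  toFun a n := (ξ n - 1) * ∑ j ∈ Finset.range n, a j
  map_add' a b := by
    ext n
    simp [mul_add, Finset.sum_add_distrib]
  map_smul' k a := by
    ext n
    simp [Finset.mul_sum, mul_left_comm]

/-- The right action of `𝔥` on sequences. -/
noncomputable def wordAct : H →ₐ[ℤ] (Module.End ℤ (ℕ → K))ᵐᵒᵖ :=
  FreeAlgebra.lift ℤ fun
    | Letter.x => MulOpposite.op (opX ξ)
    | Letter.y => MulOpposite.op (opY ξ)

/-- The sequence that arises by the right action of a word from the unit sequence at `0`. -/
noncomputable def wordSeq : H →ₗ[ℤ] (ℕ → K) :=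
  LinearMap.applyₗ (R := ℤ) (Pi.single 0 1 : ℕ → K) ∘ₗ
    (MulOpposite.opLinearEquiv ℤ).symm.toLinearMap ∘ₗ (wordAct ξ).toLinearMap

theorem wordSeq_apply (w : H) : wordSeq ξ w = (wordAct ξ w).unop (Pi.single 0 1) := rfl

theorem wordSeq_one : wordSeq ξ 1 = Pi.single 0 1 := by
  rw [wordSeq_apply, map_one]
  rfl

theorem wordSeq_mul_X (w : H) (n : ℕ) : wordSeq ξ (w * X) n = ξ n * wordSeq ξ w n := by
  rw [wordSeq_apply, map_mul, X, wordAct, FreeAlgebra.lift_ι_apply]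
  rfl

theorem wordSeq_mul_X_pow (w : H) (k n : ℕ) :
    wordSeq ξ (w * X ^ k) n = ξ n ^ k * wordSeq ξ w n := by
  induction k with
  | zero => simp
  | succ k ih =>
    rw [pow_succ, ← mul_assoc, wordSeq_mul_X, ih]
    ring

/-- The sum of the first `N` terms of the sequence of a word. -/
noncomputable def wordSum (w : H) (N : ℕ) : K := ∑ n ∈ Finset.range N, wordSeq ξ w n

theorem wordSeq_mul_Y (w : H) (n : ℕ) :
    wordSeq ξ (w * Y) n = (ξ n - 1) * wordSum ξ w n := by
  rw [wordSeq_apply, map_mul, Y, wordAct, FreeAlgebra.lift_ι_apply]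
  rfl

theorem wordSum_succ (w : H) (N : ℕ) : wordSum ξ w (N + 1) = wordSum ξ w N + wordSeq ξ w N :=
  Finset.sum_range_succ _ _

theorem wordSum_one (N : ℕ) : wordSum ξ 1 (N + 1) = 1 := by
  rw [wordSum, wordSeq_one, Finset.sum_range_succ', Finset.sum_eq_zero]
  · simp
  · intro i _
    simp

/-- The geometric sum over the words `y x^(h-1)` telescopes. -/
theorem telescope_Ioc (t : K) {a b : ℕ} (h : a ≤ b) :
    ∑ i ∈ Finset.Ioc a b, (t - 1) * t ^ (i - 1) = t ^ b - t ^ a := by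
  induction b, h using Nat.le_induction with
  | base => simp
  | succ b hb ih =>
    rw [← Finset.insert_Ioc_right_eq_Ioc_add_one hb, Finset.sum_insert (by simp), ih,
      Nat.add_sub_cancel]
    ring

theorem telescope_signed (t : K) (a b : ℕ) :
    ∑ i ∈ Finset.Ioc a b, (t - 1) * t ^ (i - 1) - ∑ i ∈ Finset.Ioc b a, (t - 1) * t ^ (i - 1) =
      t ^ b - t ^ a := by
  rcases le_total a b with h | h
  · rw [telescope_Ioc t h, Finset.Ioc_eq_empty (by omega)]
    simp
  · rw [telescope_Ioc t h, Finset.Ioc_eq_empty (by omega)]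
    simp

theorem binomial_signed (t : K) (k : ℕ) :
    ∑ h ∈ Finset.Icc 1 (k + 1), (-1) ^ (k + 1 - h) * (k.choose (h - 1) : K) * t ^ (h - 1) =
      (t - 1) ^ k := by
  rw [sub_eq_add_neg, add_pow]
  refine Finset.sum_nbij' (fun h => h - 1) (fun i => i + 1) ?_ ?_ ?_ ?_ ?_
  · intro h hh
    have := Finset.mem_Icc.1 hh
    rw [Finset.mem_range]
    omega
  · intro i hi
    have := Finset.mem_range.1 hi
    rw [Finset.mem_Icc]
    omega
  · intro h hh
    have := Finset.mem_Icc.1 hh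
    omega
  · intro i _
    omega
  · intro h hh
    have := Finset.mem_Icc.1 hh
    rw [show k + 1 - h = k - (h - 1) by omega]
    ring

variable (e : ℕ)

theorem modify_length_even {c : List ℕ} {r : ℕ} (hlen : c.length = 2 * r) (hc : ∀ a ∈ c, 1 ≤ a)
    {A B : Finset ℕ} (hA : A ∈ Tilings r) (hB : B ⊆ posGt c) :
    ∃ s, (modify c A B).length = 2 * s := by
  rw [← map_uncovered hc A hB, List.length_reverse, List.length_map, hlen]
  obtain ⟨s, hs⟩ := even_length_uncovered hA
  exact ⟨s, by rw [hs]; ring⟩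

theorem one_le_of_mem_modify {c : List ℕ} (hc : ∀ a ∈ c, 1 ≤ a) (A : Finset ℕ) {B : Finset ℕ}
    (hB : B ⊆ posGt c) : ∀ a ∈ modify c A B, 1 ≤ a := by
  intro a ha
  rw [← map_uncovered hc A hB, List.mem_reverse, List.mem_map] at ha
  obtain ⟨i, -, rfl⟩ := ha
  omega

theorem modify_empty (c : List ℕ) : modify c ∅ ∅ = c := by
  rw [modify]
  apply List.ext_getElem
  · simp
  · intro i h1 h2
    simp [List.getElem?_eq_getElem h2]

theorem length_modify_empty (c : List ℕ) (B : Finset ℕ) : (modify c ∅ B).length = c.length := by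
  simp [modify]

theorem empty_mem_Tilings (r : ℕ) : ∅ ∈ Tilings r :=
  mem_Tilings.2 ⟨∅, ∅, by simp, by simp, by simp, by simp, by simp⟩

theorem alpha_pos {r : ℕ} {B : Finset ℕ} (hB : B ⊆ Finset.Icc 1 (2 * r)) (h : B.Nonempty) :
    1 ≤ alpha r B := by
  obtain ⟨i, hi⟩ := h
  have := Finset.mem_Icc.1 (hB hi)
  refine Finset.card_pos.2 ⟨i / 2, Finset.mem_filter.2 ⟨Finset.mem_Icc.2 (by omega), i, ?_⟩⟩
  simp only [Finset.mem_inter, Finset.mem_insert, Finset.mem_singleton]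
  exact ⟨hi, by omega⟩

theorem beta_pos {r : ℕ} {B : Finset ℕ} (hB : B ⊆ Finset.Icc 1 (2 * r)) (h : B.Nonempty) :
    1 ≤ beta r B := by
  obtain ⟨i, hi⟩ := h
  have := Finset.mem_Icc.1 (hB hi)
  refine Finset.card_pos.2 ⟨(i + 1) / 2, Finset.mem_filter.2 ⟨Finset.mem_Icc.2 (by omega), i, ?_⟩⟩
  simp only [Finset.mem_inter, Finset.mem_insert, Finset.mem_singleton]
  exact ⟨hi, by omega⟩

theorem alpha_empty (r : ℕ) : alpha r ∅ = 0 := by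
  simp [alpha]

theorem betaA_empty {r : ℕ} (B : Finset ℕ) : betaA r ∅ B = beta r B := by
  have : sigma ∅ = id := by
    ext i
    simp [sigma]
  rw [betaA, this, Finset.image_id]

theorem kappa_pos {r : ℕ} {A : Finset ℕ} (hA : A ∈ Tilings r) (h : A.Nonempty) :
    1 ≤ kappa A := by
  obtain ⟨k, hk⟩ := (even_card_of_mem_Tilings r).1 A hA
  have := Finset.card_pos.2 h
  rw [kappa]
  omega

/-- The recursion for the words, in terms of their sequences. -/
theorem wordSeq_EE {c : List ℕ} {r : ℕ} (hlen : c.length = 2 * r) (hc : c ≠ []) (N : ℕ) :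
    wordSeq ξ (EE e c) N =
      - ∑ B ∈ (posGt c).powerset.filter (fun B => B.Nonempty),
          (-1) ^ B.card * (ξ N ^ alpha r B * wordSeq ξ (EE e (modify c ∅ B)) N)
      + ∑ B ∈ (posGt c).powerset.filter (fun B => B.Nonempty),
          (-1) ^ B.card * ((ξ N ^ beta r B - ξ N ^ alpha r B) *
            wordSum ξ (EE e (modify c ∅ B)) N)
      + ∑ A ∈ (Tilings r).filter (fun A => A.Nonempty ∧ A ⊆ posOne c),
          ∑ B ∈ (posGt c).powerset, tilingWeight ((ξ N - 1) * ξ N ^ e) A *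
            ((-1) ^ B.card * ξ N ^ betaA r A B * wordSum ξ (EE e (modify c A B)) N) := by
  have hr : c.length / 2 = r := by omega
  have hzsmul : ∀ (k : ℤ) (w : H), wordSeq ξ (k • w) N = (k : K) * wordSeq ξ w N := by
    intro k w
    rw [map_zsmul, Pi.smul_apply, zsmul_eq_mul]
  rw [EE_eq e hc, hr]
  simp only [map_add, map_neg, map_sum, Pi.add_apply, Pi.neg_apply, Finset.sum_apply, hzsmul]
  refine congrArg₂ (· + ·) (congrArg₂ (· + ·) (congrArg Neg.neg ?_) ?_) ?_
  · refine Finset.sum_congr rfl fun B _ => ?_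
    rw [wordSeq_mul_X_pow]
    simp
  · refine Finset.sum_congr rfl fun B _ => ?_
    rw [← telescope_signed]
    simp only [mul_sub, Finset.mul_sum, map_sub, map_sum, Pi.sub_apply, Finset.sum_apply, sub_mul,
      Finset.sum_mul, ← mul_assoc, wordSeq_mul_X_pow, wordSeq_mul_Y]
    push_cast
    congr 1 <;> refine Finset.sum_congr rfl fun h _ => ?_ <;> ring
  · refine Finset.sum_congr rfl fun A hA => Finset.sum_congr rfl fun B _ => ?_
    have hA := Finset.mem_filter.1 hA
    obtain ⟨k, hk⟩ := Nat.exists_eq_add_of_le' (kappa_pos hA.1 hA.2.1)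
    rw [tilingWeight, hk, mul_pow, pow_succ (ξ N - 1), ← binomial_signed, Finset.sum_mul,
      Finset.sum_mul, Finset.mul_sum, Finset.sum_mul]
    refine Finset.sum_congr rfl fun h hh => ?_
    have hh := Finset.mem_Icc.1 hh
    rw [wordSeq_mul_X_pow, wordSeq_mul_Y,
      show h + e * (k + 1) + betaA r A B - 1 = (h - 1) + e * (k + 1) + betaA r A B by omega]
    push_cast
    ring

/-- The recursion for the words in terms of their partial sums: adding the partial sums up to `N` to
the terms with `α` of `wordSeq_EE` turns these into partial sums up to `N + 1`. -/
theorem wordSum_EE_succ {c : List ℕ} {r : ℕ} (hlen : c.length = 2 * r) (hc : c ≠ []) (N : ℕ) :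
    ∑ B ∈ (posGt c).powerset,
        (-1) ^ B.card * ξ N ^ alpha r B * wordSum ξ (EE e (modify c ∅ B)) (N + 1) =
      ∑ A ∈ (Tilings r).filter (fun A => A ⊆ posOne c), ∑ B ∈ (posGt c).powerset,
        tilingWeight ((ξ N - 1) * ξ N ^ e) A *
          ((-1) ^ B.card * ξ N ^ betaA r A B * wordSum ξ (EE e (modify c A B)) N) := by
  have hB : ∀ F : Finset ℕ → K, ∑ B ∈ (posGt c).powerset, F B =
      F ∅ + ∑ B ∈ (posGt c).powerset.filter (fun B => B.Nonempty), F B := by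
    intro F
    have : (posGt c).powerset.filter (fun B => B.Nonempty) = (posGt c).powerset.erase ∅ := by
      ext B
      simp [Finset.nonempty_iff_ne_empty, and_comm]
    rw [this, Finset.add_sum_erase _ _ (Finset.empty_mem_powerset _)]
  have hA : ∀ F : Finset ℕ → K, ∑ A ∈ (Tilings r).filter (fun A => A ⊆ posOne c), F A =
      F ∅ + ∑ A ∈ (Tilings r).filter (fun A => A.Nonempty ∧ A ⊆ posOne c), F A := by
    intro F
    have : (Tilings r).filter (fun A => A.Nonempty ∧ A ⊆ posOne c) =
        ((Tilings r).filter (fun A => A ⊆ posOne c)).erase ∅ := by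
      ext B
      simp only [Finset.mem_filter, Finset.mem_erase, Finset.nonempty_iff_ne_empty]
      tauto
    rw [this, Finset.add_sum_erase _ _ (Finset.mem_filter.2 ⟨empty_mem_Tilings r, by simp⟩)]
  have hmain := wordSeq_EE ξ e hlen hc N
  rw [hA, tilingWeight_empty, hB, hB]
  simp only [alpha_empty, modify_empty, wordSum_succ, betaA_empty, one_mul, Finset.card_empty,
    pow_zero]
  have hbe : beta r ∅ = 0 := by simp [beta]
  rw [hbe, hmain, pow_zero, one_mul]
  have h1 : ∀ F G F' : Finset ℕ → K, (∀ B, F B = G B + F' B) →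
      ∑ B ∈ (posGt c).powerset.filter (fun B => B.Nonempty), F B =
      ∑ B ∈ (posGt c).powerset.filter (fun B => B.Nonempty), G B +
      ∑ B ∈ (posGt c).powerset.filter (fun B => B.Nonempty), F' B := by
    intro F G F' h
    rw [← Finset.sum_add_distrib]
    exact Finset.sum_congr rfl fun B _ => h B
  rw [h1 (fun B => (-1) ^ B.card * ξ N ^ alpha r B *
      (wordSum ξ (EE e (modify c ∅ B)) N + wordSeq ξ (EE e (modify c ∅ B)) N))
      (fun B => (-1) ^ B.card * ξ N ^ alpha r B * wordSum ξ (EE e (modify c ∅ B)) N)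
      (fun B => (-1) ^ B.card * (ξ N ^ alpha r B * wordSeq ξ (EE e (modify c ∅ B)) N))
      (fun B => by ring),
    h1 (fun B => (-1) ^ B.card * ξ N ^ beta r B * wordSum ξ (EE e (modify c ∅ B)) N)
      (fun B => (-1) ^ B.card * ξ N ^ alpha r B * wordSum ξ (EE e (modify c ∅ B)) N)
      (fun B => (-1) ^ B.card * ((ξ N ^ beta r B - ξ N ^ alpha r B) *
            wordSum ξ (EE e (modify c ∅ B)) N)) (fun B => by ring)]
  ring

theorem posGt_subset {c : List ℕ} {r : ℕ} (hlen : c.length = 2 * r) :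
    posGt c ⊆ Finset.Icc 1 (2 * r) := by
  rw [← hlen]
  exact Finset.filter_subset _ _

variable {ξ e}

/-- The partial sums of the sequence of the word `𝔈_q^ε(c)` are the truncated multiple sums of
`c`, because both satisfy the same recursion. -/
theorem wordSum_EE (he : e = 0 ∨ e = 1) (h0 : ξ 0 = 0)
    (hξ : ∀ N n, 1 ≤ n → n < N → ξ N * (ξ n + ξ (N - n) - 1) = ξ n * ξ (N - n)) (N : ℕ) :
    ∀ (c : List ℕ) (r : ℕ), c.length = 2 * r → (∀ a ∈ c, 1 ≤ a) →
      wordSum ξ (EE e c) N = coeffSum ξ e N c := by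
  induction N with
  | zero =>
    intro c r _ _
    simp [wordSum, coeffSum]
  | succ N ihN =>
    intro c
    induction hs : c.sum using Nat.strong_induction_on generalizing c with
    | _ s ihs =>
    subst hs
    intro r hlen hc
    by_cases hnil : c = []
    · subst hnil
      rw [EE_nil, wordSum_one, coeffSum, Finset.sum_range_succ']
      simp [coeffArrive, blockArrive]
    -- For `N = 0` both sides are values at `n = 0`, which vanish because of `ξ_0 = 0`.
    rcases Nat.eq_zero_or_pos N with rfl | hN
    · rw [wordSum, coeffSum, zero_add, Finset.sum_range_one, Finset.sum_range_one,
        wordSeq_EE ξ e hlen hnil, h0]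
      have h1 : coeffArrive ξ e 1 c.reverse 0 = 0 := by
        have : c.reverse ≠ [] := by simpa using hnil
        rcases hL : c.reverse with _ | ⟨k, _ | ⟨l, L⟩⟩
        · exact absurd hL this
        · rw [coeffArrive, blockArrive] <;> simp
        · rw [coeffArrive, blockArrive] <;> simp
      rw [h1, Finset.sum_eq_zero, Finset.sum_eq_zero, Finset.sum_eq_zero]
      · simp
      · intro A _
        simp [wordSum]
      · intro B _
        simp [wordSum]
      · intro B hB
        have hB := Finset.mem_filter.1 hB
        have := alpha_pos ((Finset.mem_powerset.1 hB.1).trans (posGt_subset hlen)) hB.2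
        rw [zero_pow (by omega)]
        simp
    · have hr : 1 ≤ r := by
        have := List.length_pos_of_ne_nil hnil
        omega
      have hA := wordSum_EE_succ ξ e hlen hnil N
      have hG := coeffSum_succ he hN hr (hξ N) hlen hc
      have hrhs : ∀ A ∈ (Tilings r).filter (fun A => A ⊆ posOne c), ∀ B ∈ (posGt c).powerset,
          wordSum ξ (EE e (modify c A B)) N = coeffSum ξ e N (modify c A B) := by
        intro A hA B hB
        have hB := Finset.mem_powerset.1 hB
        obtain ⟨s, hs⟩ := modify_length_even hlen hc (Finset.mem_filter.1 hA).1 hB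
        exact ihN _ s hs (one_le_of_mem_modify hc A hB)
      rw [Finset.sum_congr rfl fun A hA => Finset.sum_congr rfl fun B hB => by
        rw [hrhs A hA B hB], ← hG] at hA
      -- By induction on `c`, the terms with `B ≠ ∅` on the left agree; this leaves `B = ∅`.
      rw [← Finset.add_sum_erase _ _ (Finset.empty_mem_powerset _),
        ← Finset.add_sum_erase (posGt c).powerset (fun B => (-1) ^ B.card * ξ N ^ alpha r B *
          coeffSum ξ e (N + 1) (modify c ∅ B)) (Finset.empty_mem_powerset _)] at hA
      rw [Finset.sum_congr rfl (g := fun B => (-1) ^ B.card * ξ N ^ alpha r B *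
        coeffSum ξ e (N + 1) (modify c ∅ B))] at hA
      · exact add_right_cancel (by
          simpa only [modify_empty, alpha_empty, Finset.card_empty, pow_zero, one_mul] using hA)
      · intro B hB
        obtain ⟨hB1, hB2⟩ := Finset.mem_erase.1 hB
        have hB2 := Finset.mem_powerset.1 hB2
        rw [ihs _ (modify_sum_lt (Finset.empty_subset _) hB2
          (Or.inr (Finset.nonempty_iff_ne_empty.2 hB1))) _ rfl r
          (by rw [length_modify_empty, hlen]) (one_le_of_mem_modify hc ∅ hB2)]

end Words

/-! ### Truncated multiple sums -/

section Tuples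

variable {ι K : Type*} [CommRing K] (φ : ι → ℕ → K) (s : ι → Prop)

/-- The tuples `m ≤ n₁ ≤ ⋯ ≤ n_r` such that `n_i < n_{i+1}` whenever the entry `k_i` is strict. -/
def TupleDomain (m : ℕ) (k : List ι) (n : Fin k.length → ℕ) : Prop :=
  (∀ i, m ≤ n i) ∧
    ∀ i j : Fin k.length, (i : ℕ) + 1 = j → n i ≤ n j ∧ (s (k.get i) → n i < n j)

open scoped Classical in
/-- The smallest possible value of the summation variable that follows the value `j` at `a`. -/
noncomputable def nextBound (a : ι) (j : ℕ) : ℕ := if s a then j + 1 else j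

theorem le_nextBound (a : ι) (j : ℕ) : j ≤ nextBound s a j := by
  rw [nextBound]
  split_ifs <;> omega

theorem nextBound_le {a : ι} {j i : ℕ} : nextBound s a j ≤ i ↔ j ≤ i ∧ (s a → j < i) := by
  rw [nextBound]
  split_ifs with h
  · simp only [h, true_imp_iff]
    omega
  · simp [h]

theorem tupleDomain_cons {m j : ℕ} {a : ι} {k : List ι} {n : Fin k.length → ℕ} :
    TupleDomain s m (a :: k) (Fin.cons j n : Fin (k.length + 1) → ℕ) ↔
      m ≤ j ∧ TupleDomain s (nextBound s a j) k n := by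
  constructor
  · rintro ⟨h1, h2⟩
    refine ⟨h1 (0 : Fin (k.length + 1)), ?_, ?_⟩
    · rintro ⟨i, hi⟩
      induction i with
      | zero =>
        exact (nextBound_le s).2 (h2 (0 : Fin (k.length + 1)) (Fin.succ ⟨0, hi⟩) rfl)
      | succ i ih =>
        exact (ih (by omega)).trans
          (h2 (Fin.succ ⟨i, by omega⟩) (Fin.succ ⟨i + 1, hi⟩) rfl).1
    · intro i i' hi
      exact h2 i.succ i'.succ (by simp [← hi])
  · rintro ⟨h1, h2, h3⟩
    constructor
    · intro i
      refine Fin.cases ?_ (fun i => ?_) i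
      · exact h1
      · exact h1.trans ((le_nextBound s a j).trans (h2 i))
    · intro i
      refine Fin.cases (fun i' => ?_) (fun i i' => ?_) i
      · refine Fin.cases (fun hi => ?_) (fun i' _ => ?_) i'
        · simp at hi
        · exact (nextBound_le s).1 (h2 i')
      · refine Fin.cases (fun hi => ?_) (fun i' hi => ?_) i'
        · simp at hi
        · refine h3 i i' ?_
          have h4 : (i : ℕ) + 1 + 1 = i' + 1 := hi
          omega

open scoped Classical in
/-- The sum over the tuples in `TupleDomain` with all entries `< N`. -/
noncomputable def tupleSum (N m : ℕ) (k : List ι) : K :=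
  ∑ n ∈ (Fintype.piFinset fun _ : Fin k.length => Finset.range N).filter (TupleDomain s m k),
    ∏ j, φ (k.get j) (n j)

open scoped Classical in
theorem tupleSum_nil (N m : ℕ) : tupleSum φ s N m [] = 1 := by
  rw [tupleSum, Finset.filter_true_of_mem]
  · simp
  · intro n _
    exact ⟨fun i => i.elim0, fun i => i.elim0⟩

open scoped Classical in
theorem tupleSum_cons (N m : ℕ) (a : ι) (k : List ι) :
    tupleSum φ s N m (a :: k) =
      ∑ j ∈ Finset.Ico m N, φ a j * tupleSum φ s N (nextBound s a j) k := by
  simp only [tupleSum, Finset.mul_sum]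
  rw [Finset.sum_sigma']
  symm
  refine Finset.sum_bij' (fun p _ => (Fin.cons p.1 p.2 : Fin (k.length + 1) → ℕ))
    (fun n _ => ⟨n (0 : Fin (k.length + 1)), fun i => n i.succ⟩) ?_ ?_ ?_ ?_ ?_
  · rintro ⟨j, n⟩ h
    simp only [Finset.mem_sigma, Finset.mem_filter, Fintype.mem_piFinset, Finset.mem_Ico,
      Finset.mem_range] at h
    refine Finset.mem_filter.2 ⟨?_, (tupleDomain_cons s).2 ⟨h.1.1, h.2.2⟩⟩
    rw [Fintype.mem_piFinset]
    intro i
    rw [Finset.mem_range]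
    exact Fin.cases (motive := fun i => (Fin.cons j n : Fin (k.length + 1) → ℕ) i < N)
      h.1.2 (fun i => h.2.1 i) i
  · intro n h
    obtain ⟨h1, h2⟩ := Finset.mem_filter.1 h
    rw [Fintype.mem_piFinset] at h1
    have h3 : n = (Fin.cons (n (0 : Fin (k.length + 1))) fun i => n i.succ) :=
      (Fin.cons_self_tail (α := fun _ => ℕ) (n := k.length) n).symm
    rw [h3, tupleDomain_cons] at h2
    simp only [Finset.mem_sigma, Finset.mem_filter, Fintype.mem_piFinset, Finset.mem_Ico]
    exact ⟨⟨h2.1, Finset.mem_range.1 (h1 _)⟩, fun i => h1 i.succ, h2.2⟩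
  · rintro ⟨j, n⟩ _
    rfl
  · intro n _
    exact Fin.cons_self_tail (α := fun _ => ℕ) (n := k.length) n
  · rintro ⟨j, n⟩ _
    exact (Fin.prod_univ_succ (n := k.length) fun i => φ ((a :: k).get i)
      ((Fin.cons j n : Fin (k.length + 1) → ℕ) i)).symm

theorem tupleSum_cons_self (N : ℕ) (a : ι) (k : List ι) : tupleSum φ s N N (a :: k) = 0 := by
  rw [tupleSum_cons, Finset.Ico_self, Finset.sum_empty]

/-- If `P n` is a sum over tuples whose next variable may take the value `n`, then `extendSum a P`
is the same for the tuples with one more variable, at the entry `a`. -/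
noncomputable def extendSum (P : ℕ → K) (a : ι) (n : ℕ) : K :=
  ∑ j ∈ Finset.range (n + 1) with nextBound s a j ≤ n, φ a j * P j

theorem sum_nextBound_fiber (a : ι) (g t : ℕ → K) (n : ℕ) :
    ∑ i ∈ Finset.range (n + 1), (∑ j ∈ Finset.range (i + 1) with nextBound s a j = i, g j) * t i =
      ∑ j ∈ Finset.range (n + 1) with nextBound s a j ≤ n, g j * t (nextBound s a j) := by
  simp only [Finset.sum_mul]
  rw [Finset.sum_comm' (t' := Finset.filter (fun j => nextBound s a j ≤ n) (Finset.range (n + 1)))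
    (s' := fun j => {nextBound s a j})]
  · simp
  · intro i j
    have := le_nextBound s a j
    simp only [Finset.mem_range, Finset.mem_filter, Finset.mem_singleton]
    constructor
    · rintro ⟨h1, h2, h3⟩
      omega
    · rintro ⟨h1, h2, h3⟩
      omega

/-- Iterating `extendSum` along `k` computes the sums over the tuples of `TupleDomain`.  The last
entry has to be strict, because `tupleSum N` excludes the value `N`. -/
theorem foldl_extendSum (N : ℕ) : ∀ (k : List ι), (∀ h : k ≠ [], s (k.getLast h)) →
    ∀ D : ℕ → K, k.foldl (extendSum φ s) (fun n => ∑ m ∈ Finset.range (n + 1), D m) N =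
      ∑ m ∈ Finset.range (N + 1), D m * tupleSum φ s N m k
  | [], _, D => by simp [tupleSum_nil]
  | a :: k, hk, D => by
    have hk' : ∀ h : k ≠ [], s (k.getLast h) := by
      intro h
      have := hk (by simp)
      rwa [List.getLast_cons h] at this
    have hext : extendSum φ s (fun n => ∑ m ∈ Finset.range (n + 1), D m) a = fun n =>
        ∑ i ∈ Finset.range (n + 1), ∑ j ∈ Finset.range (i + 1) with nextBound s a j = i,
          φ a j * ∑ m ∈ Finset.range (j + 1), D m := by
      funext n
      have := sum_nextBound_fiber s a (fun j => φ a j * ∑ m ∈ Finset.range (j + 1), D m) 1 n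
      rw [extendSum]
      simpa using this.symm
    rw [List.foldl_cons, hext, foldl_extendSum N k hk', sum_nextBound_fiber]
    have h1 : ∑ j ∈ Finset.range (N + 1) with nextBound s a j ≤ N,
        (φ a j * ∑ m ∈ Finset.range (j + 1), D m) * tupleSum φ s N (nextBound s a j) k =
        ∑ j ∈ Finset.range N,
        (φ a j * ∑ m ∈ Finset.range (j + 1), D m) * tupleSum φ s N (nextBound s a j) k := by
      rw [Finset.sum_filter, Finset.sum_range_succ]
      -- A weak entry may take the value `N`, but then no value `< N` is left for the next entry.
      have h2 : (if nextBound s a N ≤ N then (φ a N * ∑ m ∈ Finset.range (N + 1), D m) *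
          tupleSum φ s N (nextBound s a N) k else 0) = 0 := by
        by_cases ha : s a
        · rw [if_neg]
          simp [nextBound, ha]
        · have hne : k ≠ [] := by
            rintro rfl
            exact ha (hk (by simp))
          obtain ⟨b, k, rfl⟩ := List.exists_cons_of_ne_nil hne
          have : nextBound s a N = N := by simp [nextBound, ha]
          rw [this, tupleSum_cons_self, mul_zero, ite_self]
      rw [h2, add_zero]
      refine Finset.sum_congr rfl fun j hj => if_pos ?_
      have := Finset.mem_range.1 hj
      rw [nextBound]
      split_ifs <;> omega
    rw [h1]
    simp only [tupleSum_cons, Finset.mul_sum, Finset.sum_mul]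
    rw [Finset.sum_comm' (t' := Finset.range (N + 1)) (s' := fun m => Finset.Ico m N)]
    · refine Finset.sum_congr rfl fun m _ => Finset.sum_congr rfl fun j _ => ?_
      ring
    · intro j m
      simp only [Finset.mem_range, Finset.mem_Ico]
      omega

/-- The sequence of partial sums of the indicator function of `0`, that is, the indicator function
of the positive integers. -/
def startSeq (K : Type*) [CommRing K] (n : ℕ) : K := if n = 0 then 0 else 1

/-- `startSeq` imposes the condition `n₁ ≥ 1` on the first summation variable. -/
theorem foldl_startSeq (N : ℕ) (hN : 1 ≤ N) (k : List ι) (hk : ∀ h : k ≠ [], s (k.getLast h)) :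
    k.foldl (extendSum φ s) (startSeq K) N = tupleSum φ s N 1 k := by
  have h : startSeq K = fun n => ∑ m ∈ Finset.range (n + 1), if m = 1 then 1 else 0 := by
    funext n
    rw [Finset.sum_ite_eq', startSeq]
    by_cases h : n = 0
    · simp [h]
    · rw [if_neg h, if_pos (Finset.mem_range.2 (by omega))]
  rw [h, foldl_extendSum φ s N k hk]
  simp only [ite_mul, one_mul, zero_mul]
  rw [Finset.sum_ite_eq', if_pos (Finset.mem_range.2 (by omega))]

/-- The sums over the values of the variable that lie between `m` and `n`: strictly below `n` if the
entry is strict. -/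
noncomputable def extendKernel (a : ι) (g : ℕ → ℕ → K) (m n : ℕ) : K :=
  ∑ j ∈ Finset.range (n + 1) with nextBound s a j ≤ n ∧ m < j, φ a j * g m j

theorem extendSum_kernel (a : ι) (g : ℕ → ℕ → K) (d : ℕ → K) (n : ℕ) :
    extendSum φ s (fun n => ∑ m ∈ Finset.range n, g m n * d m) a n =
      ∑ m ∈ Finset.range n, extendKernel φ s a g m n * d m := by
  simp only [extendSum, extendKernel, Finset.mul_sum, Finset.sum_mul]
  rw [Finset.sum_comm' (t' := Finset.range n) (s' := fun m => Finset.filter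
    (fun j => nextBound s a j ≤ n ∧ m < j) (Finset.range (n + 1)))]
  · refine Finset.sum_congr rfl fun m _ => Finset.sum_congr rfl fun j _ => ?_
    ring
  · intro j m
    have := le_nextBound s a j
    simp only [Finset.mem_range, Finset.mem_filter]
    constructor
    · rintro ⟨⟨h1, h2⟩, h3⟩
      exact ⟨⟨h1, h2, h3⟩, by omega⟩
    · rintro ⟨⟨h1, h2, h3⟩, h4⟩
      exact ⟨⟨h1, h2⟩, h3⟩

/-- The iteration of `extendKernel` at one entry. -/
noncomputable def iterKernel (a : ι) : ℕ → ℕ → ℕ → K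
  | 0 => fun _ _ => 1
  | l + 1 => extendKernel φ s a (iterKernel a l)

theorem foldl_replicate (a : ι) (l : ℕ) (d : ℕ → K) :
    (List.replicate l a).foldl (extendSum φ s) (fun n => ∑ m ∈ Finset.range n, d m) =
      fun n => ∑ m ∈ Finset.range n, iterKernel φ s a l m n * d m := by
  have h : ∀ i l, (List.replicate l a).foldl (extendSum φ s)
      (fun n => ∑ m ∈ Finset.range n, iterKernel φ s a i m n * d m) =
      fun n => ∑ m ∈ Finset.range n, iterKernel φ s a (i + l) m n * d m := by
    intro i l
    induction l generalizing i with
    | zero => rfl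
    | succ l ih =>
      rw [List.replicate_succ, List.foldl_cons]
      have : extendSum φ s (fun n => ∑ m ∈ Finset.range n, iterKernel φ s a i m n * d m) a =
          fun n => ∑ m ∈ Finset.range n, iterKernel φ s a (i + 1) m n * d m := by
        funext n
        exact extendSum_kernel φ s a _ d n
      rw [this, ih, add_assoc, add_comm 1]
  have := h 0 l
  simpa [iterKernel] using this

theorem extendSum_strict {a : ι} (ha : s a) (P : ℕ → K) (n : ℕ) :
    extendSum φ s P a n = ∑ j ∈ Finset.range n, φ a j * P j := by
  rw [extendSum]
  refine Finset.sum_congr ?_ fun _ _ => rfl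
  ext j
  simp only [nextBound, if_pos ha, Finset.mem_filter, Finset.mem_range]
  omega

/-- The index `({b}^(l₁-1), a₁, …, {b}^(l_r-1), a_r)` obtained from the list of the pairs
`(l_j, k_j)`, where `a_j = f k_j`. -/
def blockIndex (b : ι) (f : ℕ → ι) (p : List (ℕ × ℕ)) : List ι :=
  p.flatMap fun x => List.replicate (x.1 - 1) b ++ [f x.2]

theorem blockIndex_append (b : ι) (f : ℕ → ι) (p p' : List (ℕ × ℕ)) :
    blockIndex b f (p ++ p') = blockIndex b f p ++ blockIndex b f p' :=
  List.flatMap_append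

theorem blockArrive_zero_eq (v : ℕ → ℕ → K) (h : ℕ → ℕ → ℕ → K) (k l : ℕ) (L : List ℕ) :
    blockArrive v h (k :: l :: L) 0 = 0 := by
  rw [blockArrive] <;> simp

/-- A multiple sum over an index composed of blocks is a chain sum over the blocks. -/
theorem foldl_blockIndex (b : ι) (f : ℕ → ι) (hf : ∀ k, s (f k)) (p : List (ℕ × ℕ)) :
    (blockIndex b f p).foldl (extendSum φ s) (startSeq K) = fun n => ∑ m ∈ Finset.range n,
      blockArrive (fun k => φ (f k)) (fun l => iterKernel φ s b (l - 1))
        (p.flatMap fun x => [x.1, x.2]).reverse m := by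
  induction p using List.reverseRecOn with
  | nil =>
    funext n
    cases n with
    | zero => simp [blockIndex, startSeq]
    | succ n =>
      rw [Finset.sum_range_succ']
      simp [blockIndex, startSeq, blockArrive]
  | append_singleton p x ih =>
    have h1 : blockIndex b f [x] = List.replicate (x.1 - 1) b ++ [f x.2] := by
      simp [blockIndex]
    have h2 : ((p ++ [x]).flatMap fun x => [x.1, x.2]).reverse =
        x.2 :: x.1 :: (p.flatMap fun x => [x.1, x.2]).reverse := by
      simp
    rw [blockIndex_append, List.foldl_append, ih, h1, List.foldl_append, foldl_replicate, h2]
    funext n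
    rw [List.foldl_cons, List.foldl_nil, extendSum_strict φ s (hf _)]
    refine Finset.sum_congr rfl fun m _ => ?_
    cases m with
    | zero => rw [blockArrive_zero_eq, Finset.sum_range_zero, mul_zero]
    | succ m => rw [blockArrive]

end Tuples

/-! ### Truncated multiple sums converge to the `q`-multiple zeta values -/

open Filter Topology

section Limits

variable {ι : Type*}

theorem tendsto_tupleSum (φ : ι → ℕ → PowerSeries ℚ) (s : ι → Prop) (k : List ι)
    (h : Summable fun n : {n : Fin k.length → ℕ // TupleDomain s 1 k n} =>
      ∏ j, φ (k.get j) (n.1 j)) :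
    Tendsto (fun N => tupleSum φ s N 1 k) atTop
      (𝓝 (∑' n : {n : Fin k.length → ℕ // TupleDomain s 1 k n}, ∏ j, φ (k.get j) (n.1 j))) := by
  classical
  have hmono : Monotone fun N : ℕ => (Fintype.piFinset fun _ : Fin k.length =>
      Finset.range N).subtype (TupleDomain s 1 k) := by
    intro M N hMN n hn
    rw [Finset.mem_subtype, Fintype.mem_piFinset] at hn ⊢
    intro i
    exact Finset.range_mono hMN (hn i)
  have hlim : Tendsto (fun N : ℕ => (Fintype.piFinset fun _ : Fin k.length =>
      Finset.range N).subtype (TupleDomain s 1 k)) atTop atTop := by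
    refine tendsto_atTop_finset_of_monotone hmono fun n => ⟨(∑ i, n.1 i) + 1, ?_⟩
    rw [Finset.mem_subtype, Fintype.mem_piFinset]
    intro i
    rw [Finset.mem_range, Nat.lt_succ_iff]
    exact Finset.single_le_sum (f := n.1) (fun _ _ => Nat.zero_le _) (Finset.mem_univ i)
  refine (h.hasSum.comp hlim).congr fun N => ?_
  rw [Function.comp_apply, Finset.sum_subtype_eq_sum_filter
    (f := fun n : Fin k.length → ℕ => ∏ j, φ (k.get j) (n j)), tupleSum]

theorem tendsto_zetaDag (k : List Entry) (hk : ∀ h : k ≠ [], k.getLast h ≠ Entry.bar1) :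
    Tendsto (fun N => k.foldl (extendSum dagFactor fun a => a ≠ Entry.bar1)
      (startSeq (PowerSeries ℚ)) N) atTop (𝓝 (zetaDag k)) := by
  refine (tendsto_tupleSum dagFactor (fun a => a ≠ Entry.bar1) k (summable_dagTerm k hk)).congr' ?_
  filter_upwards [eventually_ge_atTop 1] with N hN
  exact (foldl_startSeq _ _ N hN k hk).symm

/-- The factor of an entry in the Bradley–Zhao model. -/
noncomputable def bzFactor (k n : ℕ) : PowerSeries ℚ :=
  PowerSeries.X ^ (n * (k - 1)) * ((1 - PowerSeries.X ^ n)⁻¹) ^ k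

theorem bzDomain_iff (k : List ℕ) (n : Fin k.length → ℕ) :
    BZDomain n ↔ TupleDomain (fun _ => True) 1 k n := by
  refine and_congr_right fun _ => ⟨fun h i j hij => ?_, fun h => ?_⟩
  · have : n i < n j := h (by rw [Fin.lt_def]; omega)
    exact ⟨this.le, fun _ => this⟩
  · intro i j hij
    rw [Fin.lt_def] at hij
    have hd : ∀ (d : ℕ) (i j : Fin k.length), (i : ℕ) + d + 1 = j → n i < n j := by
      intro d
      induction d with
      | zero =>
        intro i j hij
        exact (h i j hij).2 trivial
      | succ d ih =>
        intro i j hij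
        have := j.2
        exact (ih i ⟨i + d + 1, by omega⟩ rfl).trans ((h ⟨i + d + 1, by omega⟩ j hij).2 trivial)
    exact hd (j - i - 1) i j (by omega)

theorem tendsto_zetaBZ (k : List ℕ) (hk : ∀ h : k ≠ [], 2 ≤ k.getLast h) :
    Tendsto (fun N => k.foldl (extendSum bzFactor fun _ => True) (startSeq (PowerSeries ℚ)) N)
      atTop (𝓝 (zetaBZ k)) := by
  have hD : (BZDomain : (Fin k.length → ℕ) → Prop) = TupleDomain (fun _ => True) 1 k := by
    funext n
    exact propext (bzDomain_iff k n)
  have hs := summable_bzTerm k hk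
  rw [zetaBZ]
  rw [hD] at hs ⊢
  refine (tendsto_tupleSum bzFactor (fun _ => True) k hs).congr' ?_
  filter_upwards [eventually_ge_atTop 1] with N hN
  exact (foldl_startSeq _ _ N hN k fun _ => trivial).symm

end Limits

/-! ### The sequences `ξ` of the two models -/

section Sequences

/-- The power series `1 / (1 - q^n)`.  For `n = 0` it has the junk value `0`, as `ξ_0 = 0`
requires. -/
noncomputable def qInv (n : ℕ) : PowerSeries ℚ := (1 - PowerSeries.X ^ n)⁻¹

theorem qInv_zero : qInv 0 = 0 := by
  rw [qInv, pow_zero, sub_self, PowerSeries.zero_inv]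

theorem qInv_mul {n : ℕ} (hn : 1 ≤ n) : qInv n * (1 - PowerSeries.X ^ n) = 1 := by
  rw [qInv]
  apply PowerSeries.inv_mul_cancel
  rw [map_sub, map_pow, PowerSeries.constantCoeff_X, zero_pow (by omega)]
  simp

theorem one_sub_pow_ne_zero {n : ℕ} (hn : 1 ≤ n) : (1 - PowerSeries.X ^ n : PowerSeries ℚ) ≠ 0 :=
  right_ne_zero_of_mul_eq_one (qInv_mul hn)

/-- The sequence `ξ_n` of the two models: `1 / (1 - q^n)` for `ε = 0`, and `-q^n / (1 - q^n)` for
`ε = 1`; here `ξ_0 = 0`. -/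
noncomputable def qSeq (e n : ℕ) : PowerSeries ℚ :=
  if e = 0 then qInv n else -(PowerSeries.X ^ n * qInv n)

theorem qSeq_index_zero (e : ℕ) : qSeq e 0 = 0 := by
  rw [qSeq, qInv_zero]
  simp

/-- The partial fraction relation between the `ξ_n`. -/
theorem qSeq_mul (e : ℕ) (N n : ℕ) (hn : 1 ≤ n) (hN : n < N) :
    qSeq e N * (qSeq e n + qSeq e (N - n) - 1) = qSeq e n * qSeq e (N - n) := by
  obtain ⟨m, rfl⟩ := Nat.exists_eq_add_of_lt hN
  have hm : n + m + 1 - n = m + 1 := by omega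
  have h1 := qInv_mul hn
  have h2 := qInv_mul (show 1 ≤ m + 1 by omega)
  have h3 := qInv_mul (show 1 ≤ n + (m + 1) by omega)
  rw [hm, add_assoc]
  apply mul_right_cancel₀ (one_sub_pow_ne_zero hn)
  apply mul_right_cancel₀ (one_sub_pow_ne_zero (show 1 ≤ m + 1 by omega))
  apply mul_right_cancel₀ (one_sub_pow_ne_zero (show 1 ≤ n + (m + 1) by omega))
  simp only [qSeq]
  rw [pow_add _ n (m + 1)] at h3 ⊢
  generalize qInv n = a at *
  generalize qInv (m + 1) = b at *
  generalize qInv (n + (m + 1)) = c at *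
  generalize (PowerSeries.X : PowerSeries ℚ) ^ n = x at *
  generalize (PowerSeries.X : PowerSeries ℚ) ^ (m + 1) = y at *
  split_ifs
  · linear_combination (a * (1 - x) * (1 - y) + b * (1 - y) * (1 - x) - (1 - x) * (1 - y)) * h3 +
      (1 - y) * h1 + (1 - x) * h2 - b * (1 - y) * (1 - x * y) * h1 - (1 - x * y) * h2
  · linear_combination x * y * ((x * (a * (1 - x)) * (1 - y) + y * (b * (1 - y)) * (1 - x) +
      (1 - x) * (1 - y)) * h3 + x * (1 - y) * h1 + y * (1 - x) * h2 -
      b * (1 - y) * (1 - x * y) * h1 - (1 - x * y) * h2)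

end Sequences

/-! ### The limits of the truncated multiple sums -/

open Filter Topology

section BlockArrive

variable {K : Type*} [CommRing K]

theorem blockArrive_congr {v v' : ℕ → ℕ → K} {h h' : ℕ → ℕ → ℕ → K}
    (hv : ∀ k n, v k (n + 1) = v' k (n + 1))
    (hh : ∀ l j n, j ≤ n → h l j (n + 1) = h' l j (n + 1)) :
    ∀ (L : List ℕ) (n : ℕ), blockArrive v h L n = blockArrive v' h' L n
  | k :: l :: L, n + 1 => by
    rw [blockArrive, blockArrive, hv]
    congr 1
    refine Finset.sum_congr rfl fun j hj => ?_
    rw [hh l j n (Nat.lt_succ_iff.1 (Finset.mem_range.1 hj)), blockArrive_congr hv hh L j]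
  | [], 0 => rfl
  | [], _ + 1 => rfl
  | [_], 0 => rfl
  | [_], _ + 1 => rfl
  | _ :: _ :: _, 0 => rfl

theorem blockArrive_scale (σ : ℕ → K) (v : ℕ → ℕ → K) (h : ℕ → ℕ → ℕ → K) :
    ∀ (L : List ℕ) (n : ℕ), blockArrive (fun k n => σ k * v k n) (fun l j n => σ l * h l j n) L n =
      (L.map σ).prod * blockArrive v h L n
  | k :: l :: L, n + 1 => by
    rw [blockArrive, blockArrive]
    simp only [blockArrive_scale σ v h L, List.map_cons, List.prod_cons, Finset.mul_sum]
    refine Finset.sum_congr rfl fun j _ => ?_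
    ring
  | [], 0 => by simp [blockArrive]
  | [], _ + 1 => by simp [blockArrive]
  | [_], 0 => by simp [blockArrive]
  | [_], _ + 1 => by simp [blockArrive]
  | _ :: _ :: _, 0 => by simp [blockArrive]

/-- The factor `q^n` of the weight `v k n` makes up for the weights `h l j n` and `h' l j n` being
congruent modulo `q^(N-n)` only. -/
theorem blockArrive_dvd_sub {x : K} {v : ℕ → ℕ → K} {h h' : ℕ → ℕ → ℕ → K} {N : ℕ}
    (hv : ∀ k n, x ^ n ∣ v k n)
    (hh : ∀ l j n, j < n → n ≤ N → x ^ (N - n) ∣ h l j n - h' l j n) :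
    ∀ (L : List ℕ) (n : ℕ), n ≤ N → x ^ N ∣ blockArrive v h L n - blockArrive v h' L n
  | k :: l :: L, n + 1, hn => by
    have hN : x ^ N = x ^ (n + 1) * x ^ (N - (n + 1)) := by
      rw [← pow_add]
      congr 1
      omega
    rw [blockArrive, blockArrive, ← mul_sub, ← Finset.sum_sub_distrib, hN]
    refine mul_dvd_mul (hv _ _) (Finset.dvd_sum fun j hj => ?_)
    have hj := Finset.mem_range.1 hj
    have h1 : h l j (n + 1) * blockArrive v h L j - h' l j (n + 1) * blockArrive v h' L j =
        (h l j (n + 1) - h' l j (n + 1)) * blockArrive v h L j +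
          h' l j (n + 1) * (blockArrive v h L j - blockArrive v h' L j) := by
      ring
    rw [h1]
    exact dvd_add (Dvd.dvd.mul_right (hh l j (n + 1) hj hn) _) (Dvd.dvd.mul_left
      ((pow_dvd_pow x (Nat.sub_le _ _)).trans (blockArrive_dvd_sub hv hh L j (by omega))) _)
  | [], 0, _ => by simp [blockArrive]
  | [], _ + 1, _ => by simp [blockArrive]
  | [_], 0, _ => by simp [blockArrive]
  | [_], _ + 1, _ => by simp [blockArrive]
  | _ :: _ :: _, 0, _ => by simp [blockArrive]

end BlockArrive

section Kernels

variable {ι K : Type*} [CommRing K] (φ : ι → ℕ → K) (s : ι → Prop)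

theorem extendKernel_weak_self {a : ι} (g : ℕ → ℕ → K) (m : ℕ) :
    extendKernel φ s a g m m = 0 := by
  rw [extendKernel, Finset.filter_false_of_mem, Finset.sum_empty]
  intro j hj
  have := Finset.mem_range.1 hj
  omega

theorem extendKernel_weak_succ {a : ι} (ha : ¬ s a) (g : ℕ → ℕ → K) {m n : ℕ} (hmn : m ≤ n) :
    extendKernel φ s a g m (n + 1) =
      extendKernel φ s a g m n + φ a (n + 1) * g m (n + 1) := by
  simp only [extendKernel, nextBound, if_neg ha]
  rw [Finset.range_add_one (n := n + 1), Finset.filter_insert, if_pos (by omega),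
    Finset.sum_insert (by simp), add_comm]
  congr 1
  refine Finset.sum_congr ?_ fun _ _ => rfl
  ext j
  simp only [Finset.mem_filter, Finset.mem_range]
  omega

theorem extendKernel_strict_self {a : ι} (ha : s a) (g : ℕ → ℕ → K) (m : ℕ) :
    extendKernel φ s a g m (m + 1) = 0 := by
  rw [extendKernel, Finset.filter_false_of_mem, Finset.sum_empty]
  intro j _
  simp only [nextBound, if_pos ha]
  omega

theorem extendKernel_strict_succ {a : ι} (ha : s a) (g : ℕ → ℕ → K) {m n : ℕ} (hmn : m < n) :
    extendKernel φ s a g m (n + 1) = extendKernel φ s a g m n + φ a n * g m n := by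
  simp only [extendKernel, nextBound, if_pos ha]
  have h1 : (Finset.range (n + 1 + 1)).filter (fun j => j + 1 ≤ n + 1 ∧ m < j) =
      insert n ((Finset.range (n + 1)).filter fun j => j + 1 ≤ n ∧ m < j) := by
    ext j
    simp only [Finset.mem_filter, Finset.mem_range, Finset.mem_insert]
    omega
  rw [h1, Finset.sum_insert (by simp), add_comm]

/-- For a weak entry with factor `1`, the iterated kernel counts multisets. -/
theorem iterKernel_weak {a : ι} (ha : ¬ s a) (hφ : ∀ n, φ a n = 1) (m : ℕ) :
    ∀ d l, iterKernel φ s a l m (m + d) = PowerSeries.coeff l (geomSeries (1 : K) ^ d)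
  | 0, 0 => by simp [iterKernel]
  | 0, l + 1 => by
    rw [iterKernel, add_zero, extendKernel_weak_self]
    simp [PowerSeries.coeff_one]
  | d + 1, 0 => by
    have h : PowerSeries.constantCoeff (geomSeries (1 : K)) = 1 := by
      rw [← PowerSeries.coeff_zero_eq_constantCoeff_apply, coeff_geomSeries, pow_zero]
    simp [iterKernel, h]
  | d + 1, l + 1 => by
    have h1 : geomSeries (1 : K) ^ (d + 1) =
        geomSeries 1 ^ d + geomSeries 1 ^ (d + 1) * PowerSeries.X := by
      have := geomSeries_mul (1 : K)
      rw [map_one, one_mul] at this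
      linear_combination (geomSeries (1 : K)) ^ d * this
    rw [iterKernel, ← add_assoc, extendKernel_weak_succ φ s ha _ (by omega), hφ, one_mul, h1,
      map_add, PowerSeries.coeff_succ_mul_X, add_assoc m, iterKernel_weak ha hφ m (d + 1) l,
      ← iterKernel_weak ha hφ m d (l + 1)]
    rfl

/-- For a strict entry, the iterated kernel consists of elementary symmetric polynomials. -/
theorem iterKernel_strict {a : ι} (ha : s a) (m : ℕ) :
    ∀ d l, iterKernel φ s a l m (m + 1 + d) = PowerSeries.coeff l
      (∏ j ∈ Finset.Ioo m (m + 1 + d), (1 + PowerSeries.C (φ a j) * PowerSeries.X))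
  | 0, 0 => by simp [iterKernel]
  | 0, l + 1 => by
    have : Finset.Ioo m (m + 1) = ∅ := by
      ext i
      simp only [Finset.mem_Ioo, Finset.notMem_empty, iff_false]
      omega
    rw [iterKernel, add_zero, extendKernel_strict_self φ s ha, this]
    simp [PowerSeries.coeff_one]
  | d + 1, l => by
    have h1 : Finset.Ioo m (m + 1 + (d + 1)) = insert (m + 1 + d) (Finset.Ioo m (m + 1 + d)) := by
      ext i
      simp only [Finset.mem_Ioo, Finset.mem_insert]
      omega
    rw [h1, Finset.prod_insert (by simp), add_mul, one_mul, map_add, mul_assoc,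
      PowerSeries.coeff_C_mul]
    rw [← iterKernel_strict ha m d l]
    cases l with
    | zero => simp [iterKernel]
    | succ l =>
      rw [mul_comm PowerSeries.X, PowerSeries.coeff_succ_mul_X, ← iterKernel_strict ha m d l,
        iterKernel, ← add_assoc, extendKernel_strict_succ φ s ha _ (by omega)]

end Kernels

section Region

variable {K : Type*} [CommRing K]

theorem map_geomSeries {K' : Type*} [CommRing K'] (π : K →+* K') (a : K) :
    PowerSeries.map π (geomSeries a) = geomSeries (π a) := by
  ext k
  rw [PowerSeries.coeff_map, coeff_geomSeries, coeff_geomSeries, map_pow]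

/-- If `ξ_i` tends to `c`, then the factors `1 / (1 - ξ_{N-j} z)` in `regionSeries` tend to
`1 / (1 - c z)`. -/
theorem dvd_coeff_regionSeries_sub {x c : K} {ξ : ℕ → K} (hξ : ∀ i, x ^ i ∣ ξ i - c)
    (e N m n l : ℕ) :
    x ^ (N - n) ∣ PowerSeries.coeff l (regionSeries ξ e N m n) - PowerSeries.coeff l
      (geomSeries c * ∏ j ∈ Finset.Ioo m n, geomSeries c * stepRight ξ e j) := by
  set π := Ideal.Quotient.mk (Ideal.span {x ^ (N - n)}) with hπ
  have h1 : ∀ j, j ≤ n → π (ξ (N - j)) = π c := by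
    intro j hj
    rw [hπ, Ideal.Quotient.eq, Ideal.mem_span_singleton]
    exact (pow_dvd_pow x (by omega)).trans (hξ _)
  have h2 : PowerSeries.map π (regionSeries ξ e N m n) = PowerSeries.map π
      (geomSeries c * ∏ j ∈ Finset.Ioo m n, geomSeries c * stepRight ξ e j) := by
    rw [regionSeries, map_mul, map_mul, map_prod, map_prod, stepLeft, map_geomSeries,
      map_geomSeries, h1 n le_rfl]
    congr 1
    refine Finset.prod_congr rfl fun j hj => ?_
    rw [stepSeries, map_mul, map_mul, stepLeft, map_geomSeries, map_geomSeries,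
      h1 j (Finset.mem_Ioo.1 hj).2.le]
  have h3 := congrArg (PowerSeries.coeff l) h2
  rw [PowerSeries.coeff_map, PowerSeries.coeff_map] at h3
  rwa [← Ideal.mem_span_singleton, ← Ideal.Quotient.eq]

theorem coeff_jumpSeries (ξ : ℕ → K) (e n k : ℕ) :
    PowerSeries.coeff k (jumpSeries ξ e n) = (ξ n - 1) * ξ n ^ (e + k) := by
  rw [jumpSeries, PowerSeries.coeff_C_mul, coeff_geomSeries, pow_add, mul_assoc]

end Region

section Convergence

/-- Two sequences that agree modulo `q^N` at `N` have the same limit. -/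
theorem tendsto_of_dvd_sub {F G : ℕ → PowerSeries ℚ} {a : PowerSeries ℚ}
    (h : ∀ N, PowerSeries.X ^ N ∣ F N - G N) (hG : Tendsto G atTop (𝓝 a)) :
    Tendsto F atTop (𝓝 a) := by
  rw [PowerSeries.WithPiTopology.tendsto_iff_coeff_tendsto] at hG ⊢
  intro d
  refine (hG d).congr' ?_
  filter_upwards [eventually_gt_atTop d] with N hN
  have := PowerSeries.X_pow_dvd_iff.1 (h N) d hN
  rw [map_sub] at this
  exact (sub_eq_zero.1 this).symm

/-- Replacing the weights by their limits does not change the limit of the truncated sums. -/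
theorem tendsto_coeffSum {ξ : ℕ → PowerSeries ℚ} {c a : PowerSeries ℚ} {e : ℕ}
    (hξ : ∀ i, PowerSeries.X ^ i ∣ ξ i - c)
    (hv : ∀ k n, PowerSeries.X ^ n ∣ (ξ n - 1) * ξ n ^ (e + k)) (L : List ℕ)
    (h : Tendsto (fun N => ∑ n ∈ Finset.range N, blockArrive
      (fun k n => (ξ n - 1) * ξ n ^ (e + (k - 1)))
      (fun l m n => PowerSeries.coeff (l - 1)
        (geomSeries c * ∏ j ∈ Finset.Ioo m n, geomSeries c * stepRight ξ e j)) L.reverse n)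
      atTop (𝓝 a)) :
    Tendsto (fun N => coeffSum ξ e N L) atTop (𝓝 a) := by
  refine tendsto_of_dvd_sub (fun N => ?_) h
  rw [coeffSum, ← Finset.sum_sub_distrib]
  refine Finset.dvd_sum fun n hn => ?_
  simp only [coeffArrive, coeff_jumpSeries]
  exact blockArrive_dvd_sub (fun k n => hv (k - 1) n)
    (fun l j n _ _ => dvd_coeff_regionSeries_sub hξ e N j n (l - 1)) _ n
    (Finset.mem_range.1 hn).le

theorem qInv_sub_one {n : ℕ} (hn : 1 ≤ n) : qInv n - 1 = PowerSeries.X ^ n * qInv n := by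
  linear_combination qInv_mul hn

theorem qSeq_zero (n : ℕ) : qSeq 0 n = qInv n := rfl

theorem qSeq_one (n : ℕ) : qSeq 1 n = -(PowerSeries.X ^ n * qInv n) := rfl

theorem blockIndex_eq {ι : Type*} (b : ι) {f g : ℕ → ι} {p : List (ℕ × ℕ)}
    (h : ∀ x ∈ p, f x.2 = g x.2) : blockIndex b f p = blockIndex b g p := by
  rw [blockIndex, blockIndex, List.flatMap_def, List.flatMap_def]
  congr 1
  refine List.map_congr_left fun x hx => ?_
  rw [h x hx]

theorem tendsto_coeffSum_dag (p : List (ℕ × ℕ)) (hp : ∀ x ∈ p, 1 ≤ x.1 ∧ 1 ≤ x.2) :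
    Tendsto (fun N => coeffSum (qSeq 0) 0 N (p.flatMap fun x => [x.1, x.2])) atTop
      (𝓝 (zetaDag (blockIndex Entry.bar1 Entry.int p))) := by
  have hdvd : ∀ n, PowerSeries.X ^ n ∣ qSeq 0 n - 1 := by
    intro n
    rcases Nat.eq_zero_or_pos n with rfl | hn
    · simp
    · exact ⟨_, qInv_sub_one hn⟩
  refine tendsto_coeffSum (c := 1) hdvd (fun k n => (hdvd n).mul_right _) _ ?_
  have hlast : ∀ h : blockIndex Entry.bar1 Entry.int p ≠ [],
      (blockIndex Entry.bar1 Entry.int p).getLast h ≠ Entry.bar1 := by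
    induction p using List.reverseRecOn with
    | nil => simp [blockIndex]
    | append_singleton p x _ => simp [blockIndex]
  refine (tendsto_zetaDag _ hlast).congr fun N => ?_
  rw [blockIndex_eq Entry.bar1 (g := fun k => Entry.int (k - 1 + 1))
    fun x hx => by rw [Nat.sub_add_cancel (hp x hx).2],
    foldl_blockIndex _ _ _ _ fun k => by simp]
  refine Finset.sum_congr rfl fun n _ => ?_
  apply blockArrive_congr
  · intro k n
    rw [qSeq_zero, qInv_sub_one (by omega), zero_add, dagFactor, ← qInv, pow_succ']
    ring
  · intro l j n hj
    obtain ⟨d, rfl⟩ := Nat.exists_eq_add_of_le hj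
    rw [add_assoc, iterKernel_weak _ _ (by simp) fun _ => rfl]
    congr 1
    have h1 : ∀ i, stepRight (qSeq 0) 0 i = 1 := by
      intro i
      simp [stepRight]
    simp only [h1, mul_one, Finset.prod_const, Nat.card_Ioo]
    rw [← pow_succ']
    congr 1
    omega

theorem prod_map_sign {L : List ℕ} (hL : ∀ a ∈ L, 1 ≤ a) (he : Even L.length) :
    (L.map fun a => (-1 : PowerSeries ℚ) ^ (a - 1)).prod = (-1) ^ L.sum := by
  have h : ∀ L : List ℕ, (∀ a ∈ L, 1 ≤ a) →
      (L.map fun a => (-1 : PowerSeries ℚ) ^ (a - 1)).prod * (-1) ^ L.length = (-1) ^ L.sum := by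
    intro L
    induction L with
    | nil => simp
    | cons a L ih =>
      intro hL
      obtain ⟨b, rfl⟩ := Nat.exists_eq_add_of_le' (hL a (by simp))
      have := ih fun x hx => hL x (by simp [hx])
      rw [List.map_cons, List.prod_cons, List.length_cons, List.sum_cons, pow_add _ _ L.sum, ← this,
        Nat.add_sub_cancel]
      ring
  rw [← h L hL, he.neg_one_pow, mul_one]

/-- The sign collects `(-1)^(k-1)` from the coefficient of `z^(k-1)` in each jump, where `ξ_n` has a
sign, and `(-1)^(l-1)` from the coefficient of `z^(l-1)` between two jumps, where `ξ_n - 1` does. -/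
theorem tendsto_coeffSum_bz (p : List (ℕ × ℕ)) (hp : ∀ x ∈ p, 1 ≤ x.1 ∧ 1 ≤ x.2) :
    Tendsto (fun N => coeffSum (qSeq 1) 1 N (p.flatMap fun x => [x.1, x.2])) atTop
      (𝓝 ((-1) ^ (p.flatMap fun x => [x.1, x.2]).sum *
        zetaBZ (blockIndex 1 (fun k => k + 1) p))) := by
  have hdvd : ∀ n, PowerSeries.X ^ n ∣ qSeq 1 n := by
    intro n
    rw [qSeq_one]
    exact (Dvd.intro _ rfl).neg_right
  refine tendsto_coeffSum (c := 0) (fun i => by rw [sub_zero]; exact hdvd i)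
    (fun k n => (((hdvd n).pow (by omega)).mul_left _)) _ ?_
  have hlast : ∀ h : blockIndex 1 (fun k => k + 1) p ≠ [],
      2 ≤ (blockIndex 1 (fun k => k + 1) p).getLast h := by
    induction p using List.reverseRecOn with
    | nil => simp [blockIndex]
    | append_singleton p x _ =>
      have := (hp x (by simp)).2
      simpa [blockIndex] using this
  refine ((tendsto_zetaBZ _ hlast).const_mul _).congr fun N => ?_
  -- The coefficient of `z^(k-1)` makes sense for `k = 0` as well; `k - 1 + 2` matches it there.
  rw [blockIndex_eq 1 (g := fun k => k - 1 + 2)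
    fun x hx => by have := (hp x hx).2; omega,
    foldl_blockIndex _ _ _ _ fun k => trivial, ← List.sum_reverse, ← prod_map_sign, Finset.mul_sum]
  · refine Finset.sum_congr rfl fun n _ => ?_
    rw [← blockArrive_scale]
    apply blockArrive_congr
    · intro k n
      have h1 : qSeq 1 (n + 1) - 1 = -qInv (n + 1) := by
        rw [qSeq_one]
        linear_combination qInv_sub_one (show 1 ≤ n + 1 by omega)
      rw [h1, bzFactor, ← qInv, qSeq_one, pow_mul, show k - 1 + 2 - 1 = k - 1 + 1 by omega]
      ring
    · intro l j n hj
      obtain ⟨d, rfl⟩ := Nat.exists_eq_add_of_le hj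
      rw [show j + d + 1 = j + 1 + d by omega, iterKernel_strict _ _ trivial,
        ← PowerSeries.coeff_rescale, map_prod]
      congr 1
      have h0 : geomSeries (0 : PowerSeries ℚ) = 1 := by
        have := geomSeries_mul (0 : PowerSeries ℚ)
        rwa [map_zero, zero_mul, sub_zero, mul_one] at this
      simp only [h0, one_mul]
      refine Finset.prod_congr rfl fun i hi => ?_
      have hi : 1 ≤ i := by
        have := (Finset.mem_Ioo.1 hi).1
        omega
      have h1 : qSeq 1 i - 1 = -bzFactor 1 i := by
        rw [qSeq_one, bzFactor, ← qInv, Nat.sub_self, mul_zero, pow_zero, one_mul, pow_one]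
        linear_combination qInv_sub_one hi
      have h2 : PowerSeries.rescale (-1) (PowerSeries.C (bzFactor 1 i)) =
          PowerSeries.C (bzFactor 1 i) := by
        ext m
        rw [PowerSeries.coeff_rescale, PowerSeries.coeff_C]
        split_ifs with hm
        · rw [hm, pow_zero, one_mul]
        · rw [mul_zero]
      rw [stepRight, h1, map_add, map_one, map_mul, PowerSeries.rescale_X, h2]
      simp
  · intro a ha
    rw [List.mem_reverse, List.mem_flatMap] at ha
    obtain ⟨x, hx, ha⟩ := ha
    have := hp x hx
    simp at ha
    omega
  · rw [List.length_reverse, List.length_flatMap]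
    simp

end Convergence

/-! ### The limits of the partial sums of words -/

open Filter Topology

section FoldScale

variable {ι ι' K : Type*} [CommRing K]

/-- The values of the factors at `0` do not matter, because the sequences vanish at `0`. -/
theorem foldl_extendSum_scale {φ : ι → ℕ → K} {ψ : ι' → ℕ → K} {s : ι → Prop} {s' : ι' → Prop}
    (g : ι → ι') (σ : ι → K) : ∀ (k : List ι), (∀ a ∈ k, s a ∧ s' (g a) ∧
      ∀ n, φ a (n + 1) = σ a * ψ (g a) (n + 1)) → ∀ P : ℕ → K, P 0 = 0 → ∀ (c : K) (N : ℕ),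
      k.foldl (extendSum φ s) (fun n => c * P n) N =
        c * (k.map σ).prod * (k.map g).foldl (extendSum ψ s') P N
  | [], _, P, _, c, N => by simp
  | a :: k, h, P, hP, c, N => by
    obtain ⟨h1, h2, h3⟩ := h a (by simp)
    have h4 : extendSum φ s (fun n => c * P n) a =
        fun n => (c * σ a) * extendSum ψ s' P (g a) n := by
      funext n
      rw [extendSum_strict φ s h1, extendSum_strict ψ s' h2, Finset.mul_sum]
      refine Finset.sum_congr rfl fun j _ => ?_
      cases j with
      | zero => simp [hP]
      | succ j =>
        rw [h3]
        ring
    rw [List.foldl_cons, h4, foldl_extendSum_scale g σ k (fun b hb => h b (by simp [hb]))]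
    · simp [mul_assoc]
    · rw [extendSum_strict ψ s' h2, Finset.sum_range_zero]

end FoldScale

section Words

variable {K : Type*} [CommRing K] (ξ : ℕ → K)

theorem wordSum_word (k : List ℕ) :
    wordSum ξ (word k) = k.foldl (extendSum (fun a n => (ξ n - 1) * ξ n ^ (a - 1)) fun _ => True)
      (startSeq K) := by
  induction k using List.reverseRecOn with
  | nil =>
    funext N
    have : word [] = 1 := rfl
    rw [this]
    cases N with
    | zero => simp [wordSum, startSeq]
    | succ N => simp [wordSum_one, startSeq]
  | append_singleton k a ih =>
    funext N
    have : word (k ++ [a]) = word k * Y * X ^ (a - 1) := by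
      simp [word, mul_assoc]
    rw [List.foldl_append, ← ih, List.foldl_cons, List.foldl_nil, extendSum_strict _ _ trivial,
      this, wordSum]
    refine Finset.sum_congr rfl fun n _ => ?_
    rw [wordSeq_mul_X_pow, wordSeq_mul_Y]
    ring

/-- A word that begins with `x` kills the unit sequence at `0`, because `ξ_0 = 0`. -/
theorem wordSum_X_mul (h0 : ξ 0 = 0) (w : H) (N : ℕ) : wordSum ξ (X * w) N = 0 := by
  have h1 : opX ξ (Pi.single 0 1) = 0 := by
    funext n
    change ξ n * (Pi.single 0 1 : ℕ → K) n = 0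
    cases n with
    | zero => rw [h0, zero_mul]
    | succ n => simp
  have h2 : wordSeq ξ (X * w) = (wordAct ξ w).unop (opX ξ (Pi.single 0 1)) := by
    rw [wordSeq_apply, map_mul, X, wordAct, FreeAlgebra.lift_ι_apply]
    rfl
  rw [wordSum, h2, h1, map_zero]
  simp

theorem wordSum_add (w w' : H) (N : ℕ) : wordSum ξ (w + w') N = wordSum ξ w N + wordSum ξ w' N := by
  simp [wordSum, Finset.sum_add_distrib]

theorem wordSum_zsmul (z : ℤ) (w : H) (N : ℕ) : wordSum ξ (z • w) N = z * wordSum ξ w N := by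
  rw [wordSum, map_smul, wordSum, Finset.mul_sum]
  exact Finset.sum_congr rfl fun n _ => zsmul_eq_mul _ _

theorem wordSum_zero (N : ℕ) : wordSum ξ 0 N = 0 := by
  simp [wordSum]

end Words

section Decode

theorem basis_eq_prod (L : List Letter) :
    FreeAlgebra.basisFreeMonoid ℤ Letter (FreeMonoid.ofList L) =
      (L.map (FreeAlgebra.ι ℤ)).prod := by
  rw [FreeAlgebra.basisFreeMonoid]
  simp [FreeAlgebra.equivMonoidAlgebraFreeMonoid, MonoidAlgebra.lift_single, FreeMonoid.lift_apply]
  exact one_smul ℤ _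

theorem prod_eq_decode (L : List Letter) :
    (L.map (FreeAlgebra.ι ℤ)).prod = X ^ (decode L).1 * word (decode L).2 := by
  induction L with
  | nil => simp [decode, word]
  | cons a L ih =>
    rw [List.map_cons, List.prod_cons, ih]
    cases a with
    | x =>
      rw [decode, pow_succ', mul_assoc]
      rfl
    | y =>
      have h : word (((decode L).1 + 1) :: (decode L).2) =
          Y * X ^ (decode L).1 * word (decode L).2 := rfl
      rw [decode, pow_zero, one_mul, h, mul_assoc]
      rfl

theorem one_le_of_mem_decode (L : List Letter) : ∀ a ∈ (decode L).2, 1 ≤ a := by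
  induction L with
  | nil => simp [decode]
  | cons a L ih => cases a <;> simpa [decode] using ih

/-- A word that ends in `x` has no final entry `1`. -/
theorem decode_append_x (L : List Letter) : ((decode (L ++ [Letter.x])).2 = [] →
      1 ≤ (decode (L ++ [Letter.x])).1) ∧
    ∀ h : (decode (L ++ [Letter.x])).2 ≠ [], 2 ≤ (decode (L ++ [Letter.x])).2.getLast h := by
  induction L with
  | nil => simp [decode]
  | cons a L ih =>
    cases a with
    | x =>
      refine ⟨fun _ => ?_, ih.2⟩
      rw [List.cons_append, decode]
      omega
    | y =>
      refine ⟨fun h => by simp [decode] at h, fun h => ?_⟩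
      simp only [List.cons_append, decode]
      by_cases h1 : (decode (L ++ [Letter.x])).2 = []
      · have := ih.1 h1
        simp only [h1, List.getLast_singleton]
        omega
      · rw [List.getLast_cons h1]
        exact ih.2 h1

/-- A property of the elements of `𝔥` that is preserved by linear combinations holds if it holds
for the words. -/
theorem induction_words {p : H → Prop} (h0 : p 0) (hadd : ∀ u v, p u → p v → p (u + v))
    (hsmul : ∀ (z : ℤ) u, p u → p (z • u))
    (hword : ∀ L : List Letter, p (L.map (FreeAlgebra.ι ℤ)).prod) (w : H) : p w := by
  have hw := (FreeAlgebra.basisFreeMonoid ℤ Letter).mem_span w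
  induction hw using Submodule.span_induction with
  | mem u hu =>
    obtain ⟨L, rfl⟩ := hu
    have := hword L.toList
    rwa [← basis_eq_prod, FreeMonoid.ofList_toList] at this
  | zero => exact h0
  | add u v _ _ hu hv => exact hadd u v hu hv
  | smul z u _ hu => exact hsmul z u hu

theorem extend_prod (f : List ℕ → PowerSeries ℚ) (L : List Letter) :
    extend f (L.map (FreeAlgebra.ι ℤ)).prod = if (decode L).1 = 0 then f (decode L).2 else 0 := by
  rw [← basis_eq_prod]
  exact (FreeAlgebra.basisFreeMonoid ℤ Letter).constr_basis ℤ _ _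

theorem extend_zsmul (f : List ℕ → PowerSeries ℚ) (z : ℤ) (w : H) :
    extend f (z • w) = z * extend f w := by
  rw [map_smul]
  exact zsmul_eq_mul _ _

theorem theta_X : theta X = -X := FreeAlgebra.lift_ι_apply _ _

theorem theta_Y : theta Y = -Y := FreeAlgebra.lift_ι_apply _ _

theorem theta_word {k : List ℕ} (hk : ∀ a ∈ k, 1 ≤ a) :
    theta (word k) = (-1 : ℤ) ^ k.sum • word k := by
  induction k with
  | nil => simp [word]
  | cons a k ih =>
    obtain ⟨b, rfl⟩ := Nat.exists_eq_add_of_le' (hk a (by simp))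
    have ih := ih fun x hx => hk x (by simp [hx])
    have h1 : word ((b + 1) :: k) = Y * X ^ b * word k := rfl
    have h2 : (-X : H) ^ b = (-1 : ℤ) ^ b • X ^ b := by
      rw [neg_pow, zsmul_eq_mul]
      simp
    rw [h1, map_mul, map_mul, map_pow, ih, theta_X, theta_Y, h2, List.sum_cons, pow_add, pow_succ,
      mul_smul_comm, mul_smul_comm, smul_mul_assoc, neg_mul, neg_mul, smul_neg, smul_neg, smul_smul,
      ← neg_smul]
    congr 1
    ring

end Decode

section Limits

/-- The partial sums of a word tend to its image under `Z_q^†`. -/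
theorem tendsto_wordSum_dag (w : H) : Tendsto (wordSum (qSeq 0) w) atTop
    (𝓝 (extend (fun k => zetaDag (k.map Entry.int)) w)) := by
  induction w using induction_words with
  | h0 =>
    rw [map_zero]
    exact tendsto_const_nhds.congr fun N => (wordSum_zero _ N).symm
  | hadd u v hu hv =>
    rw [map_add]
    exact (hu.add hv).congr fun N => (wordSum_add _ u v N).symm
  | hsmul z u hu =>
    rw [extend_zsmul]
    exact (hu.const_mul _).congr fun N => (wordSum_zsmul _ z u N).symm
  | hword L =>
    rw [extend_prod, prod_eq_decode]
    have hk := one_le_of_mem_decode L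
    generalize (decode L).2 = k at *
    cases hm : (decode L).1 with
    | succ m =>
      rw [if_neg (by omega)]
      refine tendsto_const_nhds.congr fun N => ?_
      rw [pow_succ', mul_assoc, wordSum_X_mul _ (qSeq_index_zero 0)]
    | zero =>
      rw [if_pos rfl, pow_zero, one_mul, wordSum_word]
      refine (tendsto_zetaDag (k.map Entry.int) ?_).congr fun N => ?_
      · intro h
        rw [List.getLast_map]
        simp
      · have := foldl_extendSum_scale (φ := fun a n => (qSeq 0 n - 1) * qSeq 0 n ^ (a - 1))
          (ψ := dagFactor) (s := fun _ => True) (s' := fun a => a ≠ Entry.bar1) Entry.int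
          (fun _ => 1) k (fun a ha => ⟨trivial, by simp, fun n => ?_⟩)
          (startSeq (PowerSeries ℚ)) rfl 1 N
        · simpa using this.symm
        · obtain ⟨b, rfl⟩ := Nat.exists_eq_add_of_le' (hk a ha)
          rw [qSeq_zero, qInv_sub_one (by omega), dagFactor, ← qInv, pow_succ' _ b,
            Nat.add_sub_cancel]
          ring

theorem tendsto_wordSum_word_bz {k : List ℕ} (hk : ∀ a ∈ k, 1 ≤ a)
    (hlast : ∀ h : k ≠ [], 2 ≤ k.getLast h) : Tendsto (wordSum (qSeq 1) (word k)) atTop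
      (𝓝 (extend zetaBZ (theta (word k)))) := by
  rw [theta_word hk, extend_zsmul, extend_word _ k hk, wordSum_word]
  refine ((tendsto_zetaBZ k hlast).const_mul _).congr fun N => ?_
  have := foldl_extendSum_scale (φ := fun a n => (qSeq 1 n - 1) * qSeq 1 n ^ (a - 1))
    (ψ := bzFactor) (s := fun _ => True) (s' := fun _ => True) id
    (fun a => (-1) ^ a) k (fun a ha => ⟨trivial, trivial, fun n => ?_⟩)
    (startSeq (PowerSeries ℚ)) rfl 1 N
  · have h1 : (k.map fun a => (-1 : PowerSeries ℚ) ^ a).prod = (-1) ^ k.sum := by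
      clear hk hlast this
      induction k with
      | nil => simp
      | cons a k ih => rw [List.map_cons, List.prod_cons, ih, List.sum_cons, pow_add]
    rw [h1] at this
    simpa using this.symm
  · obtain ⟨b, rfl⟩ := Nat.exists_eq_add_of_le' (hk a ha)
    have h1 : qSeq 1 (n + 1) - 1 = -qInv (n + 1) := by
      rw [qSeq_one]
      linear_combination qInv_sub_one (show 1 ≤ n + 1 by omega)
    rw [h1, qSeq_one, bzFactor, ← qInv, pow_mul, id, Nat.add_sub_cancel]
    ring

/-- The partial sums of a word in `𝔥⁰` tend to its image under `Z_q^BZ ∘ θ`. -/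
theorem tendsto_wordSum_bz {w : H} (hw : w ∈ H0) : Tendsto (wordSum (qSeq 1) w) atTop
    (𝓝 (extend zetaBZ (theta w))) := by
  obtain ⟨_, h1, _, ⟨v, rfl⟩, rfl⟩ := Submodule.mem_sup.1 hw
  obtain ⟨z, rfl⟩ := Submodule.mem_span_singleton.1 h1
  have hone : Tendsto (wordSum (qSeq 1) 1) atTop (𝓝 (extend zetaBZ (theta 1))) :=
    tendsto_wordSum_word_bz (k := []) (by simp) (by simp)
  have hv : Tendsto (wordSum (qSeq 1) (Y * (v * X))) atTop
      (𝓝 (extend zetaBZ (theta (Y * (v * X))))) := by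
    clear hw h1
    induction v using induction_words with
    | h0 =>
      rw [zero_mul, mul_zero, map_zero, map_zero]
      exact tendsto_const_nhds.congr fun N => (wordSum_zero _ N).symm
    | hadd u v hu hv =>
      rw [add_mul, mul_add, map_add, map_add]
      exact (hu.add hv).congr fun N => (wordSum_add _ _ _ N).symm
    | hsmul z u hu =>
      rw [smul_mul_assoc, mul_smul_comm, map_smul, extend_zsmul]
      exact (hu.const_mul _).congr fun N => (wordSum_zsmul _ z _ N).symm
    | hword L =>
      have h2 : Y * ((L.map (FreeAlgebra.ι ℤ)).prod * X) =
          ((Letter.y :: L ++ [Letter.x]).map (FreeAlgebra.ι ℤ)).prod := by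
        simp [X, Y]
      rw [h2, prod_eq_decode]
      have h3 : (decode (Letter.y :: L ++ [Letter.x])).1 = 0 := by
        rw [List.cons_append, decode]
      rw [h3, pow_zero, one_mul]
      exact tendsto_wordSum_word_bz (one_le_of_mem_decode _) (decode_append_x (Letter.y :: L)).2
  rw [map_add, map_add, map_smul, extend_zsmul]
  refine ((hone.const_mul _).add hv).congr fun N => ?_
  rw [← wordSum_zsmul, ← wordSum_add]
  rfl

end Limits

/-! ### Membership in `𝔥¹` and in `𝔥^{≥2}` -/

section Membership

theorem mem_map_mulLeft {A : Subalgebra ℤ H} {a w : H} :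
    w ∈ (Subalgebra.toSubmodule A).map (LinearMap.mulLeft ℤ a) ↔ ∃ u ∈ A, a * u = w :=
  Iff.rfl

theorem mul_mem_map_mulLeft {A : Subalgebra ℤ H} {a w u : H}
    (hw : w ∈ (Subalgebra.toSubmodule A).map (LinearMap.mulLeft ℤ a)) (hu : u ∈ A) :
    w * u ∈ (Subalgebra.toSubmodule A).map (LinearMap.mulLeft ℤ a) := by
  obtain ⟨v, hv, rfl⟩ := mem_map_mulLeft.1 hw
  exact mem_map_mulLeft.2 ⟨v * u, mul_mem hv hu, (mul_assoc _ _ _).symm⟩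

/-- If the subalgebra `A` contains `x` and all `y x^i` with `i ≥ ε`, and `a A` contains the latter
as well, then the words `𝔈_q^ε(c)` with `c ≠ ∅` lie in `a A`. -/
theorem EE_mem {e : ℕ} (he : e ≤ 1) {A : Subalgebra ℤ H} {a : H} (hX : X ∈ A)
    (hA : ∀ i, e ≤ i → Y * X ^ i ∈ A)
    (ha : ∀ i, e ≤ i → Y * X ^ i ∈ (Subalgebra.toSubmodule A).map (LinearMap.mulLeft ℤ a)) :
    ∀ (c : List ℕ) (r : ℕ), c.length = 2 * r → (∀ b ∈ c, 1 ≤ b) → c ≠ [] →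
      EE e c ∈ (Subalgebra.toSubmodule A).map (LinearMap.mulLeft ℤ a) := by
  intro c
  induction hs : c.sum using Nat.strong_induction_on generalizing c with
  | _ s ih =>
  subst hs
  intro r hlen hc hne
  have hr : c.length / 2 = r := by omega
  have hB : ∀ B ∈ (posGt c).powerset.filter (fun B => B.Nonempty),
      EE e (modify c ∅ B) ∈ (Subalgebra.toSubmodule A).map (LinearMap.mulLeft ℤ a) ∧
        1 ≤ alpha r B ∧ 1 ≤ beta r B := by
    intro B hB
    obtain ⟨h1, h2⟩ := Finset.mem_filter.1 hB
    have h1 := Finset.mem_powerset.1 h1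
    have h3 := h1.trans (posGt_subset hlen)
    refine ⟨ih _ (modify_sum_lt (Finset.empty_subset _) h1 (Or.inr h2)) _ rfl r
      ((length_modify_empty c B).trans hlen) (one_le_of_mem_modify hc ∅ h1) ?_,
      alpha_pos h3 h2, beta_pos h3 h2⟩
    rw [← List.length_pos_iff_ne_nil, length_modify_empty]
    exact List.length_pos_iff_ne_nil.2 hne
  rw [EE_eq e hne, hr]
  refine add_mem (add_mem (neg_mem (sum_mem fun B hB' => zsmul_mem ?_ _))
    (sum_mem fun B hB' => zsmul_mem ?_ _))
    (sum_mem fun T hT => sum_mem fun B hB' => sum_mem fun h hh => zsmul_mem ?_ _)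
  · exact mul_mem_map_mulLeft (hB B hB').1 (pow_mem hX _)
  · obtain ⟨h1, h2, h3⟩ := hB B hB'
    refine mul_mem_map_mulLeft h1 (sub_mem (sum_mem fun h hh => hA _ ?_)
      (sum_mem fun h hh => hA _ ?_))
    · have := Finset.mem_Ioc.1 hh
      omega
    · have := Finset.mem_Ioc.1 hh
      omega
  · obtain ⟨hT1, hT2, hT3⟩ := Finset.mem_filter.1 hT
    have hB' := Finset.mem_powerset.1 hB'
    have hk := kappa_pos hT1 hT2
    have hh := Finset.mem_Icc.1 hh
    have hexp : e ≤ h + e * kappa T + betaA r T B - 1 := by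
      have := Nat.le_mul_of_pos_right e hk
      omega
    by_cases hnil : modify c T B = []
    · rw [hnil, EE_nil, one_mul]
      exact ha _ hexp
    · obtain ⟨r', hr'⟩ := modify_length_even hlen hc hT1 hB'
      rw [mul_assoc]
      exact mul_mem_map_mulLeft (ih _ (modify_sum_lt hT3 hB' (Or.inl hT2)) _ rfl r' hr'
        (one_le_of_mem_modify hc T hB') hnil) (hA _ hexp)

theorem wordE_mem {c : List ℕ} {r : ℕ} (hlen : c.length = 2 * r) (hc : ∀ b ∈ c, 1 ≤ b) :
    wordE c ∈ H1 := by
  by_cases hnil : c = []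
  · rw [hnil, wordE, EE_nil]
    exact Submodule.mem_sup_left (Submodule.mem_span_singleton_self 1)
  · have h := EE_mem (e := 0) (by omega) (A := ⊤) (a := Y) trivial (fun _ _ => trivial)
      (fun i _ => mem_map_mulLeft.2 ⟨X ^ i, trivial, rfl⟩) c r hlen hc hnil
    obtain ⟨u, -, hu⟩ := mem_map_mulLeft.1 h
    exact Submodule.mem_sup_right ⟨u, hu⟩

theorem EE_one_mem {c : List ℕ} {r : ℕ} (hlen : c.length = 2 * r) (hc : ∀ b ∈ c, 1 ≤ b) :
    EE 1 c ∈ Hge2 := by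
  by_cases hnil : c = []
  · rw [hnil, EE_nil]
    exact Submodule.mem_sup_left (Submodule.mem_span_singleton_self 1)
  · have hX : X ∈ Algebra.adjoin ℤ ({X, Y * X} : Set H) := Algebra.subset_adjoin (by simp)
    have hYX : Y * X ∈ Algebra.adjoin ℤ ({X, Y * X} : Set H) := Algebra.subset_adjoin (by simp)
    have hpow : ∀ i, 1 ≤ i → Y * X ^ i = Y * X * X ^ (i - 1) := by
      intro i hi
      obtain ⟨j, rfl⟩ := Nat.exists_eq_add_of_le' hi
      rw [pow_succ', mul_assoc, Nat.add_sub_cancel]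
    exact Submodule.mem_sup_right (EE_mem (e := 1) le_rfl hX
      (fun i hi => by rw [hpow i hi]; exact mul_mem hYX (pow_mem hX _))
      (fun i hi => mem_map_mulLeft.2 ⟨X ^ (i - 1), pow_mem hX _, (hpow i hi).symm⟩)
      c r hlen hc hnil)

theorem theta_mem_Hge2 {w : H} (hw : w ∈ Hge2) : theta w ∈ Hge2 := by
  have hA : ∀ u ∈ Algebra.adjoin ℤ ({X, Y * X} : Set H),
      theta u ∈ Algebra.adjoin ℤ ({X, Y * X} : Set H) := by
    intro u hu
    induction hu using Algebra.adjoin_induction with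
    | mem v hv =>
      rcases hv with rfl | rfl
      · rw [theta_X]
        exact neg_mem (Algebra.subset_adjoin (by simp))
      · rw [map_mul, theta_X, theta_Y, neg_mul_neg]
        exact Algebra.subset_adjoin (by simp)
    | algebraMap z =>
      rw [AlgHom.commutes]
      exact Subalgebra.algebraMap_mem _ z
    | add u v _ _ hu hv =>
      rw [map_add]
      exact add_mem hu hv
    | mul u v _ _ hu hv =>
      rw [map_mul]
      exact mul_mem hu hv
  obtain ⟨_, h1, _, ⟨v, hv, rfl⟩, rfl⟩ := Submodule.mem_sup.1 hw
  obtain ⟨z, rfl⟩ := Submodule.mem_span_singleton.1 h1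
  rw [map_add, map_smul, map_one]
  refine add_mem (Submodule.mem_sup_left (Submodule.mem_span_singleton.2 ⟨z, rfl⟩))
    (Submodule.mem_sup_right ⟨theta v, hA v hv, ?_⟩)
  rw [LinearMap.mulLeft_apply, LinearMap.mulLeft_apply, map_mul, map_mul, theta_X, theta_Y,
    neg_mul_neg]

end Membership

end QMZV

open QMZV
theorem theorem1p1 (r : ℕ) (l k : Fin r → ℕ) (hl : ∀ j, 1 ≤ l j) (hk : ∀ j, 1 ≤ k j) :
    (∃ hE : wordE (interleave l k) ∈ H1,
      zetaDag (dagIndex l k) = ZDag ⟨wordE (interleave l k), hE⟩) ∧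
    (∃ hD : wordD (interleave l k) ∈ Hge2,
      zetaBZ (bzIndex l k) = ZBZ ⟨wordD (interleave l k), Hge2_le_H0 hD⟩) := by
  set p : List (ℕ × ℕ) := List.ofFn fun j => (l j, k j) with hp
  have hpos : ∀ x ∈ p, 1 ≤ x.1 ∧ 1 ≤ x.2 := by
    intro x hx
    obtain ⟨j, rfl⟩ := List.mem_ofFn.1 hx
    exact ⟨hl j, hk j⟩
  have h1 : interleave l k = p.flatMap fun x => [x.1, x.2] := by
    rw [hp, interleave, List.flatMap_def, List.map_ofFn]
    rfl
  have h2 : dagIndex l k = blockIndex Entry.bar1 Entry.int p := by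
    rw [hp, dagIndex, blockIndex, List.flatMap_def, List.map_ofFn]
    rfl
  have h3 : bzIndex l k = blockIndex 1 (fun k => k + 1) p := by
    rw [hp, bzIndex, blockIndex, List.flatMap_def, List.map_ofFn]
    rfl
  have hlen : (p.flatMap fun x => [x.1, x.2]).length = 2 * p.length := by
    rw [List.length_flatMap]
    simp [mul_comm]
  have hc : ∀ a ∈ p.flatMap fun x => [x.1, x.2], 1 ≤ a := by
    intro a ha
    obtain ⟨x, hx, ha⟩ := List.mem_flatMap.1 ha
    have := hpos x hx
    simp only [List.mem_cons, List.not_mem_nil, or_false] at ha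
    omega
  have hD := EE_one_mem hlen hc
  rw [h1, h2, h3]
  refine ⟨⟨wordE_mem hlen hc, ?_⟩, ⟨zsmul_mem (theta_mem_Hge2 hD) _, ?_⟩⟩
  · refine tendsto_nhds_unique (tendsto_coeffSum_dag p hpos) ?_
    refine (tendsto_wordSum_dag _).congr fun N => ?_
    exact wordSum_EE (Or.inl rfl) (qSeq_index_zero 0) (qSeq_mul 0) N _ _ hlen hc
  · have h4 := tendsto_nhds_unique (tendsto_coeffSum_bz p hpos)
      ((tendsto_wordSum_bz (Hge2_le_H0 hD)).congr fun N =>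
        wordSum_EE (Or.inr rfl) (qSeq_index_zero 1) (qSeq_mul 1) N _ _ hlen hc)
    have h5 : ZBZ ⟨wordD (p.flatMap fun x => [x.1, x.2]),
        Hge2_le_H0 (zsmul_mem (theta_mem_Hge2 hD) _)⟩ =
        (-1) ^ (p.flatMap fun x => [x.1, x.2]).sum *
          extend zetaBZ (theta (EE 1 (p.flatMap fun x => [x.1, x.2]))) := by
      have := extend_zsmul zetaBZ ((-1) ^ (p.flatMap fun x => [x.1, x.2]).sum)
        (theta (EE 1 (p.flatMap fun x => [x.1, x.2])))
      rw [Int.cast_pow, Int.cast_neg, Int.cast_one] at this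
      exact this
    rw [h5, ← h4, ← mul_assoc, ← mul_pow, neg_one_mul, neg_neg, one_pow, one_mul]
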